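/- **Conventions.** Let $\mu\subseteq\lambda$ be partitions such that the skew diagram $[\lambda/\mu]$ is (edgewise) connected, let $\lambda',\mu'$ be the conjugate partitions, and let a cell $(i,j)$ (row $i$, column $j$, matrix convention) have content $c(i,j)=j-i$. For finite alphabets put $e_n(\mathbf u/\mathbf v)=\sum_{i=0}^n(-1)^{n-i}e_i(\mathbf u)h_{n-i}(\mathbf v)$ (and $e_n=0$ for $n<0$), and write $\overline{\mathbf u}=-\mathbf u$, $\mathbf u_n=(u_1,\dots,u_n)$, $\mathbf y_{p,q}=(y_p,\dots,y_q)$ (empty if $p>q$). The dual refined canonical stable Grothendieck polynomial is $$g_{\lambda/\mu}(\mathbf x_m;\boldsymbol\alpha,\boldsymbol\beta)=\det\Big[e_{\lambda'_i-i-\mu'_j+j}\big(\mathbf x_m,\overline{\boldsymbol\alpha}_{j-1},\boldsymbol\beta_{\lambda'_i-1}\,/\,\overline{\boldsymbol\alpha}_{i-1},\boldsymbol\beta_{\mu'_j}\big)\Big]_{1\le i,j\le n},\qquad n\ge\lambda_1.$$ An *r-shape* is a skew shape $\kappa/\nu$ with root content $r\in\mathbb Z$; its cell $(i,j)$ has content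 $j-i+r-1+\kappa'_1$ (the usual shape has $r=1-\kappa'_1$). *Column flags* of $\kappa/\nu$ are integer vectors $\mathbf a,\mathbf b$ with $a_i-a_{i+1}\le\nu'_i-\nu'_{i+1}+1$ and $b_i-b_{i+1}\le\kappa'_i-\kappa'_{i+1}+1$ whenever $\nu'_i<\kappa'_{i+1}$. For column flags the *flagged dual Grothendieck enumerator* is $$\mathsf g^{\mathbf a,\mathbf b}_{\kappa/\nu}(\mathbf x_m;\boldsymbol\alpha,\boldsymbol\beta)=\det\Big[e_{\kappa'_i-i-\nu'_j+j}\big(\mathbf y_{a_j,b_i}/\mathbf z_{a'_j,b'_i}\big)\Big]_{1\le i,j\le\kappa_1},$$ where $a'_j=a_j+(\text{content of the top cell of column }j)$, $b'_i=b_i+(\text{content of the bottom cell of column }i)$, and $y_i=x_i,\ z_i=0$ for $1\le i\le m$; $y_i=\beta_{i-m},\ z_i=-\alpha_{i-m}$ for $i>m$; $y_i=-\alpha_{1-i},\ z_i=\beta_{1-i}$ for $i\le0$. A *ribbon* is a nonempty connected skew diagram with no $2\times2$ block; its *head* is its bottom-left cell and its *tail* its top-right cell. An *outer ribbon decomposition*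 $(\theta_1,\dots,\theta_k)$ of $\lambda/\mu$ is a partition of its diagram into ribbons such that each head has no left neighbour or no lower neighbour in $[\lambda/\mu]$ and each tail has no upper neighbour or no right neighbour in $[\lambda/\mu]$. A cell $\gamma\in\theta_i$ *goes up* if the cell above it is in $\theta_i$, or if $\gamma$ is the tail of $\theta_i$ and has no upper neighbour in $[\lambda/\mu]$; it *goes right* if the cell to its right is in $\theta_i$, or if it is the tail of $\theta_i$ and has no right neighbour in $[\lambda/\mu]$. All cells of a given content, other than the largest content occurring in $\lambda/\mu$, go in the same direction. For contents $p\le q$ of cells of $\lambda/\mu$ let $\Theta(p,q)$ be the ribbon with one cell of each content in $[p,q]$, root content $p$, in which the cell of content $c+1$ lies above (resp. to the right of) the cell of content $c$ if the cells of content $c$ in $\lambda/\mu$ go up (resp. right); $\Theta(q+1,q)=\varnothing$, and $\Theta(p,q)$ is undefined for $p>q+1$. Put $\theta_i\#\theta_j=\Theta(c(\delta_i),c(\gamma_j))$, where $\delta_i$ is the head of $\theta_i$ and $\gamma_j$ the tail of $\theta_j$. Let $\rho^{ij}_1,\dots,\rho^{ij}_{k^{ij}}$ be the columns of $\theta_i\#\theta_j$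 from left to right, let $m^{ij}_r$ be the leftmost cell of $\lambda/\mu$ with the content of the top cell of $\rho^{ij}_r$, and $M^{ij}_r$ the rightmost cell of $\lambda/\mu$ with the content of the bottom cell of $\rho^{ij}_r$. The *induced ribbon flags* of $\mathbf a,\mathbf b$ are $$a^{ij}_r=a_{\mathrm{col}(m^{ij}_r)}-(\mu'_{\mathrm{col}(m^{ij}_r)}+1)+\mathrm{row}(m^{ij}_r),\qquad b^{ij}_r=b_{\mathrm{col}(M^{ij}_r)}-\lambda'_{\mathrm{col}(M^{ij}_r)}+\mathrm{row}(M^{ij}_r)\qquad(1\le r\le k^{ij}).$$ **Corollary** (Hamel--Goulden formulas for dual refined canonical stable Grothendieck polynomials). Let $m\ge0$, let $(\theta_1,\dots,\theta_k)$ be an outer ribbon decomposition of the connected skew shape $\lambda/\mu$, and let $a_i=-i+2$, $b_i=\lambda'_i+m-1$. Then $\mathbf a,\mathbf b$ are column flags of $\lambda/\mu$, the induced ribbon flags $\mathbf a^{ij},\mathbf b^{ij}$ are column flags of $\theta_i\#\theta_j$ and are given by $$a^{ij}_r=-c(m^{ij}_r)-\mu'_{\mathrm{col}(m^{ij}_r)}+1,\qquad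 b^{ij}_r=\mathrm{row}(M^{ij}_r)+m-1\qquad(1\le r\le k^{ij}),$$ and $$g_{\lambda/\mu}(\mathbf x_m;\boldsymbol\alpha,\boldsymbol\beta)=\det\Big[\mathsf g^{\mathbf a^{ij},\mathbf b^{ij}}_{\theta_i\#\theta_j}(\mathbf x_m;\boldsymbol\alpha,\boldsymbol\beta)\Big]_{1\le i,j\le k},$$ where the $(i,j)$ entry is $1$ if $\theta_i\#\theta_j=\varnothing$ and $0$ if $\theta_i\#\theta_j$ is undefined. -/

import Mathlib

namespace HamelGoulden

/-! Cells are pairs `(row, column)` of natural numbers counted from `0` (as in `YoungDiagram`): the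
cell in row `i` and column `j`, counted from `1` as in a matrix, is the pair `(i - 1, j - 1)`. Columns
and flags are likewise indexed from `0`, so that `λ'_j`, `μ'_j`, `a_j`, `b_j` (with `j` counted from
`1`) are `lam.colLen (j - 1)`, `mu.colLen (j - 1)`, `a (j - 1)`, `b (j - 1)`. The formulas displayed
in comments count from `1`. The sequences of variables `x`, `α`, `β : ℕ → R` are counted from `1`; their
value at `0` is never used. -/

/-! ### Supersymmetric functions -/

section Supersymmetric

variable {R : Type*} [CommRing R]

/-- `e_n(u / v) = ∑_{i + k = n} (-1)^k e_i(u) h_k(v)` for finite alphabets `u`, `v`;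
it is `0` for `n < 0`. -/
noncomputable def superElem {ι κ : Type*} [Fintype ι] [DecidableEq ι] [Fintype κ] [DecidableEq κ]
    (u : ι → R) (v : κ → R) (n : ℤ) : R :=
  if 0 ≤ n then
    ∑ p ∈ Finset.HasAntidiagonal.antidiagonal n.toNat,
      (-1) ^ p.2 * MvPolynomial.aeval u (MvPolynomial.esymm ι ℤ p.1) *
        MvPolynomial.aeval v (MvPolynomial.hsymm κ ℤ p.2)
  else 0

/-- The alphabet `y_{a,b} = (y_a, …, y_b)`, empty if `b < a`. -/
def interval (y : ℤ → R) (a b : ℤ) : Finset.Icc a b → R := fun t => y t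

/-- The alphabet `x_n = (x_1, …, x_n)`. -/
def initial (x : ℕ → R) (n : ℕ) : Fin n → R := fun t => x (t + 1)

end Supersymmetric

/-! ### Shapes with shifted contents -/

/-- A skew shape `lam / mu` together with a root content: an r-shape. -/
structure RShape where
  lam : YoungDiagram
  mu : YoungDiagram
  le : mu ≤ lam
  root : ℤ

namespace RShape

/-- The usual skew shape, an r-shape with root content `1 - λ'_1`. -/
def usual (lam mu : YoungDiagram) (h : mu ≤ lam) : RShape := ⟨lam, mu, h, 1 - lam.colLen 0⟩

/-- The diagram of the skew shape. -/
def cells (D : RShape) : Finset (ℕ × ℕ) := D.lam.cells \ D.mu.cells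

/-- The shifted content `c(i, j) = j - i + r - 1 + λ'_1`. -/
def content (D : RShape) (γ : ℕ × ℕ) : ℤ := (γ.2 : ℤ) - γ.1 + D.root - 1 + D.lam.colLen 0

/-- The number `λ_1` of columns. -/
def numCols (D : RShape) : ℕ := D.lam.rowLen 0

/-- The content of the top cell (in row `μ'_j + 1`, counted from `1`) of a column. -/
def topContent (D : RShape) (j : ℕ) : ℤ :=
  (j : ℤ) - D.mu.colLen j + D.root - 1 + D.lam.colLen 0

/-- The content of the bottom cell (in row `λ'_j`, counted from `1`) of a column. -/
def botContent (D : RShape) (j : ℕ) : ℤ :=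
  (j : ℤ) - ((D.lam.colLen j : ℤ) - 1) + D.root - 1 + D.lam.colLen 0

/-- The cells of given content. -/
def diagonal (D : RShape) (c : ℤ) : Finset (ℕ × ℕ) := D.cells.filter fun γ => D.content γ = c

/-- `max(c)`: the rightmost cell of content `c` (both coordinates increase along a diagonal). -/
def rightmost (D : RShape) (c : ℤ) : ℕ × ℕ :=
  ((D.diagonal c).sup Prod.fst, (D.diagonal c).sup Prod.snd)

/-- `min(c)`: the leftmost cell of content `c`. -/
def leftmost (D : RShape) (c : ℤ) : ℕ × ℕ :=
  ((((D.diagonal c).image Prod.fst).min).untopD 0, (((D.diagonal c).image Prod.snd).min).untopD 0)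

/-- Column flags. -/
def IsColumnFlags (D : RShape) (a b : ℕ → ℤ) : Prop :=
  ∀ i : ℕ, D.mu.colLen i < D.lam.colLen (i + 1) →
    a i - a (i + 1) ≤ (D.mu.colLen i : ℤ) - D.mu.colLen (i + 1) + 1 ∧
    b i - b (i + 1) ≤ (D.lam.colLen i : ℤ) - D.lam.colLen (i + 1) + 1

/-- The flagged supersymmetric Schur function
`det [e_{λ'_i - i - μ'_j + j}(y_{a_j, b_i} / z_{a'_j, b'_i})]`, where `a'_j`, `b'_i` are the conjugate
flags. -/
noncomputable def flaggedSchur {R : Type*} [CommRing R] (D : RShape) (a b : ℕ → ℤ) (y z : ℤ → R) : R :=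
  Matrix.det (Matrix.of fun i j : Fin D.numCols =>
    superElem (interval y (a j) (b i))
      (interval z (a j + D.topContent j) (b i + D.botContent i))
      ((D.lam.colLen i : ℤ) - (i : ℕ) - D.mu.colLen j + (j : ℕ)))

/-- The smallest Young diagram containing a finite set of cells. -/
def hull (C : Finset (ℕ × ℕ)) : YoungDiagram where
  cells := C.biUnion fun d => Finset.Iic d
  isLowerSet := by
    intro γ δ h hγ
    simp only [Finset.coe_biUnion, Finset.coe_Iic, Set.mem_iUnion, Set.mem_Iic] at hγ ⊢
    obtain ⟨d, hd, hle⟩ := hγ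
    exact ⟨d, hd, h.trans hle⟩

/-- The cells of `hull C` that are not weakly south-east of a cell of `C`. -/
def innerHull (C : Finset (ℕ × ℕ)) : YoungDiagram where
  cells := (hull C).cells.filter fun γ => ∀ d ∈ C, ¬ d ≤ γ
  isLowerSet := by
    intro γ δ h hγ
    simp only [Finset.coe_filter, Set.mem_ofPred_eq] at hγ ⊢
    exact ⟨(hull C).isLowerSet h hγ.1, fun d hd hle => hγ.2 d hd (hle.trans h)⟩

/-- The r-shape with set of cells `C` (for `C` the diagram of a skew shape) and root content `r`. -/
def ofCells (C : Finset (ℕ × ℕ)) (r : ℤ) : RShape where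
  lam := hull C
  mu := innerHull C
  le := fun _ h => (Finset.mem_filter.mp h).1
  root := r

end RShape

/-! ### Dual Grothendieck polynomials and the `g`-specialization -/

section Grothendieck

variable {R : Type*} [CommRing R]

/-- The specialization of the variables `y_i`, `i ∈ ℤ`. -/
def gY (m : ℕ) (x α β : ℕ → R) (i : ℤ) : R :=
  if i ≤ 0 then -α (1 - i).toNat else if i ≤ m then x i.toNat else β (i - m).toNat

/-- The specialization of the variables `z_i`, `i ∈ ℤ`. -/
def gZ (m : ℕ) (α β : ℕ → R) (i : ℤ) : R :=
  if i ≤ 0 then β (1 - i).toNat else if i ≤ m then 0 else -α (i - m).toNat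

/-- The flagged dual Grothendieck enumerator `g^{a,b}_D(x_m; α, β)`. -/
noncomputable def flaggedG (D : RShape) (a b : ℕ → ℤ) (m : ℕ) (x α β : ℕ → R) : R :=
  D.flaggedSchur a b (gY m x α β) (gZ m α β)

/-- The dual refined canonical stable Grothendieck polynomial `g_{λ/μ}(x_m; α, β)` as the `n × n`
determinant of the `e_{λ'_i - i - μ'_j + j}(x_m, -α_{j-1}, β_{λ'_i - 1} / -α_{i-1}, β_{μ'_j})`
(`i`, `j` counted from `1`), for any `n ≥ λ_1`. -/
noncomputable def dualGrothendieck (n : ℕ) (lam mu : YoungDiagram) (m : ℕ) (x α β : ℕ → R) : R :=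
  Matrix.det (Matrix.of fun i j : Fin n =>
    superElem
      (Sum.elim (initial x m) (Sum.elim (initial (-α) j) (initial β (lam.colLen i - 1))))
      (Sum.elim (initial (-α) i) (initial β (mu.colLen j)))
      ((lam.colLen i : ℤ) - (i : ℕ) - mu.colLen j + (j : ℕ)))

end Grothendieck

/-! ### Outer ribbon decompositions -/

/-- Two cells are adjacent if they share an edge. -/
def cellGraph : SimpleGraph (ℕ × ℕ) :=
  SimpleGraph.fromRel fun γ δ => δ = (γ.1 + 1, γ.2) ∨ δ = (γ.1, γ.2 + 1)

/-- A ribbon: a connected skew diagram without a `2 × 2` block. -/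
structure IsRibbon (θ : Finset (ℕ × ℕ)) : Prop where
  skew : ∃ ν κ : YoungDiagram, κ ≤ ν ∧ θ = ν.cells \ κ.cells
  connected : (cellGraph.induce (θ : Set (ℕ × ℕ))).Connected
  no_block : ∀ i j : ℕ, ¬ ((i, j) ∈ θ ∧ (i, j + 1) ∈ θ ∧ (i + 1, j) ∈ θ ∧ (i + 1, j + 1) ∈ θ)

/-- The head of a ribbon: its bottom leftmost cell. -/
def head (θ : Finset (ℕ × ℕ)) : ℕ × ℕ := (θ.sup Prod.fst, ((θ.image Prod.snd).min).untopD 0)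

/-- The tail of a ribbon: its top rightmost cell. -/
def tail (θ : Finset (ℕ × ℕ)) : ℕ × ℕ := (((θ.image Prod.fst).min).untopD 0, θ.sup Prod.snd)

namespace RShape

/-- The diagram is edgewise connected (the empty diagram is admitted). -/
def IsConnected (D : RShape) : Prop := (cellGraph.induce (D.cells : Set (ℕ × ℕ))).Preconnected

/-- The cell `γ` has no left neighbour in the diagram. -/
def OnLeft (D : RShape) (γ : ℕ × ℕ) : Prop := γ.2 = 0 ∨ (γ.1, γ.2 - 1) ∉ D.cells

/-- The cell `γ` has no lower neighbour in the diagram. -/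
def OnBottom (D : RShape) (γ : ℕ × ℕ) : Prop := (γ.1 + 1, γ.2) ∉ D.cells

/-- The cell `γ` has no upper neighbour in the diagram. -/
def OnTop (D : RShape) (γ : ℕ × ℕ) : Prop := γ.1 = 0 ∨ (γ.1 - 1, γ.2) ∉ D.cells

/-- The cell `γ` has no right neighbour in the diagram. -/
def OnRight (D : RShape) (γ : ℕ × ℕ) : Prop := (γ.1, γ.2 + 1) ∉ D.cells

/-- `(θ_1, …, θ_k)` is an outer ribbon decomposition of the shape. -/
structure IsOuterDecomposition (D : RShape) {k : ℕ} (θ : Fin k → Finset (ℕ × ℕ)) : Prop where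
  ribbon : ∀ i, IsRibbon (θ i)
  disjoint : ∀ i j, i ≠ j → Disjoint (θ i) (θ j)
  cover : Finset.univ.biUnion θ = D.cells
  head_perimeter : ∀ i, D.OnLeft (head (θ i)) ∨ D.OnBottom (head (θ i))
  tail_perimeter : ∀ i, D.OnTop (tail (θ i)) ∨ D.OnRight (tail (θ i))

section CuttingStrip

variable (D : RShape) {k : ℕ} (θ : Fin k → Finset (ℕ × ℕ))

/-- A cell of content `c` goes up: the cell above it is in the same ribbon, or it is the tail of its
ribbon and lies on the top perimeter. In a connected shape all cells of content `c` that do not go up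
go right. (The direction of the top-right cell of the shape is never used below.) -/
def GoesUp (c : ℤ) : Prop :=
  ∃ i, ∃ γ ∈ θ i, D.content γ = c ∧
    ((0 < γ.1 ∧ (γ.1 - 1, γ.2) ∈ θ i) ∨ (γ = tail (θ i) ∧ D.OnTop γ))

instance : DecidablePred (D.GoesUp θ) := fun c => by
  unfold GoesUp OnTop
  infer_instance

/-- Number of cells of the cutting strip with content in `[p, c)` that go up. -/
noncomputable def upSteps (p c : ℤ) : ℕ := ((Finset.Ico p c).filter fun s => D.GoesUp θ s).card

/-- Number of cells of the cutting strip with content in `[p, c)` that go right. -/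
noncomputable def rightSteps (p c : ℤ) : ℕ := ((Finset.Ico p c).filter fun s => ¬ D.GoesUp θ s).card

/-- The part `Θ(p, q)` of the cutting strip with contents in `[p, q]`, as an r-shape with root content
`p`: the cell of content `c + 1` is above or to the right of the cell of content `c` according to the
direction of `c`. It is empty for `p > q`. -/
noncomputable def strip (p q : ℤ) : RShape :=
  ofCells ((Finset.Icc p q).image fun c => (D.upSteps θ c q, D.rightSteps θ p c)) p

/-- The content of the head `δ_i` of `θ_i`. -/
def headContent (i : Fin k) : ℤ := D.content (head (θ i))

/-- The content of the tail `γ_j` of `θ_j`. -/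
def tailContent (j : Fin k) : ℤ := D.content (tail (θ j))

/-- `θ_i # θ_j = Θ(c(δ_i), c(γ_j))`, meaningful if `HashDefined`. -/
noncomputable def hash (i j : Fin k) : RShape := D.strip θ (D.headContent θ i) (D.tailContent θ j)

/-- `θ_i # θ_j` is defined (possibly empty). -/
def HashDefined (i j : Fin k) : Prop := D.headContent θ i ≤ D.tailContent θ j + 1

instance (i j : Fin k) : Decidable (D.HashDefined θ i j) := by
  unfold HashDefined
  infer_instance

/-- `M^{ij}_r`: the rightmost cell of the shape whose content is that of the bottom cell of the
`r`-th vertical strip (column) of `θ_i # θ_j`. -/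
noncomputable def cellM (i j : Fin k) (r : ℕ) : ℕ × ℕ := D.rightmost ((D.hash θ i j).botContent r)

/-- `m^{ij}_r`: the leftmost cell of the shape whose content is that of the top cell of the
`r`-th vertical strip (column) of `θ_i # θ_j`. -/
noncomputable def cellm (i j : Fin k) (r : ℕ) : ℕ × ℕ := D.leftmost ((D.hash θ i j).topContent r)

/-- The induced ribbon flag `a^{ij}_r = a_{col(m)} - (μ'_{col(m)} + 1) + row(m)`, `m = m^{ij}_r`. -/
noncomputable def inducedA (a : ℕ → ℤ) (i j : Fin k) (r : ℕ) : ℤ :=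
  a (D.cellm θ i j r).2 - ((D.mu.colLen (D.cellm θ i j r).2 : ℤ) + 1) +
    (((D.cellm θ i j r).1 : ℤ) + 1)

/-- The induced ribbon flag `b^{ij}_r = b_{col(M)} - λ'_{col(M)} + row(M)`, `M = M^{ij}_r`. -/
noncomputable def inducedB (b : ℕ → ℤ) (i j : Fin k) (r : ℕ) : ℤ :=
  b (D.cellM θ i j r).2 - (D.lam.colLen (D.cellM θ i j r).2 : ℤ) + (((D.cellM θ i j r).1 : ℤ) + 1)

/-- The enumerator of `θ_i # θ_j` with the induced ribbon flags: it is `1` if `θ_i # θ_j` is empty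
(a `0 × 0` determinant), and `0` if `θ_i # θ_j` is undefined. -/
noncomputable def ribbonG {R : Type*} [CommRing R] (a b : ℕ → ℤ) (m : ℕ) (x α β : ℕ → R)
    (i j : Fin k) : R :=
  if D.HashDefined θ i j then
    flaggedG (D.hash θ i j) (D.inducedA θ a i j) (D.inducedB θ b i j) m x α β
  else 0

end CuttingStrip

end RShape

end HamelGoulden

open HamelGoulden

/-! Both determinants are evaluations of one determinant that depends on the shape only. All their
entries are values of a single kernel $K(p,q)$ of two contents (`contentKernel`), with $K(p,p)=1$
and $K(p,q)=0$ for $q<p$. For the Grothendieck determinant the entry $(i,j)$ is $K$ at the content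
of the bottom cell of column $i$ and at the successor of the content of the top cell of column $j$
(`dualGrothendieck_eq_det`). For $\theta_i\#\theta_j$ the entries are the values of $K$ at the
bottom and top contents of its columns, so that its enumerator is a Hessenberg determinant in $K$
(`ribbonG_eq_stripDet`). This uses that the flags of the corollary, read at the extreme cell of a
diagonal, depend on the content only.

The common determinant is that of `diagonalMatrix K`, indexed by the cells and one marker for each
content. Let the shape be cut into chains of cells of consecutive contents, with the direction of
each step determined by its content. Permuting the rows along the chains turns the row of every cell
into a unit vector, and a matrix over the markers remains (`det_diagonalMatrix`). Its rows at
contents that end no chain are, up to sign, rows of a triangular matrix with diagonal entries $\pm1$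
(`pivotMatrix`). Dividing by that matrix leaves a minor $\det N(\text{start},\text{end})$ over the
chains.

If the chains are the columns, no step goes right, the pivot matrix is the identity and $N=K$
(`det_columns`). If the chains are the ribbons of an outer decomposition, $N$ satisfies the
recursion obtained by expanding Hessenberg determinants, hence equals the strip determinant up to
sign (`pivot_eq_stripDet`), and all signs cancel (`det_ribbons`). That outer ribbons form such
chains rests on the constancy of directions along diagonals (`goesUp_iff`). Connectedness ensures
that every content between a head and a tail occurs in the shape. -/

namespace HamelGoulden

/-! ### Linear algebra: unit rows, signs of permutations, Hessenberg determinants. -/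

section LinearAlgebra

variable {R : Type*} [CommRing R]

/-- The matrix is block triangular with a diagonal lower block. This removes the rows of the cells,
and later those of the markers at which no chain ends. -/
theorem det_of_rows_eq_single {n : Type*} [Fintype n] [DecidableEq n] (A : Matrix n n R)
    (p : n → Prop) [DecidablePred p] (c : n → R)
    (h : ∀ i, ¬ p i → ∀ j, A i j = if j = i then c i else 0) :
    A.det = (A.submatrix (Subtype.val : {i // p i} → n) Subtype.val).det *
      ∏ i : {i // ¬ p i}, c i := by
  rw [Matrix.twoBlockTriangular_det A p]
  · congr 1
    have : (A.toSquareBlockProp fun i => ¬ p i) = Matrix.diagonal fun i : {i // ¬ p i} => c i := by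
      ext i j
      rw [Matrix.diagonal_apply]
      change A i j = _
      rw [h i i.2 j]
      by_cases hij : i = j
      · simp [hij]
      · rw [if_neg hij, if_neg (fun h => hij (Subtype.ext h.symm))]
    rw [this, Matrix.det_diagonal]
  · intro i hi j hj
    rw [h i hi j, if_neg]
    rintro rfl
    exact hi hj

/-- The sign of a permutation each of whose cycles contains exactly one element outside `D`. -/
theorem sign_eq_neg_one_pow_card {Ω : Type*} [Fintype Ω] [DecidableEq Ω] (n : ℕ) :
    ∀ (α : Type) (P : Equiv.Perm Ω) (D : Finset Ω) (rank : Ω → ℤ) (fin : Ω → α),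
      D.card = n → (∀ ω, fin (P ω) = fin ω) →
      (∀ ω ω', ω ∉ D → ω' ∉ D → fin ω = fin ω' → ω = ω') →
      (∀ ω ∈ D, P ω ∈ D → rank ω < rank (P ω)) → Equiv.Perm.sign P = (-1) ^ n := by
  induction n with
  | zero =>
    intro α P D rank fin hD h1 h2 h3
    rw [Finset.card_eq_zero] at hD
    subst hD
    have : P = 1 := by
      ext ω
      exact h2 _ _ (by simp) (by simp) (h1 ω)
    simp [this]
  | succ n ih =>
    intro α P D rank fin hD h1 h2 h3
    -- An element of `D` of greatest rank must leave `D`. Composing with the transposition of `d`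
    -- and `P d` splits `d` off its cycle as a fixed point and changes the sign once.
    obtain ⟨d, hd, hmax⟩ := D.exists_max_image rank (Finset.card_pos.mp (by omega))
    have hPd : P d ∉ D := fun h => absurd (hmax _ h) (not_le.mpr (h3 d hd h))
    have hne : d ≠ P d := fun h => hPd (h ▸ hd)
    have key : ∀ ω, ω ≠ d → (Equiv.swap d (P d) * P) ω ≠ d ∧
        ((Equiv.swap d (P d) * P) ω = P ω ∨ (P ω = d ∧ (Equiv.swap d (P d) * P) ω = P d)) := by
      intro ω hω
      have h' : P ω ≠ P d := fun h => hω (P.injective h)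
      by_cases h'' : P ω = d
      · simp [h'', Ne.symm hne]
      · simp only [Equiv.Perm.mul_apply, Equiv.swap_apply_of_ne_of_ne h'' h']
        exact ⟨h'', Or.inl trivial⟩
    have hsd : (Equiv.swap d (P d) * P) d = d := by simp
    -- The new fixed point `d` now lies outside the smaller set and forms a cycle of its own, so it
    -- needs a fresh label, `none`.
    have := ih (Option α) (Equiv.swap d (P d) * P) (D.erase d) rank
      (fun ω => if ω = d then none else some (fin ω))
      (by rw [Finset.card_erase_of_mem hd, hD]; rfl) ?_ ?_ ?_
    · rw [Equiv.Perm.sign_mul, Equiv.Perm.sign_swap hne] at this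
      rw [pow_succ, ← this]
      simp
    · intro ω
      by_cases hω : ω = d
      · rw [hω, hsd]
      · obtain ⟨ha, hb⟩ := key ω hω
        simp only [ha, hω, if_false]
        rcases hb with hb | ⟨hb, hc⟩
        · rw [hb, h1]
        · rw [hc, h1, ← h1 ω, hb]
    · intro ω ω' hω hω' h
      simp only [Finset.mem_erase, not_and_or, not_not] at hω hω'
      split_ifs at h with h4 h5 h5
      · rw [h4, h5]
      · exact h2 _ _ (hω.resolve_left h4) (hω'.resolve_left h5) (Option.some.inj h)
    · intro ω hω hω'
      obtain ⟨ha, hb⟩ := key ω (Finset.ne_of_mem_erase hω)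
      rcases hb with hb | ⟨hb, hc⟩
      · rw [hb] at hω' ⊢
        exact h3 _ (Finset.mem_of_mem_erase hω) (Finset.mem_of_mem_erase hω')
      · rw [hc] at hω'
        exact absurd (Finset.mem_of_mem_erase hω') hPd

/-- The determinant of the matrix with columns `(K (t i) (t (j + 1)))_i`, `j < m`, and `v`. -/
noncomputable def hessenberg (K : ℤ → ℤ → R) (t : ℕ → ℤ) (m : ℕ) (v : ℕ → R) : R :=
  Matrix.det (Matrix.of fun i j : Fin (m + 1) =>
    if (j : ℕ) = m then v i else K (t i) (t (j + 1)))

theorem hessenberg_zero (K : ℤ → ℤ → R) (t : ℕ → ℤ) (v : ℕ → R) : hessenberg K t 0 v = v 0 := by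
  simp [hessenberg]

/-- In the last row all entries vanish except the last two, `K (t (m + 1)) (t (m + 1)) = 1` and `v
(m + 1)`. Expansion along this row leaves two smaller determinants of the same kind. -/
theorem hessenberg_succ (K : ℤ → ℤ → R) (h1 : ∀ x, K x x = 1) (h0 : ∀ x y, y < x → K x y = 0)
    (t : ℕ → ℤ) (m : ℕ) (ht : ∀ k ≤ m, t k < t (k + 1)) (v : ℕ → R) :
    hessenberg K t (m + 1) v =
      v (m + 1) * hessenberg K t m (fun i => K (t i) (t (m + 1))) - hessenberg K t m v := by
  have hmono : ∀ k ≤ m, ∀ l < k, t (l + 1) < t (k + 1) := by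
    intro k hk
    induction k with
    | zero => intro l hl; omega
    | succ k ih =>
      intro l hl
      rcases Nat.lt_succ_iff_lt_or_eq.mp hl with h | h
      · exact (ih (by omega) l h).trans (ht _ hk)
      · subst h
        exact ht _ hk
  unfold hessenberg
  rw [Matrix.det_succ_row _ (Fin.last (m + 1)), Fin.sum_univ_castSucc, Fin.sum_univ_castSucc,
    Finset.sum_eq_zero]
  · simp only [Matrix.of_apply, Fin.val_last, Fin.val_castSucc, if_true, zero_add]
    rw [if_neg (by omega), h1, add_comm, sub_eq_add_neg]
    congr 1
    · rw [Even.neg_one_pow ⟨m + 1, rfl⟩, one_mul]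
      congr 2
      ext i j
      simp only [Matrix.submatrix_apply, Matrix.of_apply, Fin.succAbove_last, Fin.val_castSucc]
      have := j.2
      rw [if_neg (by omega)]
      split_ifs with h
      · rw [h]
      · rfl
    · rw [Odd.neg_one_pow ⟨m, by ring⟩, mul_one, neg_one_mul]
      congr 2
      ext i j
      simp only [Matrix.submatrix_apply, Matrix.of_apply, Fin.succAbove_last, Fin.val_castSucc]
      by_cases hj : (j : ℕ) = m
      · have : j = Fin.last m := Fin.ext hj
        subst this
        simp
      · have : (Fin.castSucc (Fin.last m)).succAbove j = j.castSucc :=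
          Fin.succAbove_of_castSucc_lt _ _ (by
            rw [Fin.lt_def]; have := j.2; simp only [Fin.val_castSucc, Fin.val_last]; omega)
        rw [this]
        have := j.2
        simp only [Fin.val_castSucc]
        rw [if_neg (by omega), if_neg hj]
  · intro j _
    have := j.2
    simp only [Matrix.of_apply, Fin.val_last, Fin.val_castSucc]
    rw [if_neg (by omega), h0 _ _ (hmono m le_rfl j this)]
    ring

/-- Iterating the expansion gives the form that is compared with `pivot_recursion`. -/
theorem hessenberg_eq_sum (K : ℤ → ℤ → R) (h1 : ∀ x, K x x = 1) (h0 : ∀ x y, y < x → K x y = 0)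
    (t : ℕ → ℤ) (m : ℕ) (ht : ∀ k < m, t k < t (k + 1)) (v : ℕ → R) :
    hessenberg K t m v = (-1) ^ m * v 0 + ∑ k ∈ Finset.range m,
      (-1) ^ (m - 1 - k) * v (k + 1) * hessenberg K t k (fun i => K (t i) (t (k + 1))) := by
  induction m with
  | zero => simp [hessenberg_zero]
  | succ m ih =>
    rw [hessenberg_succ K h1 h0 t m (fun k hk => ht k (by omega)), ih (fun k hk => ht k (by omega)),
      Finset.sum_range_succ]
    have : ∑ k ∈ Finset.range m, (-1) ^ (m + 1 - 1 - k) * v (k + 1) *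
          hessenberg K t k (fun i => K (t i) (t (k + 1))) =
        - ∑ k ∈ Finset.range m, (-1) ^ (m - 1 - k) * v (k + 1) *
          hessenberg K t k (fun i => K (t i) (t (k + 1))) := by
      rw [← Finset.sum_neg_distrib]
      refine Finset.sum_congr rfl fun k hk => ?_
      rw [Finset.mem_range] at hk
      rw [show m + 1 - 1 - k = (m - 1 - k) + 1 by omega, pow_succ]
      ring
    rw [this]
    simp only [Nat.add_sub_cancel, Nat.sub_self, pow_zero, pow_succ]
    ring

end LinearAlgebra

end HamelGoulden

/-! ### Chain systems and the signs of the permutations attached to them. -/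

namespace HamelGoulden

/-- The diagonals of a skew shape: the diagonal of content `x` consists of the cells in the rows
`lo x, …, hi x - 1`; all cells have contents in `[P, Q)`. -/
structure IsDiagonalBounds (lo hi : ℤ → ℤ) (P Q : ℤ) : Prop where
  lo_step : ∀ x, lo (x - 1) = lo x ∨ lo (x - 1) = lo x + 1
  hi_step : ∀ x, hi (x - 1) = hi x ∨ hi (x - 1) = hi x + 1
  lo_le_hi : ∀ x, lo x ≤ hi x
  left : lo (P - 1) = hi (P - 1)
  right : lo Q = hi Q

/-- A decomposition of a shape into chains of cells of consecutive contents, where the cell of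
content `x` in a chain is to the right of its predecessor if `x ∈ X` and above it otherwise.
A chain with contents `p, …, q` has end `q + 1 ∈ E` and start `st (q + 1) = p`, and `en x k` is the end of
the chain of the cell of content `x` in row `k`. -/
structure IsChainSystem (lo hi : ℤ → ℤ) (P Q : ℤ) (X E : Finset ℤ) (st : ℤ → ℤ) (en : ℤ → ℤ → ℤ) :
    Prop where
  mem_Icc : ∀ y ∈ E, y ∈ Finset.Icc P Q
  st_mem_Icc : ∀ y ∈ E, st y ∈ Finset.Icc P Q
  -- The first cell of a chain lacks the predecessor prescribed by `X`: there is no cell to the left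
  -- of the first row of the diagonal, respectively no cell below its last row.
  st_right : ∀ y ∈ E, st y ∈ X → lo (st y - 1) ≠ lo (st y)
  st_up : ∀ y ∈ E, st y ∉ X → hi (st y - 1) = hi (st y)
  st_inj : ∀ y ∈ E, ∀ y' ∈ E, st y = st y' → y = y'
  not_end_right : ∀ y ∈ Finset.Icc P Q, y ∉ E → y ∈ X → hi (y - 1) = hi y
  not_end_up : ∀ y ∈ Finset.Icc P Q, y ∉ E → y ∉ X → lo (y - 1) ≠ lo y
  en_mem : ∀ x k, lo x ≤ k → k < hi x → en x k ∈ E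
  en_right : ∀ x ∈ X, ∀ k, lo (x - 1) ≤ k → k < hi (x - 1) → k < hi x → en (x - 1) k = en x k
  en_right_last : ∀ x ∈ X, lo (x - 1) ≤ hi x → hi x < hi (x - 1) → en (x - 1) (hi x) = x
  en_up : ∀ x ∉ X, ∀ k, lo (x - 1) ≤ k → k < hi (x - 1) → lo x < k → en (x - 1) k = en x (k - 1)
  en_up_last : ∀ x ∉ X, lo (x - 1) = lo x → lo x < hi (x - 1) → en (x - 1) (lo x) = x
  en_st_right : ∀ y ∈ E, st y ∈ X → lo (st y) < hi (st y) → en (st y) (lo (st y)) = y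
  en_st_up : ∀ y ∈ E, st y ∉ X → lo (st y) < hi (st y) → en (st y) (hi (st y) - 1) = y
  -- Chains may be empty: their start is their end. This occurs for columns without cells.
  st_of_eq : ∀ y ∈ E, lo (st y) = hi (st y) → st y = y

/-- The pairs `(x, k)` with `x ∈ [P, Q]` and `k ∈ [lo x, hi x]`: the cells, and one further position
`(x, hi x)` for each `x`. -/
noncomputable def positions (lo hi : ℤ → ℤ) (P Q : ℤ) : Finset (ℤ × ℤ) :=
  (Finset.Icc P Q).biUnion fun x => (Finset.Icc (lo x) (hi x)).image fun k => (x, k)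

theorem mem_positions {lo hi : ℤ → ℤ} {P Q : ℤ} {ω : ℤ × ℤ} :
    ω ∈ positions lo hi P Q ↔ P ≤ ω.1 ∧ ω.1 ≤ Q ∧ lo ω.1 ≤ ω.2 ∧ ω.2 ≤ hi ω.1 := by
  obtain ⟨x, k⟩ := ω
  simp only [positions, Finset.mem_biUnion, Finset.mem_image, Finset.mem_Icc, Prod.mk.injEq]
  constructor
  · rintro ⟨y, hy, l, hl, rfl, rfl⟩
    exact ⟨hy.1, hy.2, hl.1, hl.2⟩
  · rintro ⟨h1, h2, h3, h4⟩
    exact ⟨x, ⟨h1, h2⟩, k, ⟨h3, h4⟩, rfl, rfl⟩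

section Chains

variable {lo hi : ℤ → ℤ} {P Q : ℤ} {X E : Finset ℤ} {st : ℤ → ℤ} {en : ℤ → ℤ → ℤ}

/-- A cell `(x, k)` is sent to `(x + 1, k)`, and `(y, hi y)` to the position that replaces the missing
predecessor of the start of the chain with end `y` (to the one of its own that is not used, if there
is no such chain). -/
def successor (lo hi : ℤ → ℤ) (X E : Finset ℤ) (st : ℤ → ℤ) (ω : ℤ × ℤ) : ℤ × ℤ :=
  if ω.2 < hi ω.1 then (ω.1 + 1, ω.2)
  else if ω.1 ∈ E then (st ω.1, if st ω.1 ∈ X then lo (st ω.1) else hi (st ω.1))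
  else (ω.1, if ω.1 ∈ X then hi ω.1 else lo ω.1)

/-- Rotation of the positions of content not in `X`. -/
def rotation (lo hi : ℤ → ℤ) (X : Finset ℤ) (ω : ℤ × ℤ) : ℤ × ℤ :=
  if ω.1 ∈ X then ω else if ω.2 < hi ω.1 then (ω.1, ω.2 + 1) else (ω.1, lo ω.1)

theorem successor_mem (hB : IsDiagonalBounds lo hi P Q) (hS : IsChainSystem lo hi P Q X E st en)
    {ω : ℤ × ℤ} (hω : ω ∈ positions lo hi P Q) :
    successor lo hi X E st ω ∈ positions lo hi P Q := by
  obtain ⟨x, k⟩ := ω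
  rw [mem_positions] at hω ⊢
  simp only at hω
  unfold successor
  simp only
  split_ifs with h1 h2 h3 h3
  · have hQ : x ≠ Q := by
      rintro rfl
      have := hB.right
      omega
    have a1 := hB.lo_step (x + 1)
    have a2 := hB.hi_step (x + 1)
    simp only [add_sub_cancel_right] at a1 a2
    refine ⟨?_, ?_, ?_, ?_⟩ <;> simp only <;> omega
  · have := Finset.mem_Icc.mp (hS.st_mem_Icc x h2)
    exact ⟨this.1, this.2, le_rfl, hB.lo_le_hi _⟩
  · have := Finset.mem_Icc.mp (hS.st_mem_Icc x h2)
    exact ⟨this.1, this.2, hB.lo_le_hi _, le_rfl⟩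
  · exact ⟨hω.1, hω.2.1, hB.lo_le_hi _, le_rfl⟩
  · exact ⟨hω.1, hω.2.1, le_rfl, hB.lo_le_hi _⟩

theorem rotation_mem (hB : IsDiagonalBounds lo hi P Q)
    {ω : ℤ × ℤ} (hω : ω ∈ positions lo hi P Q) : rotation lo hi X ω ∈ positions lo hi P Q := by
  obtain ⟨x, k⟩ := ω
  have := hB.lo_le_hi x
  rw [mem_positions] at hω ⊢
  simp only at hω
  unfold rotation
  simp only
  split_ifs <;> refine ⟨?_, ?_, ?_, ?_⟩ <;> simp only <;> omega

theorem rotation_injOn {ω ω' : ℤ × ℤ} (hω : ω ∈ positions lo hi P Q)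
    (hω' : ω' ∈ positions lo hi P Q) (h : rotation lo hi X ω = rotation lo hi X ω') : ω = ω' := by
  obtain ⟨x, k⟩ := ω
  obtain ⟨x', k'⟩ := ω'
  rw [mem_positions] at hω hω'
  simp only at hω hω'
  have hx : x = x' := by
    unfold rotation at h
    simp only at h
    split_ifs at h <;> simp only [Prod.mk.injEq] at h <;> exact h.1
  subst hx
  unfold rotation at h
  simp only at h
  ext
  · rfl
  split_ifs at h <;> simp only [Prod.mk.injEq] at h <;> omega

/-- The successor of a position which is not a cell does not lie next to a cell. -/
theorem successor_not_cell (hB : IsDiagonalBounds lo hi P Q)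
    (hS : IsChainSystem lo hi P Q X E st en) {ω : ℤ × ℤ} (hω : ω ∈ positions lo hi P Q)
    (hc : ¬ ω.2 < hi ω.1) :
    ¬ (lo ((successor lo hi X E st ω).1 - 1) ≤ (successor lo hi X E st ω).2 ∧
      (successor lo hi X E st ω).2 < hi ((successor lo hi X E st ω).1 - 1)) := by
  obtain ⟨x, k⟩ := ω
  rw [mem_positions] at hω
  simp only at hω hc
  unfold successor
  simp only [hc, if_false]
  have hI : x ∈ Finset.Icc P Q := Finset.mem_Icc.mpr ⟨hω.1, hω.2.1⟩
  split_ifs with h2 h3 h3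
  · have := hS.st_right x h2 h3
    have := hB.lo_step (st x)
    simp only; omega
  · have := hS.st_up x h2 h3
    simp only; omega
  · have := hS.not_end_right x hI h2 h3
    simp only; omega
  · have := hS.not_end_up x hI h2 h3
    have := hB.lo_step x
    simp only; omega

/-- Cells hit exactly positions whose left neighbour is a cell, and markers never do. Two markers
that are ends are separated by `st_inj`; two markers that are not ends keep their contents. A
collision of the two kinds would make `lo` exceed `hi` on the preceding diagonal. -/
theorem successor_injOn (hB : IsDiagonalBounds lo hi P Q) (hS : IsChainSystem lo hi P Q X E st en)
    {ω ω' : ℤ × ℤ} (hω : ω ∈ positions lo hi P Q) (hω' : ω' ∈ positions lo hi P Q)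
    (h : successor lo hi X E st ω = successor lo hi X E st ω') : ω = ω' := by
  have aux : ∀ ω ω' : ℤ × ℤ, ω ∈ positions lo hi P Q → ω' ∈ positions lo hi P Q →
      ω.2 < hi ω.1 → ¬ ω'.2 < hi ω'.1 →
      successor lo hi X E st ω ≠ successor lo hi X E st ω' := by
    intro ω ω' hω hω' h1 h2 h
    apply successor_not_cell hB hS hω' h2
    rw [← h, successor, if_pos h1]
    rw [mem_positions] at hω
    simpa using ⟨hω.2.2.1, h1⟩
  have aux2 : ∀ ω ω' : ℤ × ℤ, ω ∈ positions lo hi P Q → ω' ∈ positions lo hi P Q →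
      ¬ ω.2 < hi ω.1 → ¬ ω'.2 < hi ω'.1 → ω.1 ∈ E → ω'.1 ∉ E →
      successor lo hi X E st ω ≠ successor lo hi X E st ω' := by
    intro ω ω' hω hω' h1 h2 hE hE' h
    obtain ⟨x, k⟩ := ω
    obtain ⟨x', k'⟩ := ω'
    rw [mem_positions] at hω hω'
    simp only at hω hω' h1 h2 hE hE'
    simp only [successor, h1, h2, hE, hE', if_false, if_true, Prod.mk.injEq] at h
    obtain ⟨h, h'⟩ := h
    have e1 := hS.st_right x hE
    have e2 := hS.st_up x hE
    rw [h] at h' e1 e2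
    have hI : x' ∈ Finset.Icc P Q := Finset.mem_Icc.mpr ⟨hω'.1, hω'.2.1⟩
    have b1 := hS.not_end_right x' hI hE'
    have b2 := hS.not_end_up x' hI hE'
    have s1 := hB.lo_step x'
    have s2 := hB.hi_step x'
    have s3 := hB.lo_le_hi (x' - 1)
    by_cases hX : x' ∈ X
    · simp only [hX, if_true, forall_const] at h' e1 b1
      omega
    · simp only [hX, if_false, not_false_eq_true, forall_const] at h' e2 b2
      omega
  by_cases h1 : ω.2 < hi ω.1 <;> by_cases h2 : ω'.2 < hi ω'.1
  · simp only [successor, h1, h2, if_true, Prod.mk.injEq, add_left_inj] at h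
    exact Prod.ext h.1 h.2
  · exact absurd h (aux _ _ hω hω' h1 h2)
  · exact absurd h.symm (aux _ _ hω' hω h2 h1)
  · have key : ω.1 = ω'.1 := by
      by_cases h3 : ω.1 ∈ E <;> by_cases h4 : ω'.1 ∈ E
      · simp only [successor, h1, h2, h3, h4, if_false, if_true, Prod.mk.injEq] at h
        exact hS.st_inj _ h3 _ h4 h.1
      · exact absurd h (aux2 _ _ hω hω' h1 h2 h3 h4)
      · exact absurd h.symm (aux2 _ _ hω' hω h2 h1 h4 h3)
      · simp only [successor, h1, h2, h3, h4, if_false, Prod.mk.injEq] at h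
        exact h.1
    rw [mem_positions] at hω hω'
    refine Prod.ext key ?_
    rw [key] at hω h1
    omega

/-- The end of the chain of a position. -/
def chainEnd (hi : ℤ → ℤ) (en : ℤ → ℤ → ℤ) (ω : ℤ × ℤ) : ℤ :=
  if ω.2 < hi ω.1 then en ω.1 ω.2 else ω.1

/-- The end of the chain of the position that is rotated to the given one. -/
def chainEndRotated (lo hi : ℤ → ℤ) (X : Finset ℤ) (en : ℤ → ℤ → ℤ) (ω : ℤ × ℤ) : ℤ :=
  if ω.1 ∈ X then chainEnd hi en ω else if ω.2 = lo ω.1 then ω.1 else en ω.1 (ω.2 - 1)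

/-- For contents in `X` the position `(x, k)` already stands for the cell that follows its left
neighbour. For the other contents the cell above that neighbour is in row `k - 1`, and `rotation`
accounts for this shift. -/
theorem chainEndRotated_rotation {ω : ℤ × ℤ} (hω : ω ∈ positions lo hi P Q) :
    chainEndRotated lo hi X en (rotation lo hi X ω) = chainEnd hi en ω := by
  obtain ⟨x, k⟩ := ω
  rw [mem_positions] at hω
  simp only at hω
  unfold rotation chainEndRotated chainEnd
  by_cases hX : x ∈ X
  · simp [hX]
  · simp only [hX, if_false]
    by_cases h : k < hi x
    · simp only [h, if_true, hX, if_false]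
      rw [if_neg (by omega), add_sub_cancel_right]
    · simp [h, hX]

/-- Together with `chainEndRotated_rotation` this shows that the successor followed by the inverse
rotation stays on one chain, closed into a cycle by its marker. -/
theorem chainEndRotated_successor (hB : IsDiagonalBounds lo hi P Q)
    (hS : IsChainSystem lo hi P Q X E st en) {ω : ℤ × ℤ} (hω : ω ∈ positions lo hi P Q) :
    chainEndRotated lo hi X en (successor lo hi X E st ω) = chainEnd hi en ω := by
  obtain ⟨x, k⟩ := ω
  rw [mem_positions] at hω
  simp only at hω
  have hI : x ∈ Finset.Icc P Q := Finset.mem_Icc.mpr ⟨hω.1, hω.2.1⟩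
  unfold successor chainEndRotated chainEnd
  by_cases h : k < hi x
  · simp only [h, if_true]
    have s1 := hB.lo_step (x + 1)
    have s2 := hB.hi_step (x + 1)
    simp only [add_sub_cancel_right] at s1 s2
    by_cases hX : x + 1 ∈ X
    · simp only [hX, if_true]
      have e1 := hS.en_right _ hX k
      have e2 := hS.en_right_last _ hX
      simp only [add_sub_cancel_right] at e1 e2
      by_cases hk : k < hi (x + 1)
      · rw [if_pos hk, e1 hω.2.2.1 h hk]
      · have : k = hi (x + 1) := by omega
        rw [if_neg hk, this, e2 (by omega) (by omega)]
    · simp only [hX, if_false]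
      have e1 := hS.en_up _ hX k
      have e2 := hS.en_up_last _ hX
      simp only [add_sub_cancel_right] at e1 e2
      by_cases hk : k = lo (x + 1)
      · rw [if_pos hk, hk, e2 (by omega) (by omega)]
      · rw [if_neg hk, e1 hω.2.2.1 h (by omega)]
  · simp only [h, if_false]
    by_cases hE : x ∈ E
    · simp only [hE, if_true]
      have e0 := hB.lo_le_hi (st x)
      have e1 := hS.en_st_right x hE
      have e2 := hS.en_st_up x hE
      have e3 := hS.st_of_eq x hE
      by_cases hX : st x ∈ X
      · simp only [hX, if_true, forall_const] at e1 ⊢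
        split_ifs with hl
        · exact e1 hl
        · exact e3 (by omega)
      · simp only [hX, if_false, not_false_eq_true, forall_const] at e2 ⊢
        split_ifs with hl
        · exact e3 hl.symm
        · exact e2 (by omega)
    · simp only [hE, if_false]
      by_cases hX : x ∈ X <;> simp [hX]

/-- The permutation of the positions given by `successor`. -/
noncomputable def successorPerm (hB : IsDiagonalBounds lo hi P Q)
    (hS : IsChainSystem lo hi P Q X E st en) : Equiv.Perm (positions lo hi P Q) :=
  Equiv.ofBijective (fun ω => ⟨successor lo hi X E st ω, successor_mem hB hS ω.2⟩)
    (Finite.injective_iff_bijective.mp fun ω ω' h =>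
      Subtype.ext (successor_injOn hB hS ω.2 ω'.2 (Subtype.ext_iff.mp h)))

/-- The permutation of the positions given by `rotation`. -/
noncomputable def rotationPerm (X : Finset ℤ) (hB : IsDiagonalBounds lo hi P Q) :
    Equiv.Perm (positions lo hi P Q) :=
  Equiv.ofBijective (fun ω => ⟨rotation lo hi X ω, rotation_mem hB ω.2⟩)
    (Finite.injective_iff_bijective.mp fun ω ω' h =>
      Subtype.ext (rotation_injOn ω.2 ω'.2 (Subtype.ext_iff.mp h)))

/-- The number of cells whose content satisfies `p`. -/
noncomputable def cellCount (lo hi : ℤ → ℤ) (P Q : ℤ) (p : ℤ → Prop) [DecidablePred p] : ℕ :=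
  (Finset.univ.filter fun ω : positions lo hi P Q => ω.1.2 < hi ω.1.1 ∧ p ω.1.1).card

theorem eq_of_not_cell {ω ω' : positions lo hi P Q} (h : ¬ ω.1.2 < hi ω.1.1)
    (h' : ¬ ω'.1.2 < hi ω'.1.1) (he : ω.1.1 = ω'.1.1) : ω = ω' := by
  have h1 := mem_positions.mp ω.2
  have h2 := mem_positions.mp ω'.2
  refine Subtype.ext (Prod.ext he ?_)
  rw [he] at h1 h
  omega

/-- On a content outside `X` the rotation is one cycle through the cells of that content and their
marker; all other positions are fixed. -/
theorem sign_rotationPerm (hB : IsDiagonalBounds lo hi P Q) :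
    Equiv.Perm.sign (rotationPerm X hB) = (-1) ^ cellCount lo hi P Q (· ∉ X) := by
  refine sign_eq_neg_one_pow_card _ (ℤ × ℤ) _
    (Finset.univ.filter fun ω : positions lo hi P Q => ω.1.2 < hi ω.1.1 ∧ ω.1.1 ∉ X)
    (fun ω => ω.1.2) (fun ω => if ω.1.1 ∈ X then ω.1 else (ω.1.1, hi ω.1.1)) rfl ?_ ?_ ?_
  · rintro ⟨⟨x, k⟩, hω⟩
    simp only [rotationPerm, Equiv.ofBijective_apply, rotation]
    by_cases hX : x ∈ X
    · simp [hX]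
    · by_cases hk : k < hi x <;> simp [hX, hk]
  · intro ω ω' h h' he
    simp only [Finset.mem_filter, Finset.mem_univ, true_and, not_and_or, not_not] at h h'
    have hx : ω.1.1 = ω'.1.1 := by
      split_ifs at he <;> simpa using (Prod.ext_iff.mp he).1
    by_cases hX : ω.1.1 ∈ X
    · have hX' := hX
      rw [hx] at hX'
      simp only [hX, hX', if_true] at he
      exact Subtype.ext he
    · have hX' := hX
      rw [hx] at hX'
      exact eq_of_not_cell (h.resolve_right hX) (h'.resolve_right hX') hx
  · rintro ⟨⟨x, k⟩, hω⟩ h h'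
    simp only [Finset.mem_filter, Finset.mem_univ, true_and] at h
    simp only [rotationPerm, Equiv.ofBijective_apply, rotation]
    simp [h.1, h.2]

/-- After the inverse rotation each cycle contains exactly one marker, so the sign of the product is
the parity of the number of all cells. The cells with content outside `X` are accounted for by the
rotation itself. -/
theorem sign_successorPerm (hB : IsDiagonalBounds lo hi P Q)
    (hS : IsChainSystem lo hi P Q X E st en) :
    Equiv.Perm.sign (successorPerm hB hS) = (-1) ^ cellCount lo hi P Q (· ∈ X) := by
  have h1 : Equiv.Perm.sign ((rotationPerm X hB)⁻¹ * successorPerm hB hS) =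
      (-1) ^ cellCount lo hi P Q (fun _ => True) := by
    have hrot : ∀ ω, ((rotationPerm X hB)⁻¹ ω).1.1 = ω.1.1 := by
      intro ω
      obtain ⟨ω, rfl⟩ := (rotationPerm X hB).surjective ω
      have : (rotationPerm X hB)⁻¹ (rotationPerm X hB ω) = ω := Equiv.symm_apply_apply _ _
      rw [this]
      simp only [rotationPerm, Equiv.ofBijective_apply, rotation]
      split_ifs <;> rfl
    refine sign_eq_neg_one_pow_card _ ℤ _
      (Finset.univ.filter fun ω : positions lo hi P Q => ω.1.2 < hi ω.1.1 ∧ True)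
      -- The content serves as rank: the successor of a cell has content one larger, and the
      -- rotation preserves contents.
      (fun ω => ω.1.1) (fun ω => chainEnd hi en ω.1) rfl ?_ ?_ ?_
    · intro ω
      rw [← chainEndRotated_successor hB hS ω.2, Equiv.Perm.mul_apply]
      have : ∀ ω', chainEnd hi en ((rotationPerm X hB)⁻¹ ω').1 =
          chainEndRotated lo hi X en ω'.1 := by
        intro ω'
        obtain ⟨ω', rfl⟩ := (rotationPerm X hB).surjective ω'
        have : (rotationPerm X hB)⁻¹ (rotationPerm X hB ω') = ω' := Equiv.symm_apply_apply _ _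
        rw [this]
        exact (chainEndRotated_rotation ω'.2).symm
      rw [this]
      rfl
    · intro ω ω' h h' he
      simp only [Finset.mem_filter, Finset.mem_univ, true_and, and_true] at h h'
      simp only [chainEnd, h, h', if_false] at he
      exact eq_of_not_cell h h' he
    · intro ω h _
      simp only [Finset.mem_filter, Finset.mem_univ, true_and, and_true] at h
      rw [Equiv.Perm.mul_apply, hrot]
      simp [successorPerm, successor, h]
  have h2 : cellCount lo hi P Q (fun _ => True) =
      cellCount lo hi P Q (· ∈ X) + cellCount lo hi P Q (· ∉ X) := by
    unfold cellCount
    rw [← Finset.card_union_of_disjoint]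
    · congr 1
      ext ω
      simp only [Finset.mem_filter, Finset.mem_univ, true_and, Finset.mem_union]
      tauto
    · rw [Finset.disjoint_filter]
      tauto
  rw [Equiv.Perm.sign_mul, Equiv.Perm.sign_inv, sign_rotationPerm, h2, pow_add, mul_comm] at h1
  exact mul_right_cancel h1

end Chains

end HamelGoulden

namespace HamelGoulden

/-! ### The determinant of the shape evaluated along a chain system. -/

section ChainDeterminant

variable {R : Type*} [CommRing R] {lo hi : ℤ → ℤ} {P Q : ℤ} {X E : Finset ℤ} {st : ℤ → ℤ}
  {en : ℤ → ℤ → ℤ}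

/-- A matrix attached to a shape, which does not depend on a decomposition. -/
noncomputable def diagonalMatrix (K : ℤ → ℤ → R) (lo hi : ℤ → ℤ) (P Q : ℤ) :
    Matrix (positions lo hi P Q) (positions lo hi P Q) R :=
  Matrix.of fun ω ω' =>
    if lo (ω.1.1 - 1) ≤ ω.1.2 ∧ ω.1.2 < hi (ω.1.1 - 1) then
      if ω'.1 = (ω.1.1 - 1, ω.1.2) then 1 else 0
    else if ω.1.2 < lo (ω.1.1 - 1) then if ω'.1 = (ω.1.1, hi ω.1.1) then 1 else 0
    else if ω'.1.2 < hi ω'.1.1 then 0 else K ω.1.1 ω'.1.1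

/-- The change of variables that inverts `K` at the rows in `X`. -/
def pivotMatrix (K : ℤ → ℤ → R) (X : Finset ℤ) (y r : ℤ) : R :=
  if y ∈ X then -K y r else if r = y then 1 else 0

/-- The matrix `K` with the rows in `X` replaced by unit vectors. -/
def unitMatrix (K : ℤ → ℤ → R) (X : Finset ℤ) (y r : ℤ) : R :=
  if y ∈ X then if r = y then 1 else 0 else K y r

theorem det_pivotMatrix (K : ℤ → ℤ → R) (h1 : ∀ x, K x x = 1) (h0 : ∀ x y, y < x → K x y = 0)
    (X : Finset ℤ) (P Q : ℤ) :
    Matrix.det (Matrix.of fun y r : Finset.Icc P Q => pivotMatrix K X y r) =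
      ∏ y : Finset.Icc P Q, if (y : ℤ) ∈ X then -1 else 1 := by
  rw [Matrix.det_of_isUpperTriangular]
  · refine Finset.prod_congr rfl fun y _ => ?_
    simp [pivotMatrix, h1]
  · intro y r hyr
    have h : (r : ℤ) < y := hyr
    simp only [Matrix.of_apply, pivotMatrix]
    rw [h0 _ _ h, if_neg h.ne]
    simp

/-- The positions which are not cells. -/
noncomputable def markerEquiv (hB : IsDiagonalBounds lo hi P Q) :
    Finset.Icc P Q ≃ {ω : positions lo hi P Q // ¬ ω.1.2 < hi ω.1.1} where
  toFun y := ⟨⟨(y, hi y), mem_positions.mpr ⟨(Finset.mem_Icc.mp y.2).1, (Finset.mem_Icc.mp y.2).2,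
    hB.lo_le_hi _, le_rfl⟩⟩, lt_irrefl _⟩
  invFun ω := ⟨ω.1.1.1, Finset.mem_Icc.mpr ⟨(mem_positions.mp ω.1.2).1, (mem_positions.mp ω.1.2).2.1⟩⟩
  left_inv _ := rfl
  right_inv ω := Subtype.ext (eq_of_not_cell (lt_irrefl _) ω.2 rfl)

/-- The hypothesis `hN` says that `N` is `unitMatrix` times the inverse of `pivotMatrix`. After the
rows have been permuted by `successorPerm`, only the block of the markers matters. It factors
through `pivotMatrix`, and the remaining factor is `N` on the chains and diagonal elsewhere. -/
theorem det_diagonalMatrix (K : ℤ → ℤ → R) (h1 : ∀ x, K x x = 1) (h0 : ∀ x y, y < x → K x y = 0)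
    (hB : IsDiagonalBounds lo hi P Q) (hS : IsChainSystem lo hi P Q X E st en) (N : ℤ → ℤ → R)
    (hN : ∀ p ∈ Finset.Icc P Q, ∀ r ∈ Finset.Icc P Q,
      ∑ q ∈ Finset.Icc P Q, N p q * pivotMatrix K X q r = unitMatrix K X p r) :
    (diagonalMatrix K lo hi P Q).det = (-1) ^ cellCount lo hi P Q (· ∈ X) *
      ((∏ y ∈ E, if y ∈ X then -1 else 1) * Matrix.det (Matrix.of fun y r : E => N (st y) r)) := by
  have hperm := Matrix.det_permute (successorPerm hB hS) (diagonalMatrix K lo hi P Q)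
  rw [sign_successorPerm] at hperm
  have hsq : ((-1 : R) ^ cellCount lo hi P Q (· ∈ X)) * (-1) ^ cellCount lo hi P Q (· ∈ X) = 1 := by
    rw [← mul_pow]; simp
  -- The row of a cell `(x, k)` is now that of `(x + 1, k)`, which is the unit vector at `(x, k)`.
  have hunit := det_of_rows_eq_single
    ((diagonalMatrix K lo hi P Q).submatrix (successorPerm hB hS) id)
    (fun ω => ¬ ω.1.2 < hi ω.1.1) (fun _ => 1) (by
      intro ω hω ω'
      rw [not_not] at hω
      have := (mem_positions.mp ω.2).2.2.1
      simp only [Matrix.submatrix_apply, id, diagonalMatrix, Matrix.of_apply, successorPerm,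
        Equiv.ofBijective_apply, successor, hω, if_true, add_sub_cancel_right, this, true_and]
      exact if_congr (by rw [Subtype.ext_iff]) rfl rfl)
  rw [Finset.prod_const_one, mul_one] at hunit
  rw [← Matrix.det_reindex_self (markerEquiv hB).symm] at hunit
  -- If `y ∉ E`, the remaining row at `y` is the row of `pivotMatrix` up to the sign on the diagonal
  -- of `B`. If `y ∈ E`, it is the row of `unitMatrix` at the start of the chain.
  set B : Matrix (Finset.Icc P Q) (Finset.Icc P Q) R := Matrix.of fun y r =>
    if (y : ℤ) ∈ E then N (st y) r else if r = y then (if (y : ℤ) ∈ X then -1 else 1) else 0 with hBdef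
  have hmul : (Matrix.reindex (markerEquiv hB).symm (markerEquiv hB).symm)
      (((diagonalMatrix K lo hi P Q).submatrix (successorPerm hB hS) id).submatrix Subtype.val
        Subtype.val) = B * Matrix.of fun y r : Finset.Icc P Q => pivotMatrix K X y r := by
    ext y r
    have hy := y.2
    have hr := r.2
    have hyp : ((y : ℤ), hi y) ∈ positions lo hi P Q := ((markerEquiv hB y).1).2
    have hnc := successor_not_cell hB hS hyp (lt_irrefl _)
    rw [Matrix.mul_apply]
    simp only [Matrix.reindex_apply, Matrix.submatrix_apply, Equiv.symm_symm, id, markerEquiv,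
      Equiv.coe_fn_mk, successorPerm, Equiv.ofBijective_apply, diagonalMatrix, Matrix.of_apply,
      hBdef, lt_irrefl, if_false]
    rw [if_neg hnc]
    by_cases hE : (y : ℤ) ∈ E
    · simp only [hE, if_true]
      rw [Finset.sum_coe_sort (Finset.Icc P Q) fun q => N (st y) q * pivotMatrix K X q r,
        hN _ (hS.st_mem_Icc _ hE) _ hr]
      have e1 := hS.st_right y hE
      have e2 := hS.st_up y hE
      have s1 := hB.lo_step (st y)
      have s2 := hB.lo_le_hi (st y - 1)
      simp only [successor, lt_irrefl, if_false, hE, if_true, unitMatrix]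
      by_cases hX : st y ∈ X
      · have := e1 hX
        simp only [hX, if_true]
        rw [if_pos (by omega)]
        refine if_congr ?_ rfl rfl
        constructor
        · intro h; exact (Prod.ext_iff.mp h).1
        · intro h; rw [h]
      · have := e2 hX
        simp only [hX, if_false]
        rw [if_neg (by omega)]
    · simp only [hE, if_false, ite_mul, zero_mul, Finset.sum_ite_eq', Finset.mem_univ, if_true]
      have e1 := hS.not_end_right y hy hE
      have e2 := hS.not_end_up y hy hE
      have s1 := hB.lo_step y
      have s2 := hB.lo_le_hi (y - 1)
      simp only [successor, lt_irrefl, if_false, hE, pivotMatrix]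
      by_cases hX : (y : ℤ) ∈ X
      · have := e1 hX
        simp only [hX, if_true]
        rw [if_neg (by omega)]
        ring
      · have := e2 hX
        simp only [hX, if_false, one_mul]
        rw [if_pos (by omega)]
        refine if_congr ?_ rfl rfl
        constructor
        · intro h; exact (Prod.ext_iff.mp h).1
        · intro h; rw [h]
  have hBdet : B.det = (∏ y : {y : Finset.Icc P Q // ¬ (y : ℤ) ∈ E},
      if (y : ℤ) ∈ X then -1 else 1) * Matrix.det (Matrix.of fun y r : E => N (st y) r) := by
    rw [det_of_rows_eq_single B (fun y => (y : ℤ) ∈ E) (fun y => if (y : ℤ) ∈ X then -1 else 1)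
      (by intro y hy r; simp [hBdef, hy]), mul_comm]
    congr 1
    let e : E ≃ {y : Finset.Icc P Q // (y : ℤ) ∈ E} :=
      { toFun := fun y => ⟨⟨y, hS.mem_Icc _ y.2⟩, y.2⟩
        invFun := fun y => ⟨y, y.2⟩
        left_inv := fun y => rfl
        right_inv := fun y => rfl }
    rw [← Matrix.det_reindex_self e.symm]
    congr 1
    ext y r
    simp [hBdef, e]
  -- The diagonal signs of `B` and the determinant of `pivotMatrix` agree off `E`, so only the signs
  -- on `E` survive.
  have hprod : (∏ y : {y : Finset.Icc P Q // ¬ (y : ℤ) ∈ E}, if (y : ℤ) ∈ X then (-1 : R) else 1) *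
      (∏ y : Finset.Icc P Q, if (y : ℤ) ∈ X then (-1 : R) else 1) =
      ∏ y ∈ E, if y ∈ X then (-1 : R) else 1 := by
    rw [← Fintype.prod_subtype_mul_prod_subtype (fun y : Finset.Icc P Q => (y : ℤ) ∈ E),
      mul_comm, mul_assoc, ← Finset.prod_mul_distrib]
    have : ∀ y : {y : Finset.Icc P Q // ¬ (y : ℤ) ∈ E},
        (if (y : ℤ) ∈ X then (-1 : R) else 1) * (if (y : ℤ) ∈ X then -1 else 1) = 1 := by
      intro y; split_ifs <;> simp
    simp only [this, Finset.prod_const_one, mul_one]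
    rw [← Finset.prod_coe_sort E fun y => if y ∈ X then (-1 : R) else 1]
    exact (Fintype.prod_equiv
      { toFun := fun y : E => (⟨⟨y, hS.mem_Icc _ y.2⟩, y.2⟩ : {y : Finset.Icc P Q // (y : ℤ) ∈ E})
        invFun := fun y => ⟨y, y.2⟩
        left_inv := fun y => rfl
        right_inv := fun y => rfl } _ _ (fun y => rfl)).symm
  rw [hunit, hmul, Matrix.det_mul, det_pivotMatrix K h1 h0, hBdet] at hperm
  rw [← hprod]
  push_cast at hperm
  linear_combination (-(-1 : R) ^ cellCount lo hi P Q (· ∈ X)) * hperm -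
    (diagonalMatrix K lo hi P Q).det * hsq

end ChainDeterminant

end HamelGoulden

namespace HamelGoulden

/-! ### Diagonals of Young diagrams, and the columns as a chain system. -/

section Diagonals

theorem exists_not_mem_diagonal (ν : YoungDiagram) (x : ℤ) :
    ∃ i : ℕ, 0 ≤ (i : ℤ) + x ∧ (i, ((i : ℤ) + x).toNat) ∉ ν := by
  refine ⟨ν.colLen 0 + x.natAbs, by omega, fun h => ?_⟩
  have := YoungDiagram.mem_iff_lt_colLen.mp (ν.isLowerSet (a := _)
    (b := (ν.colLen 0 + x.natAbs, 0)) (Prod.mk_le_mk.mpr ⟨le_rfl, Nat.zero_le _⟩) h)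
  omega

open Classical in
/-- The row of the first cell of content `x` that is not in the diagram. -/
noncomputable def diagRow (ν : YoungDiagram) (x : ℤ) : ℤ :=
  ((Nat.find (exists_not_mem_diagonal ν x) : ℕ) : ℤ)

variable {ν κ : YoungDiagram}

theorem diagRow_spec (ν : YoungDiagram) (x : ℤ) : ∃ i j : ℕ, diagRow ν x = i ∧ (j : ℤ) = i + x ∧
    (i, j) ∉ ν ∧ ∀ i' j' : ℕ, (j' : ℤ) = i' + x → (i', j') ∉ ν → i ≤ i' := by
  classical
  have h := Nat.find_spec (exists_not_mem_diagonal ν x)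
  refine ⟨_, _, rfl, Int.toNat_of_nonneg h.1, h.2, fun i' j' hj h' => Nat.find_min' _ ⟨by omega, ?_⟩⟩
  rwa [← hj, Int.toNat_natCast]

theorem mem_iff_lt_diagRow {i j : ℕ} {x : ℤ} (hx : (j : ℤ) = i + x) :
    (i, j) ∈ ν ↔ (i : ℤ) < diagRow ν x := by
  obtain ⟨d, e, hd, he, hne, hmin⟩ := diagRow_spec ν x
  rw [hd]
  constructor
  · intro h
    by_contra hc
    exact hne (ν.isLowerSet (Prod.mk_le_mk.mpr ⟨by omega, by omega⟩) h)
  · intro h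
    by_contra hc
    have := hmin i j hx hc
    omega

theorem diagRow_nonneg (ν : YoungDiagram) (x : ℤ) : 0 ≤ diagRow ν x := by
  obtain ⟨d, e, hd, he, hne, hmin⟩ := diagRow_spec ν x
  omega

theorem diagRow_add_nonneg (ν : YoungDiagram) (x : ℤ) : 0 ≤ diagRow ν x + x := by
  obtain ⟨d, e, hd, he, hne, hmin⟩ := diagRow_spec ν x
  omega

theorem diagRow_mono (h : ν ≤ κ) (x : ℤ) : diagRow ν x ≤ diagRow κ x := by
  obtain ⟨d, e, hd, he, hne, hmin⟩ := diagRow_spec κ x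
  obtain ⟨d', e', hd', he', hne', hmin'⟩ := diagRow_spec ν x
  have := hmin' d e he (fun h' => hne (h h'))
  omega

/-- Moving the first missing cell of a diagonal one step right or down gives a missing cell of the
adjacent diagonal. -/
theorem diagRow_step (ν : YoungDiagram) (x : ℤ) :
    diagRow ν (x - 1) = diagRow ν x ∨ diagRow ν (x - 1) = diagRow ν x + 1 := by
  obtain ⟨d, e, hd, he, hne, hmin⟩ := diagRow_spec ν x
  obtain ⟨d', e', hd', he', hne', hmin'⟩ := diagRow_spec ν (x - 1)
  have h1 := hmin d' (e' + 1) (by push_cast; omega)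
    (fun h => hne' (ν.isLowerSet (Prod.mk_le_mk.mpr ⟨le_rfl, Nat.le_succ _⟩) h))
  have h2 := hmin' (d + 1) e (by push_cast; omega)
    (fun h => hne (ν.isLowerSet (Prod.mk_le_mk.mpr ⟨Nat.le_succ _, le_rfl⟩) h))
  omega

/-- The cell directly below column `j` is missing. The bottom cell of the column, if there is one,
is present and its content is one larger. -/
theorem diagRow_sub_colLen (ν : YoungDiagram) (j : ℕ) :
    diagRow ν ((j : ℤ) - ν.colLen j) = ν.colLen j := by
  have h1 : ¬ (ν.colLen j : ℤ) < diagRow ν ((j : ℤ) - ν.colLen j) := by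
    rw [← mem_iff_lt_diagRow (j := j) (by ring), YoungDiagram.mem_iff_lt_colLen]
    exact lt_irrefl _
  have h2 := diagRow_step ν ((j : ℤ) - ν.colLen j + 1)
  rw [add_sub_cancel_right] at h2
  rcases Nat.eq_zero_or_pos (ν.colLen j) with h | h
  · have := diagRow_nonneg ν ((j : ℤ) - ν.colLen j)
    omega
  · have : ((ν.colLen j - 1 : ℕ) : ℤ) < diagRow ν ((j : ℤ) - ν.colLen j + 1) := by
      rw [← mem_iff_lt_diagRow (j := j) (by push_cast [h]; omega), YoungDiagram.mem_iff_lt_colLen]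
      omega
    omega

theorem diagRow_sub_colLen_add_one (ν : YoungDiagram) (j : ℕ) :
    diagRow ν ((j : ℤ) - ν.colLen j + 1) = ν.colLen j := by
  have h0 := diagRow_sub_colLen ν j
  have h2 := diagRow_step ν ((j : ℤ) - ν.colLen j + 1)
  rw [add_sub_cancel_right] at h2
  rcases Nat.eq_zero_or_pos (ν.colLen j) with h | h
  · have := diagRow_nonneg ν ((j : ℤ) - ν.colLen j + 1)
    omega
  · have : ((ν.colLen j - 1 : ℕ) : ℤ) < diagRow ν ((j : ℤ) - ν.colLen j + 1) := by
      rw [← mem_iff_lt_diagRow (j := j) (by push_cast [h]; omega), YoungDiagram.mem_iff_lt_colLen]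
      omega
    omega

/-- Along the boundary of the diagram, a step that does not change the row is the lower edge of a
column, so `diagRow` recovers the column length. -/
theorem colLen_of_diagRow_eq {x : ℤ} (h : diagRow ν (x - 1) = diagRow ν x) {j : ℕ}
    (hj : (j : ℤ) = diagRow ν x + x - 1) : (ν.colLen j : ℤ) = diagRow ν x := by
  obtain ⟨d, hd⟩ := Int.eq_ofNat_of_zero_le (diagRow_nonneg ν x)
  have h1 : ¬ (d, j) ∈ ν := by
    rw [mem_iff_lt_diagRow (x := x - 1) (by omega)]
    omega
  rw [YoungDiagram.mem_iff_lt_colLen] at h1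
  by_contra hc
  have h2 : ¬ (d - 1, j) ∈ ν := by
    rw [YoungDiagram.mem_iff_lt_colLen]
    omega
  rw [mem_iff_lt_diagRow (x := x) (by omega)] at h2
  omega

theorem colLen_mono (h : ν ≤ κ) (j : ℕ) : ν.colLen j ≤ κ.colLen j := by
  by_contra hc
  have h1 : (κ.colLen j, j) ∈ ν := YoungDiagram.mem_iff_lt_colLen.mpr (by omega)
  have := YoungDiagram.mem_iff_lt_colLen.mp (h h1)
  omega

theorem colLen_eq_zero {n j : ℕ} (hn : ν.rowLen 0 ≤ n) (hj : n ≤ j) : ν.colLen j = 0 := by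
  by_contra hc
  have h1 : (0, j) ∈ ν := YoungDiagram.mem_iff_lt_colLen.mpr (by omega)
  have := YoungDiagram.mem_iff_lt_rowLen.mp h1
  omega

theorem isDiagonalBounds {lam mu : YoungDiagram} (hle : mu ≤ lam) {n : ℕ} (hn : lam.rowLen 0 ≤ n) :
    IsDiagonalBounds (diagRow mu) (diagRow lam) (1 - lam.colLen 0) n where
  lo_step := diagRow_step mu
  hi_step := diagRow_step lam
  lo_le_hi := diagRow_mono hle
  left := by
    have h1 := diagRow_sub_colLen lam 0
    have h2 := diagRow_add_nonneg mu (1 - lam.colLen 0 - 1 : ℤ)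
    have h3 := diagRow_mono hle (1 - lam.colLen 0 - 1 : ℤ)
    have : ((0 : ℕ) : ℤ) - lam.colLen 0 = 1 - lam.colLen 0 - 1 := by push_cast; ring
    rw [this] at h1
    omega
  right := by
    have h1 := diagRow_sub_colLen lam n
    rw [colLen_eq_zero hn le_rfl] at h1
    have h2 := diagRow_mono hle n
    have h3 := diagRow_nonneg mu n
    simp only [Nat.cast_zero, sub_zero] at h1
    omega

theorem exists_cell_of_lt_diagRow {lam mu : YoungDiagram} {x k : ℤ} (h : diagRow mu x ≤ k)
    (h' : k < diagRow lam x) : ∃ i j : ℕ, (i : ℤ) = k ∧ (j : ℤ) = k + x ∧ (i, j) ∈ lam ∧ (i, j) ∉ mu := by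
  have h1 := diagRow_nonneg mu x
  have h2 := diagRow_add_nonneg mu x
  refine ⟨k.toNat, (k + x).toNat, by omega, by omega, ?_, ?_⟩
  · rw [mem_iff_lt_diagRow (x := x) (by omega)]; omega
  · rw [mem_iff_lt_diagRow (x := x) (by omega)]; omega

/-- The content following that of the top cell of column `j`. -/
def columnEnd (mu : YoungDiagram) (j : ℕ) : ℤ := (j : ℤ) - mu.colLen j + 1

theorem columnEnd_strictMono (mu : YoungDiagram) : StrictMono (columnEnd mu) := by
  intro i j hij
  have := mu.colLen_anti i j hij.le
  unfold columnEnd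
  omega

/-- The column of the cell that precedes the end `y` of a chain which is a column. -/
noncomputable def endColumn (mu : YoungDiagram) (y : ℤ) : ℕ := (diagRow mu y + y - 1).toNat

theorem endColumn_columnEnd (mu : YoungDiagram) (j : ℕ) : endColumn mu (columnEnd mu j) = j := by
  unfold endColumn columnEnd
  rw [diagRow_sub_colLen_add_one]
  omega

/-- The columns form a chain system in which all steps go up. -/
theorem isChainSystem_columns {lam mu : YoungDiagram} (hle : mu ≤ lam) {n : ℕ}
    (hn : lam.rowLen 0 ≤ n) :
    IsChainSystem (diagRow mu) (diagRow lam) (1 - lam.colLen 0) n ∅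
      ((Finset.range n).image (columnEnd mu)) (fun y => columnEnd lam (endColumn mu y))
      (fun x k => columnEnd mu (k + x).toNat) where
  mem_Icc := by
    intro y hy
    obtain ⟨j, hj, rfl⟩ := Finset.mem_image.mp hy
    have := colLen_mono hle j
    have := lam.colLen_anti 0 j (Nat.zero_le _)
    rw [Finset.mem_range] at hj
    simp only [columnEnd, Finset.mem_Icc]
    omega
  st_mem_Icc := by
    intro y hy
    obtain ⟨j, hj, rfl⟩ := Finset.mem_image.mp hy
    have := lam.colLen_anti 0 j (Nat.zero_le _)
    rw [Finset.mem_range] at hj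
    rw [endColumn_columnEnd]
    simp only [columnEnd, Finset.mem_Icc]
    omega
  st_right := by simp
  st_up := by
    intro y hy _
    rw [columnEnd, diagRow_sub_colLen_add_one, add_sub_cancel_right, diagRow_sub_colLen]
  st_inj := by
    intro y hy y' hy' h
    obtain ⟨j, hj, rfl⟩ := Finset.mem_image.mp hy
    obtain ⟨j', hj', rfl⟩ := Finset.mem_image.mp hy'
    rw [endColumn_columnEnd, endColumn_columnEnd] at h
    rw [(columnEnd_strictMono lam).injective h]
  not_end_right := by simp
  -- Where the upper boundary does not change its row, it passes over a column, so the content is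
  -- the end of that column and lies in `E`.
  not_end_up := by
    intro y hy hE _ h
    apply hE
    have h1 := diagRow_add_nonneg mu (y - 1)
    obtain ⟨j, hj⟩ := Int.eq_ofNat_of_zero_le h1
    have h2 := colLen_of_diagRow_eq h (j := j) (by omega)
    have h3 : y = columnEnd mu j := by unfold columnEnd; omega
    refine Finset.mem_image.mpr ⟨j, Finset.mem_range.mpr ?_, h3.symm⟩
    by_contra hc
    have h4 := colLen_eq_zero hn (not_lt.mp hc)
    have h5 := colLen_mono hle j
    rw [Finset.mem_Icc] at hy
    unfold columnEnd at h3
    omega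
  en_mem := by
    intro x k h h'
    obtain ⟨i, j, hi, hj, h1, h2⟩ := exists_cell_of_lt_diagRow h h'
    refine Finset.mem_image.mpr ⟨j, Finset.mem_range.mpr ?_, by rw [← hj, Int.toNat_natCast]⟩
    by_contra hc
    have h4 := colLen_eq_zero hn (not_lt.mp hc)
    rw [YoungDiagram.mem_iff_lt_colLen] at h1
    omega
  en_right := by simp
  en_right_last := by simp
  en_up := by
    intro x _ k _ _ _
    congr 2
    ring
  en_up_last := by
    intro x _ h _
    have h1 := diagRow_add_nonneg mu (x - 1)
    obtain ⟨j, hj⟩ := Int.eq_ofNat_of_zero_le h1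
    have h2 := colLen_of_diagRow_eq h (j := j) (by omega)
    have h3 : (diagRow mu x + (x - 1)).toNat = j := by omega
    rw [h3]
    unfold columnEnd
    omega
  en_st_right := by simp
  en_st_up := by
    intro y hy _ _
    obtain ⟨j, hj, rfl⟩ := Finset.mem_image.mp hy
    rw [endColumn_columnEnd]
    congr 1
    rw [columnEnd, diagRow_sub_colLen_add_one]
    omega
  st_of_eq := by
    intro y hy h
    obtain ⟨j, hj, rfl⟩ := Finset.mem_image.mp hy
    rw [endColumn_columnEnd] at h ⊢
    rw [columnEnd, diagRow_sub_colLen_add_one] at h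
    -- If the column had a cell, its bottom cell would lie on a diagonal without cells and hence
    -- belong to `mu`.
    have h1 := colLen_mono hle j
    by_contra hc
    have h2 : (lam.colLen j - 1, j) ∈ mu := by
      rw [mem_iff_lt_diagRow (x := (j : ℤ) - lam.colLen j + 1)]
      · unfold columnEnd at hc
        omega
      · unfold columnEnd at hc
        omega
    rw [YoungDiagram.mem_iff_lt_colLen] at h2
    unfold columnEnd at hc
    omega

/-- The determinant over the columns of a skew shape. -/
theorem det_columns {R : Type*} [CommRing R] {lam mu : YoungDiagram} (hle : mu ≤ lam) {n : ℕ}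
    (hn : lam.rowLen 0 ≤ n) (K : ℤ → ℤ → R) (h1 : ∀ x, K x x = 1) (h0 : ∀ x y, y < x → K x y = 0) :
    (diagonalMatrix K (diagRow mu) (diagRow lam) (1 - lam.colLen 0) n).det =
      Matrix.det (Matrix.of fun i j : Fin n => K (columnEnd lam i) (columnEnd mu j)) := by
  -- For `X = ∅` the pivot matrix is the identity and `unitMatrix` is `K`, so that `N = K`.
  rw [det_diagonalMatrix K h1 h0 (isDiagonalBounds hle hn) (isChainSystem_columns hle hn) K]
  · have : cellCount (diagRow mu) (diagRow lam) (1 - lam.colLen 0) n (· ∈ (∅ : Finset ℤ)) = 0 := by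
      simp [cellCount]
    rw [this]
    simp only [Finset.notMem_empty, if_false, Finset.prod_const_one, pow_zero, one_mul]
    let e : Fin n ≃ (Finset.range n).image (columnEnd mu) := Equiv.ofBijective
      (fun j => ⟨columnEnd mu j, Finset.mem_image.mpr ⟨j, Finset.mem_range.mpr j.2, rfl⟩⟩)
      ⟨fun i j h => Fin.ext ((columnEnd_strictMono mu).injective (Subtype.ext_iff.mp h)), by
        rintro ⟨y, hy⟩
        obtain ⟨j, hj, rfl⟩ := Finset.mem_image.mp hy
        exact ⟨⟨j, Finset.mem_range.mp hj⟩, rfl⟩⟩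
    rw [← Matrix.det_reindex_self e]
    congr 1
    ext y r
    obtain ⟨i, rfl⟩ := e.surjective y
    obtain ⟨j, rfl⟩ := e.surjective r
    have he : ∀ j : Fin n, (e j : ℤ) = columnEnd mu j := fun _ => rfl
    simp only [Matrix.reindex_apply, Matrix.submatrix_apply, Equiv.symm_apply_apply,
      Matrix.of_apply, he, endColumn_columnEnd]
  · intro p hp r hr
    simp only [pivotMatrix, unitMatrix, Finset.notMem_empty, if_false, mul_ite, mul_one, mul_zero,
      Finset.sum_ite_eq, hr, if_true]

end Diagonals

end HamelGoulden

namespace HamelGoulden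

/-! ### Ribbons: one cell of each content between head and tail. -/

section Ribbons

/-- The content of a cell of a usual shape. -/
def cellContent (γ : ℕ × ℕ) : ℤ := (γ.2 : ℤ) - γ.1

/-- Contents of adjacent cells differ by one, so a walk that passes from contents at most `c` to
larger ones crosses from `c` to `c + 1`. -/
theorem exists_step {C : Finset (ℕ × ℕ)} (hC : (cellGraph.induce (C : Set (ℕ × ℕ))).Preconnected)
    {γ γ' : ℕ × ℕ} (hγ : γ ∈ C) (hγ' : γ' ∈ C) {c : ℤ} (h : cellContent γ ≤ c)
    (h' : c < cellContent γ') :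
    ∃ δ ∈ C, cellContent δ = c ∧ ((δ.1, δ.2 + 1) ∈ C ∨ (0 < δ.1 ∧ (δ.1 - 1, δ.2) ∈ C)) := by
  obtain ⟨w⟩ := hC ⟨γ, hγ⟩ ⟨γ', hγ'⟩
  obtain ⟨d, -, h1, h2⟩ := w.exists_boundary_dart {δ | cellContent δ.1 ≤ c} h (not_le.mpr h')
  obtain ⟨⟨⟨⟨i, j⟩, hδ⟩, ⟨⟨i', j'⟩, hδ'⟩⟩, hadj⟩ := d
  simp only [Set.mem_ofPred_eq, cellContent] at h1 h2
  simp only [SimpleGraph.comap_adj, cellGraph, SimpleGraph.fromRel_adj, Function.Embedding.subtype_apply,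
    Prod.mk.injEq] at hadj
  rw [Finset.mem_coe] at hδ hδ'
  refine ⟨(i, j), hδ, ?_, ?_⟩
  · simp only [cellContent]
    omega
  · obtain ⟨-, (⟨h3, h4⟩ | ⟨h3, h4⟩) | ⟨h3, h4⟩ | ⟨h3, h4⟩⟩ := hadj
    · omega
    · left
      rw [h3, h4] at hδ'
      exact hδ'
    · right
      refine ⟨by simp only; omega, ?_⟩
      have h5 : i - 1 = i' := by omega
      simp only [h5]
      rw [h4]
      exact hδ'
    · omega

theorem min_untopD_eq {s : Finset ℕ} {a : ℕ} (ha : a ∈ s) (h : ∀ b ∈ s, a ≤ b) :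
    s.min.untopD 0 = a := by
  have : s.min = a := le_antisymm (Finset.min_le ha)
    (Finset.le_min fun b hb => WithTop.coe_le_coe.mpr (h b hb))
  rw [this]
  rfl

theorem sup_eq_of_mem {C : Finset (ℕ × ℕ)} {f : ℕ × ℕ → ℕ} {γ : ℕ × ℕ} (hγ : γ ∈ C)
    (h : ∀ δ ∈ C, f δ ≤ f γ) : C.sup f = f γ :=
  le_antisymm (Finset.sup_le h) (Finset.le_sup hγ)

theorem min_image_eq_of_mem {C : Finset (ℕ × ℕ)} {f : ℕ × ℕ → ℕ} {γ : ℕ × ℕ} (hγ : γ ∈ C)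
    (h : ∀ δ ∈ C, f γ ≤ f δ) : (C.image f).min.untopD 0 = f γ :=
  min_untopD_eq (Finset.mem_image_of_mem f hγ) fun b hb => by
    obtain ⟨δ, hδ, rfl⟩ := Finset.mem_image.mp hb
    exact h δ hδ

namespace IsRibbon

variable {θ : Finset (ℕ × ℕ)}

theorem mem_of_le (hθ : IsRibbon θ) {γ γ' δ : ℕ × ℕ} (hγ : γ ∈ θ) (hγ' : γ' ∈ θ) (h : γ ≤ δ)
    (h' : δ ≤ γ') : δ ∈ θ := by
  obtain ⟨ν, κ, -, rfl⟩ := hθ.skew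
  rw [Finset.mem_sdiff] at hγ hγ' ⊢
  exact ⟨ν.isLowerSet h' hγ'.1, fun hκ => hγ.2 (κ.isLowerSet h hκ)⟩

/-- Two cells, one strictly south-east of the other, would by convexity enclose a `2 × 2` block.
Hence a ribbon has at most one cell on each diagonal. -/
theorem not_lt (hθ : IsRibbon θ) {γ γ' : ℕ × ℕ} (hγ : γ ∈ θ) (hγ' : γ' ∈ θ) (h : γ.1 < γ'.1) :
    γ'.2 ≤ γ.2 := by
  by_contra! hc
  obtain ⟨i, j⟩ := γ
  obtain ⟨i', j'⟩ := γ'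
  simp only at h hc
  refine hθ.no_block i j ⟨hγ, ?_, ?_, ?_⟩ <;>
    exact hθ.mem_of_le hγ hγ' (Prod.mk_le_mk.mpr ⟨by omega, by omega⟩)
      (Prod.mk_le_mk.mpr ⟨by omega, by omega⟩)

theorem eq_of_content_eq (hθ : IsRibbon θ) {γ γ' : ℕ × ℕ} (hγ : γ ∈ θ) (hγ' : γ' ∈ θ)
    (h : cellContent γ = cellContent γ') : γ = γ' := by
  have h1 := hθ.not_lt hγ hγ'
  have h2 := hθ.not_lt hγ' hγ
  unfold cellContent at h
  ext <;> omega

theorem nonempty (hθ : IsRibbon θ) : θ.Nonempty := by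
  obtain ⟨γ⟩ := hθ.connected.nonempty
  exact ⟨γ.1, γ.2⟩

/-- The cell of least content attains both the greatest row and the least column, so the two
coordinates in the definition of `head` belong to one cell. -/
theorem head_mem (hθ : IsRibbon θ) : head θ ∈ θ ∧ ∀ γ ∈ θ, cellContent (head θ) ≤ cellContent γ := by
  obtain ⟨γ, hγ, hmin⟩ := θ.exists_min_image cellContent hθ.nonempty
  have : head θ = γ := by
    refine Prod.ext (sup_eq_of_mem hγ fun δ hδ => ?_)
      (min_image_eq_of_mem (f := Prod.snd) hγ fun δ hδ => ?_)
    all_goals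
      have h1 := hθ.not_lt hγ hδ
      have h2 := hθ.not_lt hδ hγ
      have h3 := hmin δ hδ
      unfold cellContent at h3
      omega
  rw [this]
  exact ⟨hγ, hmin⟩

theorem tail_mem (hθ : IsRibbon θ) : tail θ ∈ θ ∧ ∀ γ ∈ θ, cellContent γ ≤ cellContent (tail θ) := by
  obtain ⟨γ, hγ, hmax⟩ := θ.exists_max_image cellContent hθ.nonempty
  have : tail θ = γ := by
    refine Prod.ext (min_image_eq_of_mem (f := Prod.fst) hγ fun δ hδ => ?_)
      (sup_eq_of_mem hγ fun δ hδ => ?_)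
    all_goals
      have h1 := hθ.not_lt hγ hδ
      have h2 := hθ.not_lt hδ hγ
      have h3 := hmax δ hδ
      unfold cellContent at h3
      omega
  rw [this]
  exact ⟨hγ, hmax⟩

/-- A cell of a ribbon which is not the head has a left or a lower neighbour in the ribbon. -/
theorem exists_pred (hθ : IsRibbon θ) {i j : ℕ} (h : (i, j) ∈ θ) (hne : (i, j) ≠ head θ) :
    (0 < j ∧ (i, j - 1) ∈ θ) ∨ (i + 1, j) ∈ θ := by
  have h1 := hθ.head_mem
  have h2 : cellContent (head θ) < cellContent (i, j) := lt_of_le_of_ne (h1.2 _ h) fun he =>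
    hne (hθ.eq_of_content_eq h1.1 h he).symm
  obtain ⟨⟨i', j'⟩, hδ, hc, hs⟩ := exists_step hθ.connected.preconnected h1.1 h
    (c := cellContent (i, j) - 1) (by omega) (by omega)
  rcases hs with hs | ⟨hpos, hs⟩
  · have := hθ.eq_of_content_eq hs h (by simp only [cellContent] at hc ⊢; push_cast; omega)
    simp only [Prod.mk.injEq] at this
    left
    rw [← this.1, ← this.2]
    exact ⟨by omega, hδ⟩
  · have := hθ.eq_of_content_eq hs h (by simp only [cellContent] at hc hpos ⊢; omega)
    simp only [Prod.mk.injEq] at this hpos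
    right
    rw [← this.2, ← this.1, Nat.sub_add_cancel (by omega)]
    exact hδ

/-- A cell of a ribbon which is not the tail has an upper or a right neighbour in the ribbon. -/
theorem exists_succ (hθ : IsRibbon θ) {γ : ℕ × ℕ} (h : γ ∈ θ) (hne : γ ≠ tail θ) :
    (γ.1, γ.2 + 1) ∈ θ ∨ (0 < γ.1 ∧ (γ.1 - 1, γ.2) ∈ θ) := by
  have h1 := hθ.tail_mem
  have h2 : cellContent γ < cellContent (tail θ) := lt_of_le_of_ne (h1.2 _ h) fun he =>
    hne (hθ.eq_of_content_eq h h1.1 he)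
  obtain ⟨δ, hδ, hc, hs⟩ := exists_step hθ.connected.preconnected h h1.1 le_rfl h2
  rw [← hθ.eq_of_content_eq hδ h hc]
  exact hs

theorem exists_content (hθ : IsRibbon θ) {c : ℤ} (h : cellContent (head θ) ≤ c)
    (h' : c ≤ cellContent (tail θ)) : ∃ γ ∈ θ, cellContent γ = c := by
  rcases h'.lt_or_eq with h' | h'
  · obtain ⟨δ, hδ, hc, -⟩ := exists_step hθ.connected.preconnected hθ.head_mem.1 hθ.tail_mem.1 h h'
    exact ⟨δ, hδ, hc⟩
  · exact ⟨_, hθ.tail_mem.1, h'.symm⟩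

end IsRibbon

end Ribbons

/-! ### Outer decompositions: the direction is constant along a diagonal. -/

namespace RShape

variable {lam mu : YoungDiagram} {hle : mu ≤ lam} {k : ℕ} {θ : Fin k → Finset (ℕ × ℕ)}

theorem usual_content (γ : ℕ × ℕ) : (usual lam mu hle).content γ = cellContent γ := by
  simp only [content, usual, cellContent]
  ring

theorem mem_usual_cells {γ : ℕ × ℕ} : γ ∈ (usual lam mu hle).cells ↔ γ ∈ lam ∧ γ ∉ mu := by
  simp [cells, usual]

theorem mem_usual_cells_iff {i j : ℕ} {x : ℤ} (hx : (j : ℤ) = i + x) :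
    (i, j) ∈ (usual lam mu hle).cells ↔ diagRow mu x ≤ i ∧ (i : ℤ) < diagRow lam x := by
  rw [mem_usual_cells, mem_iff_lt_diagRow hx, mem_iff_lt_diagRow hx]
  omega

theorem cells_convex {γ γ' δ : ℕ × ℕ} (hγ : γ ∈ (usual lam mu hle).cells)
    (hγ' : γ' ∈ (usual lam mu hle).cells) (h : γ ≤ δ) (h' : δ ≤ γ') :
    δ ∈ (usual lam mu hle).cells := by
  rw [mem_usual_cells] at *
  exact ⟨lam.isLowerSet h' hγ'.1, fun hm => hγ.2 (mu.isLowerSet h hm)⟩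

namespace IsOuterDecomposition

theorem mem_cells (hθ : (usual lam mu hle).IsOuterDecomposition θ) {a : Fin k} {γ : ℕ × ℕ}
    (h : γ ∈ θ a) : γ ∈ (usual lam mu hle).cells := by
  rw [← hθ.cover]
  exact Finset.mem_biUnion.mpr ⟨a, Finset.mem_univ _, h⟩

theorem exists_mem (hθ : (usual lam mu hle).IsOuterDecomposition θ) {γ : ℕ × ℕ}
    (h : γ ∈ (usual lam mu hle).cells) : ∃ a, γ ∈ θ a := by
  rw [← hθ.cover] at h
  obtain ⟨a, -, ha⟩ := Finset.mem_biUnion.mp h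
  exact ⟨a, ha⟩

theorem eq_of_mem (hθ : (usual lam mu hle).IsOuterDecomposition θ) {a b : Fin k} {γ : ℕ × ℕ}
    (h : γ ∈ θ a) (h' : γ ∈ θ b) : a = b := by
  by_contra hne
  exact Finset.disjoint_left.mp (hθ.disjoint a b hne) h h'

/-- The cell `γ` of `θ a` goes up. -/
def CellGoesUp (D : RShape) (θ : Fin k → Finset (ℕ × ℕ)) (a : Fin k) (γ : ℕ × ℕ) : Prop :=
  (0 < γ.1 ∧ (γ.1 - 1, γ.2) ∈ θ a) ∨ (γ = tail (θ a) ∧ D.OnTop γ)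

/-- The cell `(i, j + 1)` between the two has a left and a lower neighbour in the shape, so it is
not a head. Its predecessor is therefore one of the two cells: if it is the left one, both go right;
if it is the lower one, both go up. In each case the position of tails on the perimeter settles the
cell that is not the predecessor. -/
theorem cellGoesUp_iff_of_adjacent (hθ : (usual lam mu hle).IsOuterDecomposition θ) {a b : Fin k}
    {i j : ℕ} (ha : (i, j) ∈ θ a) (hb : (i + 1, j + 1) ∈ θ b) :
    CellGoesUp (usual lam mu hle) θ a (i, j) ↔
      CellGoesUp (usual lam mu hle) θ b (i + 1, j + 1) := by
  have hε : (i, j + 1) ∈ (usual lam mu hle).cells :=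
    cells_convex (hθ.mem_cells ha) (hθ.mem_cells hb) (Prod.mk_le_mk.mpr ⟨le_rfl, Nat.le_succ _⟩)
      (Prod.mk_le_mk.mpr ⟨Nat.le_succ _, le_rfl⟩)
  have hab : a ≠ b := by
    rintro rfl
    have := (hθ.ribbon a).eq_of_content_eq ha hb (by simp [cellContent])
    simp at this
  obtain ⟨e, he⟩ := hθ.exists_mem hε
  have hhead : (i, j + 1) ≠ head (θ e) := by
    intro h
    have := hθ.head_perimeter e
    rw [← h] at this
    rcases this with (h | h) | h
    · simp at h
    · exact h (hθ.mem_cells ha)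
    · exact h (hθ.mem_cells hb)
  rcases (hθ.ribbon e).exists_pred he hhead with ⟨-, h⟩ | h
  · rw [Nat.add_sub_cancel] at h
    obtain rfl := hθ.eq_of_mem ha h
    refine iff_of_false ?_ ?_
    · rintro (⟨hpos, h1⟩ | ⟨h1, -⟩)
      · simp only at hpos h1
        have := (hθ.ribbon a).eq_of_content_eq h1 he
          (by simp only [cellContent]; push_cast [hpos]; omega)
        simp at this
      · have := (hθ.ribbon a).tail_mem.2 _ he
        rw [← h1] at this
        simp only [cellContent] at this
        omega
    · rintro (⟨-, h1⟩ | ⟨-, h1 | h1⟩)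
      · exact hab (hθ.eq_of_mem he h1)
      · simp at h1
      · exact h1 hε
  · obtain rfl := hθ.eq_of_mem hb h
    refine iff_of_true ?_ (Or.inl ⟨Nat.succ_pos _, he⟩)
    by_cases ht : (i, j) = tail (θ a)
    · right
      refine ⟨ht, ?_⟩
      have := hθ.tail_perimeter a
      rw [← ht] at this
      exact this.resolve_right fun h => h hε
    · rcases (hθ.ribbon a).exists_succ ha ht with h1 | h1
      · exact absurd (hθ.eq_of_mem h1 he) hab
      · exact Or.inl h1

theorem cellGoesUp_iff_of_le (hθ : (usual lam mu hle).IsOuterDecomposition θ) (s : ℕ) :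
    ∀ {a b : Fin k} {i j : ℕ}, (i, j) ∈ θ a → (i + s, j + s) ∈ θ b →
    (CellGoesUp (usual lam mu hle) θ a (i, j) ↔
      CellGoesUp (usual lam mu hle) θ b (i + s, j + s)) := by
  induction s with
  | zero =>
    intro a b i j ha hb
    obtain rfl := hθ.eq_of_mem ha hb
    rfl
  | succ s ih =>
    intro a b i j ha hb
    obtain ⟨e, he⟩ := hθ.exists_mem (γ := (i + s, j + s)) (cells_convex (hθ.mem_cells ha)
      (hθ.mem_cells hb) (Prod.mk_le_mk.mpr ⟨by omega, by omega⟩)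
      (Prod.mk_le_mk.mpr ⟨by omega, by omega⟩))
    exact (ih ha he).trans (hθ.cellGoesUp_iff_of_adjacent he hb)

theorem goesUp_iff (hθ : (usual lam mu hle).IsOuterDecomposition θ) {a : Fin k} {γ : ℕ × ℕ}
    (h : γ ∈ θ a) : (usual lam mu hle).GoesUp θ (cellContent γ) ↔
      CellGoesUp (usual lam mu hle) θ a γ := by
  constructor
  · rintro ⟨b, δ, hδ, hc, hup⟩
    change CellGoesUp (usual lam mu hle) θ b δ at hup
    obtain ⟨i, j⟩ := γ
    obtain ⟨i', j'⟩ := δ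
    rw [usual_content] at hc
    simp only [cellContent] at hc
    rcases le_total i i' with hi | hi
    · obtain ⟨s, rfl⟩ := Nat.exists_eq_add_of_le hi
      obtain rfl : j' = j + s := by push_cast at hc; omega
      exact (hθ.cellGoesUp_iff_of_le s h hδ).mpr hup
    · obtain ⟨s, rfl⟩ := Nat.exists_eq_add_of_le hi
      obtain rfl : j = j' + s := by push_cast at hc; omega
      exact (hθ.cellGoesUp_iff_of_le s hδ h).mp hup
  · intro hup
    exact ⟨a, γ, h, usual_content γ, hup⟩

/-- A ribbon going up continues whenever the shape allows it and otherwise ends. This and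
`right_mem` are the form in which directions are used for chains. -/
theorem up_mem (hθ : (usual lam mu hle).IsOuterDecomposition θ) {a : Fin k} {i j : ℕ}
    (h : (i, j) ∈ θ a) (hup : (usual lam mu hle).GoesUp θ (cellContent (i, j))) :
    (0 < i → (i - 1, j) ∈ (usual lam mu hle).cells → (i - 1, j) ∈ θ a) ∧
      (¬ (0 < i ∧ (i - 1, j) ∈ (usual lam mu hle).cells) → (i, j) = tail (θ a)) := by
  rcases (hθ.goesUp_iff h).mp hup with ⟨h1, h2⟩ | ⟨h1, h2 | h2⟩
  · exact ⟨fun _ _ => h2, fun hc => absurd ⟨h1, hθ.mem_cells h2⟩ hc⟩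
  · exact ⟨fun hpos => absurd h2 hpos.ne', fun _ => h1⟩
  · exact ⟨fun _ hm => absurd hm h2, fun _ => h1⟩

theorem right_mem (hθ : (usual lam mu hle).IsOuterDecomposition θ) {a : Fin k} {i j : ℕ}
    (h : (i, j) ∈ θ a) (hup : ¬ (usual lam mu hle).GoesUp θ (cellContent (i, j))) :
    ((i, j + 1) ∈ (usual lam mu hle).cells → (i, j + 1) ∈ θ a) ∧
      ((i, j + 1) ∉ (usual lam mu hle).cells → (i, j) = tail (θ a)) := by
  rw [hθ.goesUp_iff h, CellGoesUp, not_or] at hup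
  by_cases ht : (i, j) = tail (θ a)
  · have := hθ.tail_perimeter a
    rw [← ht] at this
    exact ⟨fun hm => absurd hm (this.resolve_left fun h => hup.2 ⟨ht, h⟩), fun _ => ht⟩
  · have := ((hθ.ribbon a).exists_succ h ht).resolve_right hup.1
    exact ⟨fun _ => this, fun hn => absurd (hθ.mem_cells this) hn⟩

end IsOuterDecomposition

end RShape

end HamelGoulden

/-! ### The ribbons of an outer decomposition as a chain system. -/

namespace HamelGoulden.RShape.IsOuterDecomposition

variable {lam mu : YoungDiagram} {hle : mu ≤ lam} {k : ℕ} {θ : Fin k → Finset (ℕ × ℕ)}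

open Classical in
/-- The contents `x` such that the cells of content `x - 1` go right; if there are no such cells,
the positions next to the diagonals of content `x - 1` and `x` are all taken into account. -/
noncomputable def rightContents (lam mu : YoungDiagram) (hle : mu ≤ lam)
    (θ : Fin k → Finset (ℕ × ℕ)) (n : ℕ) : Finset ℤ :=
  (Finset.Icc (1 - lam.colLen 0 : ℤ) n).filter fun x =>
    if diagRow mu (x - 1) < diagRow lam (x - 1) then ¬ (usual lam mu hle).GoesUp θ (x - 1)
    -- With no cells of content `x - 1` the direction is free. This choice makes the conditions on
    -- contents that end no chain hold: if the lower boundary changes its row there, the upper one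
    -- must too.
    else diagRow lam (x - 1) = diagRow lam x

/-- The end of the ribbon `θ a` as a chain. -/
def ribbonEnd (D : RShape) (θ : Fin k → Finset (ℕ × ℕ)) (a : Fin k) : ℤ := D.tailContent θ a + 1

open Classical in
/-- The start of the ribbon with end `y`. -/
noncomputable def ribbonStart (D : RShape) (θ : Fin k → Finset (ℕ × ℕ)) (y : ℤ) : ℤ :=
  if h : ∃ a, ribbonEnd D θ a = y then D.headContent θ h.choose else 0

open Classical in
/-- The end of the ribbon that contains the cell of content `x` in row `r`. -/
noncomputable def cellEnd (D : RShape) (θ : Fin k → Finset (ℕ × ℕ)) (x r : ℤ) : ℤ :=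
  if h : ∃ a, (r.toNat, (r + x).toNat) ∈ θ a then ribbonEnd D θ h.choose else 0

variable {n : ℕ}

theorem content_mem_Icc (hn : lam.rowLen 0 ≤ n) {x r : ℤ} (h : diagRow mu x ≤ r)
    (h' : r < diagRow lam x) : 1 - lam.colLen 0 ≤ x ∧ x < n := by
  obtain ⟨i, j, hi, hj, h1, -⟩ := exists_cell_of_lt_diagRow h h'
  have h2 := YoungDiagram.mem_iff_lt_colLen.mp h1
  have h3 := YoungDiagram.mem_iff_lt_rowLen.mp h1
  have h4 := lam.colLen_anti 0 j (Nat.zero_le _)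
  have h5 := lam.rowLen_anti 0 i (Nat.zero_le _)
  omega

theorem mem_rightContents {x r : ℤ} (hn : lam.rowLen 0 ≤ n) (h : diagRow mu (x - 1) ≤ r)
    (h' : r < diagRow lam (x - 1)) :
    x ∈ rightContents lam mu hle θ n ↔ ¬ (usual lam mu hle).GoesUp θ (x - 1) := by
  have := content_mem_Icc hn h h'
  rw [rightContents, Finset.mem_filter, if_pos (lt_of_le_of_lt h h'), Finset.mem_Icc]
  exact and_iff_right ⟨by omega, by omega⟩

theorem cellEnd_eq (hθ : (usual lam mu hle).IsOuterDecomposition θ) {a : Fin k} {i j : ℕ}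
    (h : (i, j) ∈ θ a) {x r : ℤ} (hr : r = i) (hx : r + x = j) :
    cellEnd (usual lam mu hle) θ x r = ribbonEnd (usual lam mu hle) θ a := by
  subst hr
  have h' : ∃ a, ((i : ℤ).toNat, ((i : ℤ) + x).toNat) ∈ θ a := ⟨a, by rw [hx]; exact h⟩
  have h2 : ((i : ℤ).toNat, ((i : ℤ) + x).toNat) = (i, j) := by rw [hx]; simp
  rw [cellEnd, dif_pos h', hθ.eq_of_mem (γ := ((i : ℤ).toNat, ((i : ℤ) + x).toNat)) h'.choose_spec
    (by rw [h2]; exact h)]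

theorem exists_ribbon (hθ : (usual lam mu hle).IsOuterDecomposition θ) {x r : ℤ}
    (h : diagRow mu x ≤ r) (h' : r < diagRow lam x) :
    ∃ a : Fin k, ∃ i j : ℕ, (i, j) ∈ θ a ∧ r = i ∧ r + x = j := by
  obtain ⟨i, j, hi, hj, h1, h2⟩ := exists_cell_of_lt_diagRow h h'
  obtain ⟨a, ha⟩ := hθ.exists_mem (mem_usual_cells.mpr ⟨h1, h2⟩)
  exact ⟨a, i, j, ha, hi.symm, hj.symm⟩

/-- A tail whose direction is up has no cell above it, and one whose direction is right has no cell
to its right. Its row is then determined by the boundary and its content, so each content has at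
most one tail. -/
theorem ribbonEnd_injective (hθ : (usual lam mu hle).IsOuterDecomposition θ) :
    Function.Injective (ribbonEnd (usual lam mu hle) θ) := by
  intro a b h
  simp only [ribbonEnd, tailContent, usual_content, add_left_inj] at h
  have key : ∀ a : Fin k,
      ((tail (θ a)).1 : ℤ) = if (usual lam mu hle).GoesUp θ (cellContent (tail (θ a))) then
        diagRow mu (cellContent (tail (θ a)) + 1) else diagRow lam (cellContent (tail (θ a)) + 1) := by
    intro a
    have hm := (hθ.ribbon a).tail_mem
    generalize tail (θ a) = γ at hm
    obtain ⟨i, j⟩ := γ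
    have h1 := (mem_usual_cells_iff (x := cellContent (i, j))
      (by simp only [cellContent]; ring)).mp (hθ.mem_cells hm.1)
    have s1 := diagRow_step mu (cellContent (i, j) + 1)
    have s2 := diagRow_step lam (cellContent (i, j) + 1)
    rw [add_sub_cancel_right] at s1 s2
    have s3 := diagRow_nonneg mu (cellContent (i, j) + 1)
    split_ifs with hup
    · have h2 := (hθ.up_mem hm.1 hup).1
      by_contra hne
      have h3 := hm.2 _ (h2 (by omega) ((mem_usual_cells_iff (x := cellContent (i, j) + 1) (by
        simp only [cellContent]; omega)).mpr (by omega)))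
      simp only [cellContent] at h3
      omega
    · have h2 := (hθ.right_mem hm.1 hup).1
      by_contra hne
      have h3 := hm.2 _ (h2 ((mem_usual_cells_iff (x := cellContent (i, j) + 1) (by
        simp only [cellContent]; push_cast; omega)).mpr (by omega)))
      simp only [cellContent] at h3
      push_cast at h3
      omega
  have ha := key a
  have hb := key b
  rw [h, ← hb] at ha
  have h3 : tail (θ a) = tail (θ b) := by
    unfold cellContent at h
    ext <;> omega
  exact hθ.eq_of_mem (hθ.ribbon a).tail_mem.1 (h3 ▸ (hθ.ribbon b).tail_mem.1)

theorem ribbonStart_ribbonEnd (hθ : (usual lam mu hle).IsOuterDecomposition θ) (a : Fin k) :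
    ribbonStart (usual lam mu hle) θ (ribbonEnd (usual lam mu hle) θ a) =
      (usual lam mu hle).headContent θ a := by
  have h : ∃ b, ribbonEnd (usual lam mu hle) θ b = ribbonEnd (usual lam mu hle) θ a := ⟨a, rfl⟩
  rw [ribbonStart, dif_pos h, hθ.ribbonEnd_injective h.choose_spec]

/-- If the cell from which the direction of content `p - 1` leads to the head were in the shape, its
ribbon would continue into the head, contradicting the minimality of the head's content. So the head
is at the end of its diagonal where that predecessor is missing, which also determines its row. -/
theorem head_row (hθ : (usual lam mu hle).IsOuterDecomposition θ) (hn : lam.rowLen 0 ≤ n)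
    (a : Fin k) {p : ℤ} (hp : p = (usual lam mu hle).headContent θ a) :
    diagRow mu p ≤ (head (θ a)).1 ∧ ((head (θ a)).1 : ℤ) < diagRow lam p ∧
    (head (θ a)).1 + p = (head (θ a)).2 ∧
    (p ∈ rightContents lam mu hle θ n →
      ((head (θ a)).1 : ℤ) = diagRow mu p ∧ diagRow mu (p - 1) ≠ diagRow mu p) ∧
    (p ∉ rightContents lam mu hle θ n →
      ((head (θ a)).1 : ℤ) = diagRow lam p - 1 ∧ diagRow lam (p - 1) = diagRow lam p) := by
  have hm := (hθ.ribbon a).head_mem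
  rw [headContent, usual_content] at hp
  set i := (head (θ a)).1 with hi
  set j := (head (θ a)).2 with hj
  have hij : head (θ a) = (i, j) := rfl
  rw [hij] at hm hp
  have hp' : (j : ℤ) = i + p := by rw [hp, cellContent]; ring
  have h1 := (mem_usual_cells_iff hp').mp (hθ.mem_cells hm.1)
  have s1 := diagRow_step mu p
  have s2 := diagRow_step lam p
  refine ⟨h1.1, h1.2, hp'.symm, fun hX => ?_, fun hX => ?_⟩
  · by_contra hne
    have l1 : diagRow mu (p - 1) ≤ i := by omega
    have l2 : (i : ℤ) < diagRow lam (p - 1) := by omega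
    rw [mem_rightContents hn l1 l2] at hX
    obtain ⟨b, i', j', hb, hi', hj'⟩ := hθ.exists_ribbon l1 l2
    obtain rfl : i = i' := by omega
    have hc : cellContent (i, j') = p - 1 := by simp only [cellContent]; omega
    have h2 := (hθ.right_mem hb (by rw [hc]; exact hX)).1
    rw [show j' + 1 = j by omega] at h2
    obtain rfl := hθ.eq_of_mem hm.1 (h2 (hθ.mem_cells hm.1))
    have := hm.2 _ hb
    omega
  · by_contra hne
    have l1 : diagRow mu (p - 1) ≤ i + 1 := by omega
    have l2 : (i : ℤ) + 1 < diagRow lam (p - 1) := by omega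
    rw [mem_rightContents hn l1 l2, not_not] at hX
    obtain ⟨b, i', j', hb, hi', hj'⟩ := hθ.exists_ribbon l1 l2
    obtain rfl : i + 1 = i' := by omega
    have hc : cellContent (i + 1, j') = p - 1 := by simp only [cellContent]; push_cast; omega
    have h2 := (hθ.up_mem hb (by rw [hc]; exact hX)).1 (Nat.succ_pos _)
    rw [show j' = j by omega, Nat.add_sub_cancel] at h2
    obtain rfl := hθ.eq_of_mem hm.1 (h2 (hθ.mem_cells hm.1))
    have := hm.2 _ hb
    omega

/-- The ribbons of an outer decomposition form a chain system. -/
theorem isChainSystem (hθ : (usual lam mu hle).IsOuterDecomposition θ) (hn : lam.rowLen 0 ≤ n) :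
    IsChainSystem (diagRow mu) (diagRow lam) (1 - lam.colLen 0) n (rightContents lam mu hle θ n)
      (Finset.univ.image (ribbonEnd (usual lam mu hle) θ)) (ribbonStart (usual lam mu hle) θ)
      (cellEnd (usual lam mu hle) θ) where
  mem_Icc := by
    intro y hy
    obtain ⟨a, -, rfl⟩ := Finset.mem_image.mp hy
    have h1 := (mem_usual_cells_iff (i := (tail (θ a)).1) (j := (tail (θ a)).2)
      (x := cellContent (tail (θ a))) (by unfold cellContent; ring)).mp (hθ.mem_cells (hθ.ribbon a).tail_mem.1)
    have := content_mem_Icc hn h1.1 h1.2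
    rw [ribbonEnd, tailContent, usual_content, Finset.mem_Icc]
    omega
  st_mem_Icc := by
    intro y hy
    obtain ⟨a, -, rfl⟩ := Finset.mem_image.mp hy
    rw [hθ.ribbonStart_ribbonEnd]
    have h := hθ.head_row hn a rfl
    have := content_mem_Icc hn h.1 h.2.1
    rw [Finset.mem_Icc]
    omega
  st_right := by
    intro y hy
    obtain ⟨a, -, rfl⟩ := Finset.mem_image.mp hy
    rw [hθ.ribbonStart_ribbonEnd]
    exact fun h => ((hθ.head_row hn a rfl).2.2.2.1 h).2
  st_up := by
    intro y hy
    obtain ⟨a, -, rfl⟩ := Finset.mem_image.mp hy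
    rw [hθ.ribbonStart_ribbonEnd]
    exact fun h => ((hθ.head_row hn a rfl).2.2.2.2 h).2
  st_inj := by
    intro y hy y' hy' h
    obtain ⟨a, -, rfl⟩ := Finset.mem_image.mp hy
    obtain ⟨b, -, rfl⟩ := Finset.mem_image.mp hy'
    rw [hθ.ribbonStart_ribbonEnd, hθ.ribbonStart_ribbonEnd] at h
    have ha := hθ.head_row hn a h.symm
    have hb := hθ.head_row hn b rfl
    have : head (θ a) = head (θ b) := by
      by_cases hX : (usual lam mu hle).headContent θ b ∈ rightContents lam mu hle θ n
      · have h1 := (ha.2.2.2.1 hX).1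
        have h2 := (hb.2.2.2.1 hX).1
        ext <;> omega
      · have h1 := (ha.2.2.2.2 hX).1
        have h2 := (hb.2.2.2.2 hX).1
        ext <;> omega
    rw [hθ.eq_of_mem (hθ.ribbon a).head_mem.1 (this ▸ (hθ.ribbon b).head_mem.1)]
  not_end_right := by
    intro y hy hE hX
    have s1 := diagRow_step lam y
    have s2 := diagRow_mono hle y
    have s3 := diagRow_step mu y
    by_cases hc : diagRow mu (y - 1) < diagRow lam (y - 1)
    · by_contra hne
      have l1 : diagRow mu (y - 1) ≤ diagRow lam y := by omega
      have l2 : diagRow lam y < diagRow lam (y - 1) := by omega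
      obtain ⟨b, i, j, hb, hi, hj⟩ := hθ.exists_ribbon l1 l2
      have hcc : cellContent (i, j) = y - 1 := by simp only [cellContent]; omega
      rw [mem_rightContents hn l1 l2, ← hcc] at hX
      have ht := (hθ.right_mem hb hX).2 fun h => by
        rw [mem_usual_cells_iff (x := y) (by push_cast; omega)] at h
        omega
      refine hE (Finset.mem_image.mpr ⟨b, Finset.mem_univ _, ?_⟩)
      rw [ribbonEnd, tailContent, usual_content, ← ht, hcc]
      ring
    · rw [rightContents, Finset.mem_filter, if_neg hc] at hX
      exact hX.2
  not_end_up := by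
    intro y hy hE hX hne
    have s1 := diagRow_step lam y
    have s2 := diagRow_mono hle y
    have s3 := diagRow_mono hle (y - 1)
    by_cases hc : diagRow mu (y - 1) < diagRow lam (y - 1)
    · obtain ⟨b, i, j, hb, hi, hj⟩ := hθ.exists_ribbon le_rfl hc
      have hcc : cellContent (i, j) = y - 1 := by simp only [cellContent]; omega
      rw [mem_rightContents hn le_rfl hc, not_not, ← hcc] at hX
      have ht := (hθ.up_mem hb hX).2 fun h => by
        rw [mem_usual_cells_iff (x := y) (by omega)] at h
        omega
      refine hE (Finset.mem_image.mpr ⟨b, Finset.mem_univ _, ?_⟩)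
      rw [ribbonEnd, tailContent, usual_content, ← ht, hcc]
      ring
    · rw [rightContents, Finset.mem_filter, if_neg hc, not_and] at hX
      have := hX hy
      omega
  en_mem := by
    intro x r h h'
    obtain ⟨a, i, j, ha, hi, hj⟩ := hθ.exists_ribbon h h'
    rw [hθ.cellEnd_eq ha hi hj]
    exact Finset.mem_image_of_mem _ (Finset.mem_univ _)
  en_right := by
    intro x hX r h h' h''
    obtain ⟨a, i, j, ha, hi, hj⟩ := hθ.exists_ribbon h h'
    have hcc : cellContent (i, j) = x - 1 := by simp only [cellContent]; omega
    have s1 := diagRow_step mu x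
    rw [mem_rightContents hn h h', ← hcc] at hX
    have hr := (hθ.right_mem ha hX).1
      ((mem_usual_cells_iff (x := x) (by push_cast; omega)).mpr (by omega))
    rw [hθ.cellEnd_eq ha hi hj, hθ.cellEnd_eq hr hi (by push_cast; omega)]
  en_right_last := by
    intro x hX h h'
    obtain ⟨a, i, j, ha, hi, hj⟩ := hθ.exists_ribbon h h'
    have hcc : cellContent (i, j) = x - 1 := by simp only [cellContent]; omega
    rw [mem_rightContents hn h h', ← hcc] at hX
    have ht := (hθ.right_mem ha hX).2 fun h => by
      rw [mem_usual_cells_iff (x := x) (by push_cast; omega)] at h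
      omega
    rw [hθ.cellEnd_eq ha hi hj, ribbonEnd, tailContent, usual_content, ← ht, hcc]
    ring
  en_up := by
    intro x hX r h h' h''
    obtain ⟨a, i, j, ha, hi, hj⟩ := hθ.exists_ribbon h h'
    have hcc : cellContent (i, j) = x - 1 := by simp only [cellContent]; omega
    have s1 := diagRow_step mu x
    have s2 := diagRow_step lam x
    have s3 := diagRow_nonneg mu x
    rw [mem_rightContents hn h h', not_not, ← hcc] at hX
    have hr := (hθ.up_mem ha hX).1 (by omega)
      ((mem_usual_cells_iff (x := x) (by omega)).mpr (by omega))
    rw [hθ.cellEnd_eq ha hi hj, hθ.cellEnd_eq hr (by omega) (by omega)]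
  en_up_last := by
    intro x hX h h'
    have h1 : diagRow mu (x - 1) ≤ diagRow mu x := by omega
    obtain ⟨a, i, j, ha, hi, hj⟩ := hθ.exists_ribbon h1 h'
    have hcc : cellContent (i, j) = x - 1 := by simp only [cellContent]; omega
    rw [mem_rightContents hn h1 h', not_not, ← hcc] at hX
    have ht := (hθ.up_mem ha hX).2 fun h => by
      rw [mem_usual_cells_iff (x := x) (by omega)] at h
      omega
    rw [hθ.cellEnd_eq ha hi hj, ribbonEnd, tailContent, usual_content, ← ht, hcc]
    ring
  en_st_right := by
    intro y hy
    obtain ⟨a, -, rfl⟩ := Finset.mem_image.mp hy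
    rw [hθ.ribbonStart_ribbonEnd]
    intro hX _
    have h := hθ.head_row hn a rfl
    have h1 := (h.2.2.2.1 hX).1
    rw [← h1]
    exact hθ.cellEnd_eq (hθ.ribbon a).head_mem.1 rfl h.2.2.1
  en_st_up := by
    intro y hy
    obtain ⟨a, -, rfl⟩ := Finset.mem_image.mp hy
    rw [hθ.ribbonStart_ribbonEnd]
    intro hX _
    have h := hθ.head_row hn a rfl
    have h1 := (h.2.2.2.2 hX).1
    rw [← h1]
    exact hθ.cellEnd_eq (hθ.ribbon a).head_mem.1 rfl h.2.2.1
  st_of_eq := by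
    intro y hy h
    obtain ⟨a, -, rfl⟩ := Finset.mem_image.mp hy
    rw [hθ.ribbonStart_ribbonEnd] at h
    have h := hθ.head_row hn a rfl
    omega

end HamelGoulden.RShape.IsOuterDecomposition

namespace HamelGoulden

/-! ### Right turns of a path of contents and the starts of its columns. -/

section Turns

variable (U : ℤ → Prop)

/-- The contents of the first cells of the columns of a strip starting with content `p`, in which the
cells of content `c` go up if `U c` and to the right otherwise. -/
noncomputable def columnStart (p : ℤ) : ℕ → ℤ
  | 0 => p
  | k + 1 => p + Nat.nth (fun d : ℕ => ¬ U (p + d)) k + 1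

/-- The number of contents in `[p, c)` that go right. -/
noncomputable def rightCount [DecidablePred U] (p c : ℤ) : ℕ := ((Finset.Ico p c).filter fun s => ¬ U s).card

theorem rightCount_eq_count [DecidablePred U] (p c : ℤ) :
    rightCount U p c = Nat.count (fun d : ℕ => ¬ U (p + d)) (c - p).toNat := by
  rw [Nat.count_eq_card_filter_range, rightCount]
  symm
  refine Finset.card_bij (fun d _ => p + d) ?_ ?_ ?_
  · intro d hd
    simp only [Finset.mem_filter, Finset.mem_range, Finset.mem_Ico] at hd ⊢
    exact ⟨by omega, hd.2⟩
  · intro d _ d' _ h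
    omega
  · intro x hx
    simp only [Finset.mem_filter, Finset.mem_Ico] at hx
    have : p + ((x - p).toNat : ℤ) = x := by omega
    refine ⟨(x - p).toNat, ?_, this⟩
    simp only [Finset.mem_filter, Finset.mem_range]
    rw [this]
    exact ⟨by omega, hx.2⟩

variable {U}
-- Since all large contents go right, `Nat.nth` never falls back to its default value, and
-- `columnStart` increases strictly for all indices.
theorem infinite_right (hU : ∃ B, ∀ c ≥ B, ¬ U c) (p : ℤ) : (Set.ofPred fun d : ℕ => ¬ U (p + d)).Infinite := by
  obtain ⟨B, hB⟩ := hU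
  refine Set.infinite_of_forall_exists_gt fun a => ⟨a + 1 + (B - p).toNat, hB _ ?_, by omega⟩
  push_cast
  omega

theorem lt_rightCount_iff [DecidablePred U] (hU : ∃ B, ∀ c ≥ B, ¬ U c)
    {p c : ℤ} {k : ℕ} :
    k < rightCount U p c ↔ columnStart U p (k + 1) ≤ c := by
  rw [rightCount_eq_count, ← not_le, Nat.count_le_iff_le_nth (infinite_right hU p), not_le]
  simp only [columnStart]
  omega

theorem columnStart_strictMono (hU : ∃ B, ∀ c ≥ B, ¬ U c) (p : ℤ) : StrictMono (columnStart U p) := by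
  refine strictMono_nat_of_lt_succ fun k => ?_
  cases k with
  | zero => simp only [columnStart]; omega
  | succ k =>
    have := Nat.nth_strictMono (infinite_right hU p) (Nat.lt_add_one k)
    simp only [columnStart]
    omega

theorem not_up_columnStart (hU : ∃ B, ∀ c ≥ B, ¬ U c) (p : ℤ) (k : ℕ) : ¬ U (columnStart U p (k + 1) - 1) := by
  have := Nat.nth_mem_of_infinite (infinite_right hU p) k
  simpa only [columnStart, add_sub_cancel_right] using this

theorem exists_columnStart_eq [DecidablePred U] {p x : ℤ} (hx : p < x) (h : ¬ U (x - 1)) :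
    ∃ k, columnStart U p (k + 1) = x := by
  have hd : p + ((x - 1 - p).toNat : ℤ) = x - 1 := by omega
  have := Nat.nth_count (p := fun d : ℕ => ¬ U (p + d)) (n := (x - 1 - p).toNat) (by rwa [hd])
  refine ⟨Nat.count (fun d : ℕ => ¬ U (p + d)) (x - 1 - p).toNat, ?_⟩
  rw [columnStart, this]
  omega

theorem rightCount_columnStart [DecidablePred U] (hU : ∃ B, ∀ c ≥ B, ¬ U c) (p : ℤ) (k : ℕ) :
    rightCount U p (columnStart U p k) = k := by
  have h : ∀ l, l < rightCount U p (columnStart U p k) ↔ l < k := fun l => by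
    rw [lt_rightCount_iff hU, (columnStart_strictMono hU p).le_iff_le]
    exact Nat.succ_le_iff
  have h1 := h k
  have h2 := h (rightCount U p (columnStart U p k))
  omega

/-- The contents in `(p, r)` reached by a step to the right are exactly the starts of the columns
after the first one. -/
theorem sum_turns [DecidablePred U] (hU : ∃ B, ∀ c ≥ B, ¬ U c) {R : Type*}
    [AddCommMonoid R] (f : ℤ → R) (p r : ℤ) :
    ∑ x ∈ (Finset.Ioo p r).filter (fun x => ¬ U (x - 1)), f x =
      ∑ k ∈ Finset.range (rightCount U p (r - 1)), f (columnStart U p (k + 1)) := by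
  symm
  refine Finset.sum_bij (fun k _ => columnStart U p (k + 1)) ?_ ?_ ?_ ?_
  · intro k hk
    rw [Finset.mem_range, lt_rightCount_iff hU] at hk
    have := columnStart_strictMono hU p (Nat.succ_pos k)
    simp only [Finset.mem_filter, Finset.mem_Ioo]
    exact ⟨⟨this, by omega⟩, not_up_columnStart hU p k⟩
  · intro k _ l _ h
    have := (columnStart_strictMono hU p).injective h
    omega
  · intro x hx
    simp only [Finset.mem_filter, Finset.mem_Ioo] at hx
    obtain ⟨k, hk⟩ := exists_columnStart_eq hx.1.1 hx.2
    refine ⟨k, ?_, hk⟩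
    rw [Finset.mem_range, lt_rightCount_iff hU, hk]
    omega
  · intro k _
    rfl

end Turns

/-! ### The strip as an explicit skew shape: column lengths and contents. -/

namespace RShape

variable (D : RShape) {k : ℕ} (θ : Fin k → Finset (ℕ × ℕ))

theorem eventually_not_goesUp : ∃ B, ∀ c ≥ B, ¬ D.GoesUp θ c := by
  obtain ⟨B, hB⟩ := ((Finset.univ.biUnion θ).image D.content).bddAbove
  refine ⟨B + 1, fun c hc h => ?_⟩
  obtain ⟨i, γ, hγ, rfl, -⟩ := h
  have := hB (Finset.mem_coe.mpr (Finset.mem_image_of_mem _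
    (Finset.mem_biUnion.mpr ⟨i, Finset.mem_univ _, hγ⟩)))
  omega

theorem rightSteps_eq (p c : ℤ) : D.rightSteps θ p c = rightCount (D.GoesUp θ) p c := rfl

theorem upSteps_add_rightSteps (p c : ℤ) :
    D.upSteps θ p c + D.rightSteps θ p c = (c - p).toNat := by
  rw [upSteps, rightSteps, Finset.card_filter_add_card_filter_not, Int.card_Ico]

theorem upSteps_add (p : ℤ) {c q : ℤ} (h : p ≤ c) (h' : c ≤ q) :
    D.upSteps θ p c + D.upSteps θ c q = D.upSteps θ p q := by
  rw [upSteps, upSteps, upSteps, ← Finset.card_union_of_disjoint, ← Finset.filter_union,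
    Finset.Ico_union_Ico_eq_Ico h h']
  exact Finset.disjoint_filter_filter (Finset.Ico_disjoint_Ico_consecutive p c q)

/-- The content of the last cell of a column of the strip. -/
noncomputable def columnTop (p q : ℤ) (r : ℕ) : ℤ :=
  if r = D.rightSteps θ p q then q else columnStart (D.GoesUp θ) p (r + 1) - 1

theorem mem_strip_lam {p q : ℤ} {i r : ℕ} : (i, r) ∈ (D.strip θ p q).lam ↔
    ∃ c, p ≤ c ∧ c ≤ q ∧ i ≤ D.upSteps θ c q ∧ r ≤ D.rightSteps θ p c := by
  change (i, r) ∈ (hull _).cells ↔ _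
  simp only [hull, Finset.mem_biUnion, Finset.mem_image, Finset.mem_Icc, Finset.mem_Iic]
  constructor
  · rintro ⟨d, ⟨c, hc, rfl⟩, hd⟩
    exact ⟨c, hc.1, hc.2, hd.1, hd.2⟩
  · rintro ⟨c, h1, h2, h3, h4⟩
    exact ⟨_, ⟨c, ⟨h1, h2⟩, rfl⟩, h3, h4⟩

theorem mem_strip_mu {p q : ℤ} {i r : ℕ} : (i, r) ∈ (D.strip θ p q).mu ↔
    (i, r) ∈ (D.strip θ p q).lam ∧
      ∀ c, p ≤ c → c ≤ q → D.upSteps θ c q ≤ i → ¬ D.rightSteps θ p c ≤ r := by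
  change (i, r) ∈ (innerHull _).cells ↔ _
  rw [innerHull, Finset.mem_filter]
  refine and_congr Iff.rfl ?_
  simp only [Finset.mem_image, Finset.mem_Icc]
  constructor
  · intro h c h1 h2 h3 h4
    exact h _ ⟨c, ⟨h1, h2⟩, rfl⟩ ⟨h3, h4⟩
  · rintro h d ⟨c, hc, rfl⟩ hd
    exact h c hc.1 hc.2 hd.1 hd.2

theorem le_rightSteps_iff {p c : ℤ} (h : p ≤ c) {r : ℕ} :
    r ≤ D.rightSteps θ p c ↔ columnStart (D.GoesUp θ) p r ≤ c := by
  cases r with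
  | zero => simpa [columnStart] using h
  | succ r => rw [rightSteps_eq, ← lt_rightCount_iff (D.eventually_not_goesUp θ), Nat.succ_le_iff]

theorem rightSteps_le_iff {p c : ℤ} {r : ℕ} :
    D.rightSteps θ p c ≤ r ↔ c < columnStart (D.GoesUp θ) p (r + 1) := by
  rw [rightSteps_eq, ← not_lt, lt_rightCount_iff (D.eventually_not_goesUp θ), not_le]

theorem colLen_eq_of_forall {ν : YoungDiagram} {r l : ℕ} (h : ∀ i, (i, r) ∈ ν ↔ i < l) :
    ν.colLen r = l := by
  have h1 := h l
  have h2 := h (ν.colLen r)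
  rw [YoungDiagram.mem_iff_lt_colLen] at h1 h2
  omega

variable {p q : ℤ}

theorem le_columnStart (r : ℕ) : p ≤ columnStart (D.GoesUp θ) p r :=
  (columnStart_strictMono (D.eventually_not_goesUp θ) p).monotone (Nat.zero_le r)

/-- Column `r` of the strip occupies the contents from `columnStart` to `columnTop`. The last column
is cut off at `q`, which causes the case distinction in `columnTop`. -/
theorem columnStart_le_columnTop (hpq : p ≤ q) {r : ℕ} (hr : r ≤ D.rightSteps θ p q) :
    columnStart (D.GoesUp θ) p r ≤ D.columnTop θ p q r ∧ D.columnTop θ p q r ≤ q ∧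
    ∀ c ≤ q, c < columnStart (D.GoesUp θ) p (r + 1) ↔ c ≤ D.columnTop θ p q r := by
  have h1 := (D.le_rightSteps_iff θ hpq).mp hr
  have h2 := columnStart_strictMono (D.eventually_not_goesUp θ) p (Nat.lt_add_one r)
  unfold columnTop
  split_ifs with h
  · have h3 := (D.rightSteps_le_iff θ (p := p) (c := q) (r := r)).mp h.ge
    exact ⟨h1, le_rfl, fun c hc => ⟨fun _ => hc, fun _ => hc.trans_lt h3⟩⟩
  · have h3 := (D.le_rightSteps_iff θ hpq (r := r + 1)).mp (by omega)
    exact ⟨by omega, by omega, fun c _ => by omega⟩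

theorem strip_lam_colLen (hpq : p ≤ q) {r : ℕ} (hr : r ≤ D.rightSteps θ p q) :
    (D.strip θ p q).lam.colLen r = D.upSteps θ (columnStart (D.GoesUp θ) p r) q + 1 := by
  refine colLen_eq_of_forall fun i => ?_
  rw [mem_strip_lam, Nat.lt_succ_iff]
  constructor
  · rintro ⟨c, h1, h2, h3, h4⟩
    rw [D.le_rightSteps_iff θ h1] at h4
    have := D.upSteps_add θ _ h4 h2
    omega
  · intro h
    exact ⟨_, D.le_columnStart θ r, (D.le_rightSteps_iff θ hpq).mp hr, h,
      (D.le_rightSteps_iff θ (D.le_columnStart θ r)).mpr le_rfl⟩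

theorem strip_numCols (hpq : p ≤ q) : (D.strip θ p q).numCols = D.rightSteps θ p q + 1 := by
  have h : ∀ r, (0, r) ∈ (D.strip θ p q).lam ↔ r < D.rightSteps θ p q + 1 := fun r => by
    rw [mem_strip_lam, Nat.lt_succ_iff]
    constructor
    · rintro ⟨c, h1, h2, -, h4⟩
      rw [D.le_rightSteps_iff θ h1] at h4
      rw [D.le_rightSteps_iff θ hpq]
      exact h4.trans h2
    · exact fun h => ⟨q, hpq, le_rfl, Nat.zero_le _, h⟩
  have h1 := h (D.rightSteps θ p q + 1)
  have h2 := h ((D.strip θ p q).lam.rowLen 0)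
  rw [YoungDiagram.mem_iff_lt_rowLen] at h1 h2
  unfold numCols
  omega

theorem strip_numCols_of_lt (hpq : q < p) : (D.strip θ p q).numCols = 0 := by
  by_contra h
  have : (0, 0) ∈ (D.strip θ p q).lam :=
    YoungDiagram.mem_iff_lt_rowLen.mpr (Nat.pos_of_ne_zero h)
  rw [mem_strip_lam] at this
  obtain ⟨c, h1, h2, -⟩ := this
  omega

theorem strip_mu_colLen (hpq : p ≤ q) {r : ℕ} (hr : r ≤ D.rightSteps θ p q) :
    (D.strip θ p q).mu.colLen r = D.upSteps θ (D.columnTop θ p q r) q := by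
  obtain ⟨h1, h2, h3⟩ := D.columnStart_le_columnTop θ hpq hr
  have h0 := D.le_columnStart θ r (p := p)
  have h4 := D.upSteps_add θ _ h1 h2
  refine colLen_eq_of_forall fun i => ?_
  rw [mem_strip_mu, YoungDiagram.mem_iff_lt_colLen, D.strip_lam_colLen θ hpq hr]
  constructor
  · rintro ⟨-, h⟩
    by_contra hc
    exact h _ (h0.trans h1) h2 (not_lt.mp hc) ((D.rightSteps_le_iff θ).mpr ((h3 _ h2).mpr le_rfl))
  · intro h
    refine ⟨by omega, fun c hc hc' hi hr' => ?_⟩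
    rw [D.rightSteps_le_iff θ, h3 c hc'] at hr'
    have := D.upSteps_add θ _ hr' h2
    omega

theorem rightSteps_columnStart (r : ℕ) :
    D.rightSteps θ p (columnStart (D.GoesUp θ) p r) = r :=
  rightCount_columnStart (D.eventually_not_goesUp θ) p r

theorem rightSteps_columnTop (hpq : p ≤ q) {r : ℕ} (hr : r ≤ D.rightSteps θ p q) :
    D.rightSteps θ p (D.columnTop θ p q r) = r := by
  obtain ⟨h1, h2, h3⟩ := D.columnStart_le_columnTop θ hpq hr
  exact le_antisymm ((D.rightSteps_le_iff θ).mpr ((h3 _ h2).mpr le_rfl))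
    ((D.le_rightSteps_iff θ ((D.le_columnStart θ r).trans h1)).mpr h1)

theorem strip_root : (D.strip θ p q).root = p := rfl

/-- Up steps and right steps from `p` to a content add up to their difference, and the start of
column `r` is reached after `r` right steps. Thus the shifted content of the strip returns the
content in the original shape. -/
theorem strip_botContent (hpq : p ≤ q) {r : ℕ} (hr : r ≤ D.rightSteps θ p q) :
    (D.strip θ p q).botContent r = columnStart (D.GoesUp θ) p r := by
  have h0 := D.le_columnStart θ r (p := p)
  have h1 := (D.le_rightSteps_iff θ hpq).mp hr
  have h2 := D.upSteps_add θ _ h0 h1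
  have h3 := D.upSteps_add_rightSteps θ p (columnStart (D.GoesUp θ) p r)
  rw [rightSteps_columnStart] at h3
  rw [botContent, strip_root, D.strip_lam_colLen θ hpq hr, D.strip_lam_colLen θ hpq (Nat.zero_le _)]
  rw [show columnStart (D.GoesUp θ) p 0 = p from rfl]
  push_cast
  omega

theorem strip_topContent (hpq : p ≤ q) {r : ℕ} (hr : r ≤ D.rightSteps θ p q) :
    (D.strip θ p q).topContent r = D.columnTop θ p q r := by
  obtain ⟨h1, h2, h3⟩ := D.columnStart_le_columnTop θ hpq hr
  have h0 := (D.le_columnStart θ r (p := p)).trans h1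
  have h4 := D.upSteps_add θ _ h0 h2
  have h5 := D.upSteps_add_rightSteps θ p (D.columnTop θ p q r)
  rw [D.rightSteps_columnTop θ hpq hr] at h5
  rw [topContent, strip_root, D.strip_mu_colLen θ hpq hr, D.strip_lam_colLen θ hpq (Nat.zero_le _)]
  rw [show columnStart (D.GoesUp θ) p 0 = p from rfl]
  push_cast
  omega

end RShape

end HamelGoulden

namespace HamelGoulden

/-! ### Supersymmetric functions and the specialization of the alphabets. -/

section Supersymmetric

variable {R : Type*} [CommRing R]

theorem aeval_esymm_comp_equiv {ι κ : Type*} [Fintype ι] [Fintype κ] (e : ι ≃ κ) (u : κ → R) (n : ℕ) :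
    MvPolynomial.aeval (u ∘ e) (MvPolynomial.esymm ι ℤ n) =
      MvPolynomial.aeval u (MvPolynomial.esymm κ ℤ n) := by
  rw [← MvPolynomial.rename_esymm ι ℤ n e, MvPolynomial.aeval_rename]

theorem aeval_hsymm {κ : Type*} [Fintype κ] [DecidableEq κ] (v : κ → R) (n : ℕ) :
    MvPolynomial.aeval v (MvPolynomial.hsymm κ ℤ n) =
      ∑ s : Sym κ n, ((s : Multiset κ).map v).prod := by
  rw [MvPolynomial.hsymm, map_sum]
  refine Finset.sum_congr rfl fun s _ => ?_
  rw [map_multiset_prod, Multiset.map_map]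
  congr 1
  exact Multiset.map_congr rfl fun x _ => by simp

/-- Complete symmetric polynomials do not change when variables equal to zero are added. -/
theorem aeval_hsymm_comp_injective {ι κ : Type*} [Fintype ι] [DecidableEq ι] [Fintype κ]
    [DecidableEq κ] (f : ι → κ) (hf : Function.Injective f) (v : κ → R)
    (hv : ∀ b, b ∉ Set.range f → v b = 0) (n : ℕ) :
    MvPolynomial.aeval (v ∘ f) (MvPolynomial.hsymm ι ℤ n) =
      MvPolynomial.aeval v (MvPolynomial.hsymm κ ℤ n) := by
  rw [aeval_hsymm, aeval_hsymm]
  refine Finset.sum_of_injOn (Sym.map f) (Sym.map_injective hf n).injOn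
    (fun _ _ => Finset.mem_coe.mpr (Finset.mem_univ _)) ?_ ?_
  · intro s _ hs
    -- A multiset not in the image contains an index outside the range of `f`, so its monomial has a
    -- zero factor.
    have : ∃ b ∈ s, b ∉ Set.range f := by
      by_contra! hc
      apply hs
      refine ⟨Sym.map (fun b : {b // b ∈ s} => (hc b.1 b.2).choose) s.attach,
        Finset.mem_coe.mpr (Finset.mem_univ _), ?_⟩
      rw [Sym.map_map]
      conv_rhs => rw [← Sym.attach_map_coe s]
      exact Sym.map_congr fun b _ => (hc b.1 b.2).choose_spec
    obtain ⟨b, hb, hbr⟩ := this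
    refine Multiset.prod_eq_zero ?_
    rw [← hv b hbr]
    exact Multiset.mem_map_of_mem v hb
  · intro s _
    rw [Sym.coe_map, Multiset.map_map]

/-- The second alphabet may be enlarged by zeros because the specialized $z_1,\dots,z_m$ vanish,
while the first alphabet is only reindexed. -/
theorem superElem_comp {ι ι' κ κ' : Type*} [Fintype ι] [DecidableEq ι] [Fintype κ] [DecidableEq κ]
    [Fintype ι'] [DecidableEq ι'] [Fintype κ'] [DecidableEq κ'] (e : ι ≃ ι') (u : ι' → R)
    (f : κ → κ') (hf : Function.Injective f) (v : κ' → R) (hv : ∀ b, b ∉ Set.range f → v b = 0)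
    (n : ℤ) : superElem (u ∘ e) (v ∘ f) n = superElem u v n := by
  unfold superElem
  simp only [aeval_esymm_comp_equiv, aeval_hsymm_comp_injective f hf v hv]

theorem superElem_zero {ι κ : Type*} [Fintype ι] [DecidableEq ι] [Fintype κ] [DecidableEq κ]
    (u : ι → R) (v : κ → R) : superElem u v 0 = 1 := by
  simp [superElem]

theorem superElem_of_neg {ι κ : Type*} [Fintype ι] [DecidableEq ι] [Fintype κ] [DecidableEq κ]
    (u : ι → R) (v : κ → R) {n : ℤ} (hn : n < 0) : superElem u v n = 0 :=
  if_neg (not_le.mpr hn)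

/-- The alphabets of the specialization are those of the dual Grothendieck polynomials. -/
theorem superElem_interval (m : ℕ) (x α β : ℕ → R) (i j L s : ℕ) (n : ℤ) :
    superElem (Sum.elim (initial x m) (Sum.elim (initial (-α) j) (initial β L)))
      (Sum.elim (initial (-α) i) (initial β s)) n =
    superElem (interval (gY m x α β) (1 - j) (L + m)) (interval (gZ m α β) (1 - s) (m + i)) n := by
  let e : Fin m ⊕ (Fin j ⊕ Fin L) → Finset.Icc (1 - j : ℤ) (L + m) :=
    Sum.elim (fun t => ⟨t + 1, Finset.mem_Icc.mpr (by omega)⟩)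
      (Sum.elim (fun t => ⟨-t, Finset.mem_Icc.mpr (by omega)⟩)
        (fun t => ⟨m + t + 1, Finset.mem_Icc.mpr (by omega)⟩))
  have he : Function.Bijective e := by
    constructor
    · rintro (t | t | t) (t' | t' | t') h <;>
        simp only [e, Sum.elim_inl, Sum.elim_inr, Subtype.mk.injEq] at h <;>
        first
          | omega
          | (congr 1; ext; omega)
          | (congr 2; ext; omega)
    · rintro ⟨t, ht⟩
      rw [Finset.mem_Icc] at ht
      by_cases h1 : t ≤ 0
      · exact ⟨Sum.inr (Sum.inl ⟨(-t).toNat, by omega⟩), Subtype.ext (by simp [e]; omega)⟩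
      · by_cases h2 : t ≤ m
        · exact ⟨Sum.inl ⟨(t - 1).toNat, by omega⟩, Subtype.ext (by simp [e]; omega)⟩
        · exact ⟨Sum.inr (Sum.inr ⟨(t - m - 1).toNat, by omega⟩), Subtype.ext (by simp [e]; omega)⟩
  let f : Fin i ⊕ Fin s → Finset.Icc (1 - s : ℤ) (m + i) :=
    Sum.elim (fun t => ⟨m + t + 1, Finset.mem_Icc.mpr (by omega)⟩)
      (fun t => ⟨-t, Finset.mem_Icc.mpr (by omega)⟩)
  have hf : Function.Injective f := by
    rintro (t | t) (t' | t') h <;>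
      simp only [f, Sum.elim_inl, Sum.elim_inr, Subtype.mk.injEq] at h <;>
      first
        | omega
        | (congr 1; ext; omega)
  have hfr : ∀ b, b ∉ Set.range f → interval (gZ m α β) (1 - s) (m + i) b = 0 := by
    rintro ⟨t, ht⟩ hb
    rw [Finset.mem_Icc] at ht
    by_cases h1 : t ≤ 0
    · exact absurd ⟨Sum.inr ⟨(-t).toNat, by omega⟩, Subtype.ext (by simp [f]; omega)⟩ hb
    · by_cases h2 : t ≤ m
      · simp [interval, gZ, h1, h2]
      · exact absurd ⟨Sum.inl ⟨(t - m - 1).toNat, by omega⟩, Subtype.ext (by simp [f]; omega)⟩ hb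
  rw [← superElem_comp (Equiv.ofBijective e he) _ f hf _ hfr]
  congr 1
  · funext t
    rcases t with t | t | t <;>
      simp only [e, Sum.elim_inl, Sum.elim_inr, Function.comp_apply, Equiv.ofBijective_apply,
        interval, gY, initial, Pi.neg_apply]
    · rw [if_neg (by omega), if_pos (by omega)]
      congr 1
    · rw [if_pos (by omega)]
      congr 2
      omega
    · rw [if_neg (by omega), if_neg (by omega)]
      congr 1
      omega
  · funext t
    rcases t with t | t
    · change -α (t + 1) = gZ m α β ((m : ℤ) + (t : ℕ) + 1)
      rw [gZ, if_neg (by omega), if_neg (by omega)]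
      congr 2
      omega
    · change β (t + 1) = gZ m α β (-(t : ℕ))
      rw [gZ, if_pos (by omega)]
      congr 1
      omega

end Supersymmetric

end HamelGoulden

namespace HamelGoulden

/-! ### The inverse of the pivot matrix and the strip determinants. -/

section PivotRecursion

variable {R : Type*} [CommRing R]

/-- The pivot matrix is triangular with diagonal entries $\pm1$, hence invertible over every
commutative ring. -/
theorem exists_mul_pivotMatrix_eq (K : ℤ → ℤ → R) (h1 : ∀ x, K x x = 1)
    (h0 : ∀ x y, y < x → K x y = 0) (X : Finset ℤ) (P Q : ℤ) :
    ∃ N : ℤ → ℤ → R, ∀ p ∈ Finset.Icc P Q, ∀ r ∈ Finset.Icc P Q,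
      ∑ q ∈ Finset.Icc P Q, N p q * pivotMatrix K X q r = unitMatrix K X p r := by
  set W : Matrix (Finset.Icc P Q) (Finset.Icc P Q) R :=
    Matrix.of fun y r => pivotMatrix K X y r with hW
  set Y : Matrix (Finset.Icc P Q) (Finset.Icc P Q) R :=
    Matrix.of fun y r => unitMatrix K X y r with hY
  have hdet : IsUnit W.det := by
    rw [hW, det_pivotMatrix K h1 h0]
    refine IsUnit.of_mul_eq_one
      (∏ y : Finset.Icc P Q, if (y : ℤ) ∈ X then (-1 : R) else 1) ?_
    rw [← Finset.prod_mul_distrib]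
    exact Finset.prod_eq_one fun y _ => by split_ifs <;> simp
  have hmul : Y * W⁻¹ * W = Y := by
    rw [Matrix.mul_assoc, Matrix.nonsing_inv_mul _ hdet, Matrix.mul_one]
  refine ⟨fun p q => if h : p ∈ Finset.Icc P Q ∧ q ∈ Finset.Icc P Q then
    (Y * W⁻¹) ⟨p, h.1⟩ ⟨q, h.2⟩ else 0, fun p hp r hr => ?_⟩
  have := congrFun (congrFun hmul ⟨p, hp⟩) ⟨r, hr⟩
  rw [Matrix.mul_apply] at this
  rw [← Finset.sum_coe_sort]
  simp only [hp, true_and, Finset.coe_mem, dif_pos, Subtype.coe_eta]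
  simpa only [hW, hY, Matrix.of_apply] using this

/-- The parity of the number of elements of `X` below `y`. -/
def signBelow (R : Type*) [CommRing R] (X : Finset ℤ) (y : ℤ) : R :=
  (-1) ^ (X.filter (· < y)).card

theorem card_filter_lt_add_one (X : Finset ℤ) (y : ℤ) :
    (X.filter (· < y + 1)).card = (X.filter (· < y)).card + if y ∈ X then 1 else 0 := by
  have h : X.filter (· < y + 1) = X.filter (· < y) ∪ X.filter (· = y) := by
    ext x
    simp only [Finset.mem_filter, Finset.mem_union, Int.lt_add_one_iff, le_iff_lt_or_eq]
    tauto
  rw [h, Finset.card_union_of_disjoint, Finset.filter_eq']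
  · split_ifs <;> simp
  · rw [Finset.disjoint_filter]
    intro x _ h1 h2
    omega

theorem signBelow_add_one (X : Finset ℤ) (y : ℤ) :
    signBelow R X (y + 1) = signBelow R X y * if y ∈ X then -1 else 1 := by
  rw [signBelow, signBelow, card_filter_lt_add_one, pow_add]
  split_ifs <;> simp

theorem signBelow_mul_self (X : Finset ℤ) (y : ℤ) : signBelow R X y * signBelow R X y = 1 := by
  rw [signBelow, ← mul_pow]
  simp

/-- The determinant attached to the strip with contents in `[p, r)`. -/
noncomputable def stripDet (U : ℤ → Prop) [DecidablePred U] (K : ℤ → ℤ → R) (p r : ℤ) : R :=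
  if r < p then 0 else if r = p then 1 else
    hessenberg K (columnStart U p) (rightCount U p (r - 1)) fun i => K (columnStart U p i) r

theorem stripDet_of_lt (U : ℤ → Prop) [DecidablePred U] (K : ℤ → ℤ → R) {p r : ℤ} (h : p < r) :
    stripDet U K p r =
      hessenberg K (columnStart U p) (rightCount U p (r - 1)) fun i => K (columnStart U p i) r := by
  rw [stripDet, if_neg (by omega), if_neg (by omega)]

theorem stripDet_self (U : ℤ → Prop) [DecidablePred U] (K : ℤ → ℤ → R) (p : ℤ) :
    stripDet U K p p = 1 := by
  rw [stripDet, if_neg (lt_irrefl _), if_pos rfl]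

variable {K : ℤ → ℤ → R} {X : Finset ℤ} {P Q : ℤ} {N : ℤ → ℤ → R}

/-- Column `r` of the linear system is solved for its diagonal term; the triangular shape leaves
only indices `q < r`. -/
theorem pivot_recursion (h1 : ∀ x, K x x = 1) (h0 : ∀ x y, y < x → K x y = 0)
    (hN : ∀ p ∈ Finset.Icc P Q, ∀ r ∈ Finset.Icc P Q,
      ∑ q ∈ Finset.Icc P Q, N p q * pivotMatrix K X q r = unitMatrix K X p r)
    {p r : ℤ} (hp : p ∈ Finset.Icc P Q) (hr : r ∈ Finset.Icc P Q) :
    N p r = (if r ∈ X then -1 else 1) * (unitMatrix K X p r +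
      ∑ q ∈ Finset.Icc P Q, if q ∈ X ∧ q < r then N p q * K q r else 0) := by
  have h := hN p hp r hr
  have hterm : ∀ q ∈ Finset.Icc P Q, N p q * pivotMatrix K X q r =
      (if q = r then N p q * (if r ∈ X then -1 else 1) else 0) -
        (if q ∈ X ∧ q < r then N p q * K q r else 0) := by
    intro q _
    unfold pivotMatrix
    rcases lt_trichotomy q r with hq | hq | hq
    · by_cases hX : q ∈ X <;> simp [hX, hq, hq.ne, hq.ne']
    · subst hq
      by_cases hX : q ∈ X <;> simp [hX, h1]
    · by_cases hX : q ∈ X <;> simp [hX, hq.ne, hq.ne', not_lt.mpr hq.le, h0 q r hq]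
  rw [Finset.sum_congr rfl hterm, Finset.sum_sub_distrib, Finset.sum_ite_eq', if_pos hr] at h
  rw [← h]
  split_ifs <;> ring

theorem pivot_eq_zero_of_lt (h1 : ∀ x, K x x = 1) (h0 : ∀ x y, y < x → K x y = 0)
    (hN : ∀ p ∈ Finset.Icc P Q, ∀ r ∈ Finset.Icc P Q,
      ∑ q ∈ Finset.Icc P Q, N p q * pivotMatrix K X q r = unitMatrix K X p r)
    {p : ℤ} (hp : p ∈ Finset.Icc P Q) (d : ℕ) :
    ∀ r ∈ Finset.Icc P Q, r = P + d → r < p → N p r = 0 := by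
  induction d using Nat.strong_induction_on with
  | _ d ih =>
    intro r hr hd hrp
    rw [pivot_recursion h1 h0 hN hp hr, Finset.sum_eq_zero, unitMatrix, h0 p r hrp,
      if_neg hrp.ne]
    · simp
    · intro q hq
      split_ifs with hc
      · have hq' := Finset.mem_Icc.mp hq
        rw [ih (q - P).toNat (by omega) q hq (by omega) (hc.2.trans hrp), zero_mul]
      · rfl

theorem card_filter_lt_eq {U : ℤ → Prop} [DecidablePred U] (hU : ∃ B, ∀ c ≥ B, ¬ U c) {p r : ℤ}
    (hpr : p < r) (hX : ∀ x, p < x → x < r → (x ∈ X ↔ ¬ U (x - 1))) :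
    (X.filter (· < r)).card = (X.filter (· < p + 1)).card + rightCount U p (r - 1) := by
  have h2 : ((Finset.Ioo p r).filter fun x => ¬ U (x - 1)).card = rightCount U p (r - 1) := by
    rw [Finset.card_eq_sum_ones, sum_turns hU (fun _ => 1)]
    simp
  have h3 : X.filter (· < r) =
      X.filter (· < p + 1) ∪ (Finset.Ioo p r).filter fun x => ¬ U (x - 1) := by
    ext x
    simp only [Finset.mem_filter, Finset.mem_union, Finset.mem_Ioo]
    constructor
    · rintro ⟨hx, hxr⟩
      by_cases hxp : x < p + 1
      · exact Or.inl ⟨hx, hxp⟩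
      · exact Or.inr ⟨⟨by omega, hxr⟩, (hX x (by omega) hxr).mp hx⟩
    · rintro (⟨hx, hxp⟩ | ⟨⟨hx, hxr⟩, hxu⟩)
      · exact ⟨hx, by omega⟩
      · exact ⟨(hX x hx hxr).mpr hxu, hxr⟩
  rw [h3, Finset.card_union_of_disjoint, h2]
  rw [Finset.disjoint_left]
  intro x hx hx'
  simp only [Finset.mem_filter, Finset.mem_Ioo] at hx hx'
  omega

/-- Both sides satisfy the same recursion in `r`: `pivot_recursion` sums over the elements of `X`
below `r`, which beyond `p` are the starts of the later columns of the strip, and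
`hessenberg_eq_sum` sums over these columns. The two factors `signBelow` absorb the alternating
signs, including the contributions of `p` and `r`, whose membership in `X` is not prescribed. -/
theorem pivot_eq_stripDet (h1 : ∀ x, K x x = 1) (h0 : ∀ x y, y < x → K x y = 0)
    (hN : ∀ p ∈ Finset.Icc P Q, ∀ r ∈ Finset.Icc P Q,
      ∑ q ∈ Finset.Icc P Q, N p q * pivotMatrix K X q r = unitMatrix K X p r)
    {U : ℤ → Prop} [DecidablePred U] (hU : ∃ B, ∀ c ≥ B, ¬ U c) {p : ℤ} (hp : p ∈ Finset.Icc P Q)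
    (d : ℕ) :
    ∀ r ∈ Finset.Icc P Q, r = p + d → (∀ x, p < x → x < r → (x ∈ X ↔ ¬ U (x - 1))) →
      N p r = signBelow R X p * signBelow R X (r + 1) * stripDet U K p r := by
  induction d using Nat.strong_induction_on with
  | _ d ih =>
    intro r hr hd hX
    have hlt : ∀ q ∈ Finset.Icc P Q, q < p → N p q = 0 := fun q hq hqp =>
      pivot_eq_zero_of_lt h1 h0 hN hp (q - P).toNat q hq
        (by have := Finset.mem_Icc.mp hq; omega) hqp
    have hP := Finset.mem_Icc.mp hp
    have hR := Finset.mem_Icc.mp hr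
    have hsq := signBelow_mul_self (R := R) X p
    rcases Nat.eq_zero_or_pos d with h | hdpos
    · obtain rfl : r = p := by omega
      rw [pivot_recursion h1 h0 hN hp hr, Finset.sum_eq_zero]
      · rw [stripDet_self, signBelow_add_one, ← mul_assoc, hsq]
        by_cases hXr : r ∈ X <;> simp [unitMatrix, hXr, h1]
      · intro q hq
        split_ifs with hc
        · rw [hlt q hq hc.2, zero_mul]
        · rfl
    · have hpr : p < r := by omega
      have hself := ih 0 hdpos p hp (by simp) (fun x hx hx' => absurd (hx.trans hx') (lt_irrefl _))
      rw [stripDet_self, mul_one, signBelow_add_one, ← mul_assoc, hsq,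
        one_mul] at hself
      -- Terms with `q < p` vanish by triangularity, the term `q = p` is kept apart, and the others
      -- are right turns.
      have hsum : (∑ q ∈ Finset.Icc P Q, if q ∈ X ∧ q < r then N p q * K q r else 0) =
          (if p ∈ X then N p p * K p r else 0) +
            ∑ q ∈ (Finset.Ioo p r).filter (fun x => ¬ U (x - 1)), N p q * K q r := by
        rw [← Finset.sum_subset (s₁ := Finset.Ico p r), ← Finset.Ioo_insert_left hpr,
          Finset.sum_insert (by simp), Finset.sum_filter]
        · congr 1
          · simp [hpr]
          · refine Finset.sum_congr rfl fun q hq => ?_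
            rw [Finset.mem_Ioo] at hq
            simp only [hX q hq.1 hq.2, hq.2, and_true]
        · intro q hq
          rw [Finset.mem_Ico] at hq
          rw [Finset.mem_Icc]
          omega
        · intro q hq hq'
          split_ifs with hc
          · rw [hlt q hq (by
              by_contra hcon
              exact hq' (Finset.mem_Ico.mpr ⟨by omega, hc.2⟩)), zero_mul]
          · rfl
      rw [pivot_recursion h1 h0 hN hp hr, hsum, sum_turns hU, stripDet_of_lt U K hpr,
        hessenberg_eq_sum K h1 h0 _ _
          (fun k _ => columnStart_strictMono hU p (Nat.lt_add_one k)), signBelow_add_one (y := r)]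
      set M := rightCount U p (r - 1) with hM
      have hcard := card_filter_lt_eq hU hpr hX
      have hgr : signBelow R X r = signBelow R X (p + 1) * (-1) ^ M := by
        rw [signBelow, hcard, pow_add]
        rfl
      have hterm : ∀ k ∈ Finset.range M,
          N p (columnStart U p (k + 1)) * K (columnStart U p (k + 1)) r =
          signBelow R X p * signBelow R X r * ((-1) ^ (M - 1 - k) * K (columnStart U p (k + 1)) r *
            hessenberg K (columnStart U p) k
              (fun i => K (columnStart U p i) (columnStart U p (k + 1)))) := by
        intro k hk
        rw [Finset.mem_range] at hk
        have hkr := (lt_rightCount_iff hU).mp hk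
        have hpk : p < columnStart U p (k + 1) := columnStart_strictMono hU p (Nat.succ_pos k)
        have hXk : columnStart U p (k + 1) ∈ X :=
          (hX _ hpk (by omega)).mpr (not_up_columnStart hU p k)
        have hX' : ∀ x, p < x → x < columnStart U p (k + 1) → (x ∈ X ↔ ¬ U (x - 1)) :=
          fun x hx hx' => hX x hx (by omega)
        have hk' : rightCount U p (columnStart U p (k + 1) - 1) = k := by
          have hl : ∀ l, l < rightCount U p (columnStart U p (k + 1) - 1) ↔ l < k := fun l => by
            rw [lt_rightCount_iff hU, Int.le_sub_one_iff,
              (columnStart_strictMono hU p).lt_iff_lt, Nat.succ_lt_succ_iff]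
          have hl1 := hl k
          have hl2 := hl (rightCount U p (columnStart U p (k + 1) - 1))
          omega
        have hcard' := card_filter_lt_eq hU hpk hX'
        rw [hk'] at hcard'
        have hsr : signBelow R X r * (-1) ^ (M - 1 - k) =
            signBelow R X (columnStart U p (k + 1) + 1) := by
          rw [signBelow, signBelow, card_filter_lt_add_one, if_pos hXk, hcard, hcard',
            show (X.filter (· < p + 1)).card + M =
              (X.filter (· < p + 1)).card + k + 1 + (M - 1 - k) by omega,
            pow_add _ _ (M - 1 - k), mul_assoc, ← mul_pow]
          simp
        rw [ih (columnStart U p (k + 1) - p).toNat (by omega) _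
          (Finset.mem_Icc.mpr ⟨by omega, by omega⟩) (by omega) hX', stripDet_of_lt U K hpk, hk',
          ← hsr]
        ring
      rw [Finset.sum_congr rfl hterm, ← Finset.mul_sum, hself]
      have hone : ((-1 : R) ^ M) * (-1) ^ M = 1 := by rw [← mul_pow]; simp
      -- If `p ∈ X` the contribution of `K p r` comes from the term `q = p`, otherwise from
      -- `unitMatrix`. Either way it is the term of the first column in the Hessenberg expansion.
      have hfirst : unitMatrix K X p r +
          (if p ∈ X then (if p ∈ X then -1 else 1) * K p r else 0) =
          signBelow R X p * signBelow R X r * ((-1) ^ M * K p r) := by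
        rw [hgr, signBelow_add_one]
        have : signBelow R X p * (signBelow R X p * (if p ∈ X then -1 else 1) * (-1) ^ M) *
            ((-1) ^ M * K p r) = (signBelow R X p * signBelow R X p) * ((-1) ^ M * (-1) ^ M) *
            ((if p ∈ X then -1 else 1) * K p r) := by ring
        rw [this, hsq, hone]
        by_cases h : p ∈ X
        · simp [unitMatrix, h, hpr.ne']
        · simp [unitMatrix, h]
      have hstart : columnStart U p 0 = p := rfl
      rw [← add_assoc, hfirst, hstart]
      ring

end PivotRecursion

/-! ### The determinant of the shape evaluated along the ribbons. -/

namespace RShape.IsOuterDecomposition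

variable {lam mu : YoungDiagram} {hle : mu ≤ lam} {k : ℕ} {θ : Fin k → Finset (ℕ × ℕ)} {n : ℕ}

/-- The number of cells that follow a cell to their left. -/
theorem cellCount_rightContents (hθ : (usual lam mu hle).IsOuterDecomposition θ)
    (hn : lam.rowLen 0 ≤ n) (X : Finset ℤ) :
    cellCount (diagRow mu) (diagRow lam) (1 - lam.colLen 0) n (· ∈ X) =
      ∑ a : Fin k, (X.filter fun x => (usual lam mu hle).headContent θ a ≤ x ∧
        x < ribbonEnd (usual lam mu hle) θ a).card := by
  rw [← Finset.card_sigma, cellCount]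
  have hex : ∀ ω ∈ (Finset.univ.filter fun ω : positions (diagRow mu) (diagRow lam)
      (1 - lam.colLen 0) n => ω.1.2 < diagRow lam ω.1.1 ∧ ω.1.1 ∈ X),
      ∃ a : Fin k, ∃ i j : ℕ, (i, j) ∈ θ a ∧ ω.1.2 = i ∧ ω.1.2 + ω.1.1 = j := by
    intro ω hω
    rw [Finset.mem_filter] at hω
    exact hθ.exists_ribbon (mem_positions.mp ω.2).2.2.1 hω.2.1
  choose f hf using hex
  have hfc : ∀ ω hω, ∃ γ ∈ θ (f ω hω), cellContent γ = ω.1.1 ∧ ω.1.2 = γ.1 := by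
    intro ω hω
    obtain ⟨i, j, h1, h2, h3⟩ := hf ω hω
    exact ⟨(i, j), h1, by simp only [cellContent]; omega, h2⟩
  refine Finset.card_bij (fun ω hω => ⟨f ω hω, ω.1.1⟩) ?_ ?_ ?_
  · intro ω hω
    obtain ⟨γ, hγ, hc, -⟩ := hfc ω hω
    have h1 := (hθ.ribbon (f ω hω)).head_mem.2 γ hγ
    have h2 := (hθ.ribbon (f ω hω)).tail_mem.2 γ hγ
    simp only [Finset.mem_sigma, Finset.mem_univ, true_and, Finset.mem_filter, headContent,
      ribbonEnd, tailContent, usual_content]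
    exact ⟨(Finset.mem_filter.mp hω).2.2, by omega, by omega⟩
  · intro ω hω ω' hω' h
    obtain ⟨γ, hγ, hc, hr⟩ := hfc ω hω
    obtain ⟨γ', hγ', hc', hr'⟩ := hfc ω' hω'
    simp only [Sigma.mk.injEq, heq_eq_eq] at h
    rw [← h.1] at hγ'
    have := (hθ.ribbon _).eq_of_content_eq hγ hγ' (by rw [hc, hc', h.2])
    exact Subtype.ext (Prod.ext h.2 (by rw [hr, hr', this]))
  · rintro ⟨a, x⟩ hx
    simp only [Finset.mem_sigma, Finset.mem_univ, true_and, Finset.mem_filter, headContent,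
      ribbonEnd, tailContent, usual_content] at hx
    -- A ribbon has exactly one cell of each content between its head and its tail, so a cell is
    -- recorded by its ribbon and its content.
    obtain ⟨⟨i, j⟩, hγ, hc⟩ := (hθ.ribbon a).exists_content hx.2.1 (by omega)
    have hij : (j : ℤ) = i + x := by simp only [cellContent] at hc; omega
    have hcell := (mem_usual_cells_iff hij).mp (hθ.mem_cells hγ)
    have hb := content_mem_Icc hn hcell.1 hcell.2
    have hω : (⟨(x, (i : ℤ)), mem_positions.mpr ⟨hb.1, hb.2.le, hcell.1, hcell.2.le⟩⟩ :
        positions (diagRow mu) (diagRow lam) (1 - lam.colLen 0) n) ∈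
        (Finset.univ.filter fun ω : positions (diagRow mu) (diagRow lam)
          (1 - lam.colLen 0) n => ω.1.2 < diagRow lam ω.1.1 ∧ ω.1.1 ∈ X) :=
      Finset.mem_filter.mpr ⟨Finset.mem_univ _, hcell.2, hx.1⟩
    refine ⟨_, hω, ?_⟩
    obtain ⟨γ', hγ', hc', hr'⟩ := hfc _ hω
    have : γ' = (i, j) := by
      simp only [cellContent] at hc' hc hr'
      ext <;> simp only <;> omega
    rw [this] at hγ'
    rw [hθ.eq_of_mem hγ' hγ]

/-- `det_diagonalMatrix` gives the minor of `N`. Its entries are strip determinants with sign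
factors that depend on the row or on the column only, so they come out as products and cancel
against the parity of the cells with content in `X`. -/
theorem det_ribbons {R : Type*} [CommRing R] (hθ : (usual lam mu hle).IsOuterDecomposition θ)
    (hn : lam.rowLen 0 ≤ n) (K : ℤ → ℤ → R) (h1 : ∀ x, K x x = 1) (h0 : ∀ x y, y < x → K x y = 0)
    (hX : ∀ a b : Fin k, ∀ x, (usual lam mu hle).headContent θ a < x →
      x < ribbonEnd (usual lam mu hle) θ b →
      (x ∈ rightContents lam mu hle θ n ↔ ¬ (usual lam mu hle).GoesUp θ (x - 1))) :
    (diagonalMatrix K (diagRow mu) (diagRow lam) (1 - lam.colLen 0) n).det =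
      Matrix.det (Matrix.of fun a b : Fin k => stripDet ((usual lam mu hle).GoesUp θ) K
        ((usual lam mu hle).headContent θ a) (ribbonEnd (usual lam mu hle) θ b)) := by
  set X := rightContents lam mu hle θ n with hXdef
  set D := usual lam mu hle with hD
  have hS := hθ.isChainSystem hn
  rw [← hXdef, ← hD] at hS
  obtain ⟨N, hN⟩ := exists_mul_pivotMatrix_eq K h1 h0 X (1 - lam.colLen 0) n
  rw [det_diagonalMatrix K h1 h0 (isDiagonalBounds hle hn) hS N hN]
  have hend : ∀ a, ribbonEnd D θ a ∈ Finset.univ.image (ribbonEnd D θ) := fun a =>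
    Finset.mem_image_of_mem _ (Finset.mem_univ a)
  have hst : ∀ a, ribbonStart D θ (ribbonEnd D θ a) = D.headContent θ a := hθ.ribbonStart_ribbonEnd
  let e : Fin k ≃ Finset.univ.image (ribbonEnd D θ) := Equiv.ofBijective
    (fun a => ⟨ribbonEnd D θ a, hend a⟩)
    ⟨fun a b h => hθ.ribbonEnd_injective (Subtype.ext_iff.mp h), by
      rintro ⟨y, hy⟩
      obtain ⟨a, -, rfl⟩ := Finset.mem_image.mp hy
      exact ⟨a, rfl⟩⟩
  have he : ∀ a, (e a : ℤ) = ribbonEnd D θ a := fun _ => rfl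
  have hentry : ∀ a b, N (D.headContent θ a) (ribbonEnd D θ b) =
      signBelow R X (D.headContent θ a) * (signBelow R X (ribbonEnd D θ b + 1) *
        stripDet (D.GoesUp θ) K (D.headContent θ a) (ribbonEnd D θ b)) := by
    intro a b
    have ha : D.headContent θ a ∈ Finset.Icc (1 - lam.colLen 0 : ℤ) n :=
      hst a ▸ hS.st_mem_Icc _ (hend a)
    have hb := hS.mem_Icc _ (hend b)
    have hb' := Finset.mem_Icc.mp hb
    rcases lt_or_ge (ribbonEnd D θ b) (D.headContent θ a) with h | h
    -- An end below the head is the case in which `θ_a # θ_b` is undefined: both sides vanish.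
    · rw [pivot_eq_zero_of_lt h1 h0 hN ha _ _ hb
        (show ribbonEnd D θ b = _ + ((ribbonEnd D θ b - (1 - lam.colLen 0)).toNat : ℤ) by omega) h,
        stripDet, if_pos h, mul_zero, mul_zero]
    · rw [← mul_assoc]
      exact pivot_eq_stripDet h1 h0 hN (D.eventually_not_goesUp θ) ha
        (ribbonEnd D θ b - D.headContent θ a).toNat _ hb (by omega) (hX a b)
  have hdet : Matrix.det (Matrix.of fun y r : Finset.univ.image (ribbonEnd D θ) =>
      N (ribbonStart D θ y) r) =
      (∏ a, signBelow R X (D.headContent θ a)) * ((∏ a, signBelow R X (ribbonEnd D θ a + 1)) *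
        Matrix.det (Matrix.of fun a b : Fin k => stripDet (D.GoesUp θ) K
          (D.headContent θ a) (ribbonEnd D θ b))) := by
    rw [← Matrix.det_reindex_self e.symm, ← Matrix.det_mul_row, ← Matrix.det_mul_column]
    congr 1
    ext a b
    simp only [Matrix.reindex_apply, Matrix.submatrix_apply, Equiv.symm_symm, Matrix.of_apply, he,
      hst]
    exact hentry a b
  have hcount : ((-1 : R) ^ cellCount (diagRow mu) (diagRow lam) (1 - lam.colLen 0) n (· ∈ X)) =
      ∏ a, (signBelow R X (D.headContent θ a) * signBelow R X (ribbonEnd D θ a)) := by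
    rw [hθ.cellCount_rightContents hn X, ← hD, ← Finset.prod_pow_eq_pow_sum]
    refine Finset.prod_congr rfl fun a _ => ?_
    have hle' : D.headContent θ a ≤ ribbonEnd D θ a := by
      have := (hθ.ribbon a).tail_mem.2 _ (hθ.ribbon a).head_mem.1
      rw [headContent, ribbonEnd, tailContent, usual_content, usual_content]
      omega
    have hsplit : (X.filter (· < ribbonEnd D θ a)).card =
        (X.filter (· < D.headContent θ a)).card +
        (X.filter fun x => D.headContent θ a ≤ x ∧ x < ribbonEnd D θ a).card := by
      rw [← Finset.card_union_of_disjoint]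
      · congr 1
        ext x
        simp only [Finset.mem_filter, Finset.mem_union]
        constructor
        · rintro ⟨hx, hx'⟩
          rcases lt_or_ge x (D.headContent θ a) with h | h
          · exact Or.inl ⟨hx, h⟩
          · exact Or.inr ⟨hx, h, hx'⟩
        · rintro (⟨hx, hx'⟩ | ⟨hx, -, hx'⟩)
          · exact ⟨hx, by omega⟩
          · exact ⟨hx, hx'⟩
      · rw [Finset.disjoint_filter]
        intro x _ h2 h3
        omega
    rw [signBelow, signBelow, hsplit, pow_add, ← mul_assoc, ← mul_pow]
    simp
  have hprodE : (∏ y ∈ Finset.univ.image (ribbonEnd D θ), if y ∈ X then (-1 : R) else 1) =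
      ∏ a, if ribbonEnd D θ a ∈ X then (-1 : R) else 1 :=
    Finset.prod_image fun a _ b _ h => hθ.ribbonEnd_injective h
  rw [hcount, hdet, hprodE]
  simp only [← mul_assoc, ← Finset.prod_mul_distrib]
  rw [Finset.prod_eq_one, one_mul]
  intro a _
  have q1 := signBelow_mul_self (R := R) X (D.headContent θ a)
  have q2 := signBelow_mul_self (R := R) X (ribbonEnd D θ a + 1)
  rw [signBelow_add_one] at q2 ⊢
  linear_combination (signBelow R X (ribbonEnd D θ a) * (if ribbonEnd D θ a ∈ X then -1 else 1)) *
    (signBelow R X (ribbonEnd D θ a) * (if ribbonEnd D θ a ∈ X then -1 else 1)) * q1 + q2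

end RShape.IsOuterDecomposition

end HamelGoulden

namespace HamelGoulden

/-! ### The kernel of two contents common to all determinants. -/

section Kernel

variable {R : Type*} [CommRing R]

/-- The function of two contents whose values are the entries of the determinants that define the
dual Grothendieck polynomials and the enumerators of the ribbons. -/
noncomputable def contentKernel (lam mu : YoungDiagram) (m : ℕ) (x α β : ℕ → R) (p q : ℤ) : R :=
  superElem
    (interval (gY m x α β) (1 - (q - 1) - mu.colLen (diagRow mu (q - 1) + (q - 1)).toNat)
      -- The maximum reproduces the truncated subtraction `lam.colLen i - 1` for columns of length
      -- zero; on nonempty diagonals it has no effect.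
      (max (diagRow lam p) 1 + m - 1))
    (interval (gZ m α β) (1 - mu.colLen (diagRow mu (q - 1) + (q - 1)).toNat)
      (diagRow lam p + p + m - 1)) (q - p)

variable (lam mu : YoungDiagram) (m : ℕ) (x α β : ℕ → R)

theorem contentKernel_self (p : ℤ) : contentKernel lam mu m x α β p p = 1 := by
  rw [contentKernel, sub_self, superElem_zero]

theorem contentKernel_of_lt {p q : ℤ} (h : q < p) : contentKernel lam mu m x α β p q = 0 :=
  superElem_of_neg _ _ (by omega)

/-- Column `j` and its length in `mu` are recovered from the content at its top by `diagRow`, and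
the column length in `lam` from the content at its bottom. Hence the entries depend on the two
contents only. -/
theorem dualGrothendieck_eq_det (n : ℕ) : dualGrothendieck n lam mu m x α β =
    Matrix.det (Matrix.of fun i j : Fin n =>
      contentKernel lam mu m x α β (columnEnd lam i) (columnEnd mu j)) := by
  unfold dualGrothendieck
  congr 1
  ext i j
  rw [Matrix.of_apply, Matrix.of_apply, superElem_interval, contentKernel]
  have h1 : columnEnd mu j - 1 = (j : ℕ) - mu.colLen j := by unfold columnEnd; ring
  have h2 : diagRow lam (columnEnd lam i) = lam.colLen i := diagRow_sub_colLen_add_one lam i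
  have h3 : ((mu.colLen j : ℤ) + (((j : ℕ) : ℤ) - mu.colLen j)).toNat = j := by omega
  rw [h1, diagRow_sub_colLen, h2, h3]
  have e1 : (1 : ℤ) - (((j : ℕ) : ℤ) - mu.colLen j) - mu.colLen j = 1 - (j : ℕ) := by ring
  have e2 : max (lam.colLen i : ℤ) 1 + m - 1 = ((lam.colLen i - 1 : ℕ) : ℤ) + m := by omega
  have e3 : (lam.colLen i : ℤ) + columnEnd lam i + m - 1 = m + (i : ℕ) := by unfold columnEnd; ring
  have e4 : columnEnd mu j - columnEnd lam i =
      (lam.colLen i : ℤ) - (i : ℕ) - mu.colLen j + (j : ℕ) := by unfold columnEnd; ring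
  rw [e1, e2, e3, e4]

end Kernel

/-! ### Extreme cells of diagonals, induced flags and ribbon enumerators. -/

namespace RShape

variable {lam mu : YoungDiagram} {hle : mu ≤ lam} {k : ℕ} {θ : Fin k → Finset (ℕ × ℕ)}

theorem mem_usual_diagonal {c : ℤ} {γ : ℕ × ℕ} : γ ∈ (usual lam mu hle).diagonal c ↔
    (γ.2 : ℤ) = γ.1 + c ∧ diagRow mu c ≤ γ.1 ∧ (γ.1 : ℤ) < diagRow lam c := by
  rw [diagonal, Finset.mem_filter, usual_content, cellContent]
  constructor
  · rintro ⟨h1, h2⟩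
    have h3 : (γ.2 : ℤ) = γ.1 + c := by omega
    exact ⟨h3, (mem_usual_cells_iff h3).mp h1⟩
  · rintro ⟨h1, h2⟩
    exact ⟨(mem_usual_cells_iff h1).mpr h2, by omega⟩

theorem leftmost_usual {c : ℤ} (hc : diagRow mu c < diagRow lam c) :
    (usual lam mu hle).leftmost c = ((diagRow mu c).toNat, (diagRow mu c + c).toNat) := by
  have h1 := diagRow_nonneg mu c
  have h2 := diagRow_add_nonneg mu c
  have h : ((diagRow mu c).toNat, (diagRow mu c + c).toNat) ∈ (usual lam mu hle).diagonal c :=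
    mem_usual_diagonal.mpr (by dsimp only; omega)
  refine Prod.ext (min_image_eq_of_mem (f := Prod.fst) h fun δ hδ => ?_)
    (min_image_eq_of_mem (f := Prod.snd) h fun δ hδ => ?_)
  all_goals
    rw [mem_usual_diagonal] at hδ
    dsimp only
    omega

theorem rightmost_usual {c : ℤ} (hc : diagRow mu c < diagRow lam c) :
    (usual lam mu hle).rightmost c =
      ((diagRow lam c - 1).toNat, (diagRow lam c - 1 + c).toNat) := by
  have h1 := diagRow_nonneg mu c
  have h2 := diagRow_add_nonneg mu c
  have h : ((diagRow lam c - 1).toNat, (diagRow lam c - 1 + c).toNat) ∈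
      (usual lam mu hle).diagonal c :=
    mem_usual_diagonal.mpr (by dsimp only; omega)
  refine Prod.ext (sup_eq_of_mem (f := Prod.fst) h fun δ hδ => ?_)
    (sup_eq_of_mem (f := Prod.snd) h fun δ hδ => ?_)
  all_goals
    rw [mem_usual_diagonal] at hδ
    dsimp only
    omega

/-- In a connected shape, the contents between a head and a tail are contents of cells. -/
theorem IsOuterDecomposition.diagRow_lt (hθ : (usual lam mu hle).IsOuterDecomposition θ)
    (hconn : (usual lam mu hle).IsConnected) {i j : Fin k} {c : ℤ}
    (h : (usual lam mu hle).headContent θ i ≤ c) (h' : c ≤ (usual lam mu hle).tailContent θ j) :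
    diagRow mu c < diagRow lam c := by
  have hi := hθ.mem_cells (hθ.ribbon i).head_mem.1
  have hj := hθ.mem_cells (hθ.ribbon j).tail_mem.1
  rw [headContent, usual_content] at h
  rw [tailContent, usual_content] at h'
  obtain ⟨δ, hδ, rfl⟩ : ∃ δ ∈ (usual lam mu hle).cells, cellContent δ = c := by
    rcases h'.lt_or_eq with h' | h'
    · obtain ⟨δ, hδ, hc, -⟩ := exists_step hconn hi hj h h'
      exact ⟨δ, hδ, hc⟩
    · exact ⟨_, hj, h'.symm⟩
  have := (mem_usual_cells_iff (i := δ.1) (j := δ.2) (x := cellContent δ)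
    (by unfold cellContent; ring)).mp hδ
  omega

section Flags

variable {m : ℕ} {a b : ℕ → ℤ}

theorem inducedA_eq (ha : ∀ i : ℕ, a i = -((i : ℤ) + 1) + 2) (i j : Fin k) (r : ℕ) :
    (usual lam mu hle).inducedA θ a i j r =
      -(usual lam mu hle).content ((usual lam mu hle).cellm θ i j r)
        - mu.colLen ((usual lam mu hle).cellm θ i j r).2 + 1 := by
  rw [inducedA, ha, usual_content, cellContent]
  change _ - ((mu.colLen _ : ℤ) + 1) + _ = _
  ring

theorem inducedB_eq (hb : ∀ i : ℕ, b i = (lam.colLen i : ℤ) + m - 1) (i j : Fin k) (r : ℕ) :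
    (usual lam mu hle).inducedB θ b i j r =
      (((usual lam mu hle).cellM θ i j r).1 + 1 : ℤ) + m - 1 := by
  rw [inducedB, hb]
  change _ - (lam.colLen _ : ℤ) + _ = _
  ring

theorem isColumnFlags_usual (ha : ∀ i : ℕ, a i = -((i : ℤ) + 1) + 2)
    (hb : ∀ i : ℕ, b i = (lam.colLen i : ℤ) + m - 1) : (usual lam mu hle).IsColumnFlags a b := by
  intro i _
  have h1 := mu.colLen_anti i (i + 1) (Nat.le_succ i)
  rw [ha, ha, hb, hb]
  change _ ≤ (mu.colLen i : ℤ) - mu.colLen (i + 1) + 1 ∧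
    _ ≤ (lam.colLen i : ℤ) - lam.colLen (i + 1) + 1
  push_cast
  omega

theorem diagRow_add_monotone (ν : YoungDiagram) : Monotone fun c : ℤ => diagRow ν c + c := by
  refine monotone_int_of_le_succ fun c => ?_
  have := diagRow_step ν (c + 1)
  rw [add_sub_cancel_right] at this
  omega

variable {i j : Fin k} {r : ℕ}

/-- By connectedness the diagonal of this content is nonempty, and its leftmost cell lies in row
`diagRow mu`. So the flag depends only on the content and is the lower limit in `contentKernel`. -/
theorem inducedA_hash (hθ : (usual lam mu hle).IsOuterDecomposition θ)
    (hconn : (usual lam mu hle).IsConnected)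
    (hij : (usual lam mu hle).headContent θ i ≤ (usual lam mu hle).tailContent θ j)
    (hr : r ≤ (usual lam mu hle).rightSteps θ ((usual lam mu hle).headContent θ i)
      ((usual lam mu hle).tailContent θ j))
    (ha : ∀ i : ℕ, a i = -((i : ℤ) + 1) + 2) :
    (usual lam mu hle).inducedA θ a i j r = 1 - ((usual lam mu hle).hash θ i j).topContent r -
      mu.colLen (diagRow mu (((usual lam mu hle).hash θ i j).topContent r) +
        ((usual lam mu hle).hash θ i j).topContent r).toNat := by
  have htop : ((usual lam mu hle).hash θ i j).topContent r = _ :=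
    (usual lam mu hle).strip_topContent θ hij hr
  have h := (usual lam mu hle).columnStart_le_columnTop θ hij hr
  have hc := hθ.diagRow_lt hconn
    (((usual lam mu hle).le_columnStart θ r).trans (h.1.trans htop.ge)) (htop.le.trans h.2.1)
  have h1 := diagRow_nonneg mu (((usual lam mu hle).hash θ i j).topContent r)
  have h2 := diagRow_add_nonneg mu (((usual lam mu hle).hash θ i j).topContent r)
  rw [inducedA_eq ha, cellm, leftmost_usual hc, usual_content, cellContent]
  dsimp only
  omega

/-- The rightmost cell of a nonempty diagonal is in row `diagRow lam`, counted from one. The form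
with the maximum matches the first alphabet of `contentKernel`, the other one the second. -/
theorem inducedB_hash (hθ : (usual lam mu hle).IsOuterDecomposition θ)
    (hconn : (usual lam mu hle).IsConnected)
    (hij : (usual lam mu hle).headContent θ i ≤ (usual lam mu hle).tailContent θ j)
    (hr : r ≤ (usual lam mu hle).rightSteps θ ((usual lam mu hle).headContent θ i)
      ((usual lam mu hle).tailContent θ j))
    (hb : ∀ i : ℕ, b i = (lam.colLen i : ℤ) + m - 1) :
    (usual lam mu hle).inducedB θ b i j r =
      max (diagRow lam (((usual lam mu hle).hash θ i j).botContent r)) 1 + m - 1 ∧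
    (usual lam mu hle).inducedB θ b i j r =
      diagRow lam (((usual lam mu hle).hash θ i j).botContent r) + m - 1 := by
  have hbot : ((usual lam mu hle).hash θ i j).botContent r = _ :=
    (usual lam mu hle).strip_botContent θ hij hr
  have h := (usual lam mu hle).columnStart_le_columnTop θ hij hr
  have hc := hθ.diagRow_lt hconn
    (((usual lam mu hle).le_columnStart θ r).trans hbot.ge) (hbot.le.trans (h.1.trans h.2.1))
  have h1 := diagRow_nonneg mu (((usual lam mu hle).hash θ i j).botContent r)
  rw [inducedB_eq hb, cellM, rightmost_usual hc]
  dsimp only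
  omega

/-- The bounds are differences of consecutive top or bottom contents. The inequalities follow
because along the strip `mu.colLen` of the recovered column decreases weakly and `diagRow lam c + c`
increases weakly. -/
theorem isColumnFlags_hash (hθ : (usual lam mu hle).IsOuterDecomposition θ)
    (hconn : (usual lam mu hle).IsConnected) (ha : ∀ i : ℕ, a i = -((i : ℤ) + 1) + 2)
    (hb : ∀ i : ℕ, b i = (lam.colLen i : ℤ) + m - 1) (i j : Fin k) :
    ((usual lam mu hle).hash θ i j).IsColumnFlags ((usual lam mu hle).inducedA θ a i j)
      ((usual lam mu hle).inducedB θ b i j) := by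
  intro r hr
  -- The condition in the definition of column flags forces column `r + 1` to exist, so the strip is
  -- nonempty.
  have hcols : r + 1 < ((usual lam mu hle).hash θ i j).numCols := by
    by_contra! hc
    rw [colLen_eq_zero le_rfl hc] at hr
    omega
  have hij : (usual lam mu hle).headContent θ i ≤ (usual lam mu hle).tailContent θ j := by
    by_contra! hc
    rw [hash, strip_numCols_of_lt _ _ hc] at hcols
    omega
  rw [hash, strip_numCols _ _ hij] at hcols
  have hr0 : r ≤ (usual lam mu hle).rightSteps θ ((usual lam mu hle).headContent θ i)
    ((usual lam mu hle).tailContent θ j) := by omega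
  have hr1 : r + 1 ≤ (usual lam mu hle).rightSteps θ ((usual lam mu hle).headContent θ i)
    ((usual lam mu hle).tailContent θ j) := by omega
  rw [inducedA_hash hθ hconn hij hr0 ha, inducedA_hash hθ hconn hij hr1 ha,
    (inducedB_hash hθ hconn hij hr0 hb).2, (inducedB_hash hθ hconn hij hr1 hb).2]
  have hlt := columnStart_strictMono ((usual lam mu hle).eventually_not_goesUp θ)
    ((usual lam mu hle).headContent θ i) (Nat.lt_add_one r)
  have htop : ((usual lam mu hle).hash θ i j).topContent r ≤
      ((usual lam mu hle).hash θ i j).topContent (r + 1) := by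
    have h0 := (usual lam mu hle).columnStart_le_columnTop θ hij hr0
    have h1 := (usual lam mu hle).columnStart_le_columnTop θ hij hr1
    rw [hash, strip_topContent _ _ hij hr0, strip_topContent _ _ hij hr1]
    have := (h0.2.2 _ h0.2.1).mpr le_rfl
    omega
  have hbot : ((usual lam mu hle).hash θ i j).botContent r ≤
      ((usual lam mu hle).hash θ i j).botContent (r + 1) := by
    rw [hash, strip_botContent _ _ hij hr0, strip_botContent _ _ hij hr1]
    omega
  have h1 := mu.colLen_anti _ _ (Int.toNat_le_toNat (diagRow_add_monotone mu htop))
  have h2 := diagRow_add_monotone lam hbot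
  dsimp only at h1 h2
  constructor
  · have : ((usual lam mu hle).hash θ i j).topContent (r + 1) -
        ((usual lam mu hle).hash θ i j).topContent r =
        (((usual lam mu hle).hash θ i j).mu.colLen r : ℤ) -
          ((usual lam mu hle).hash θ i j).mu.colLen (r + 1) + 1 := by
      simp only [topContent]
      push_cast
      ring
    omega
  · have : ((usual lam mu hle).hash θ i j).botContent (r + 1) -
        ((usual lam mu hle).hash θ i j).botContent r =
        (((usual lam mu hle).hash θ i j).lam.colLen r : ℤ) -
          ((usual lam mu hle).hash θ i j).lam.colLen (r + 1) + 1 := by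
      simp only [botContent]
      push_cast
      ring
    omega

theorem det_fin_congr {R : Type*} [CommRing R] {s t : ℕ} (h : s = t) (f g : ℕ → ℕ → R)
    (hfg : ∀ i < t, ∀ j < t, f i j = g i j) :
    Matrix.det (Matrix.of fun i j : Fin s => f i j) =
      Matrix.det (Matrix.of fun i j : Fin t => g i j) := by
  subst h
  congr 1
  ext i j
  exact hfg i i.2 j j.2

theorem superElem_hash_eq {R : Type*} [CommRing R]
    (hθ : (usual lam mu hle).IsOuterDecomposition θ) (hconn : (usual lam mu hle).IsConnected)
    (x α β : ℕ → R) (ha : ∀ i : ℕ, a i = -((i : ℤ) + 1) + 2)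
    (hb : ∀ i : ℕ, b i = (lam.colLen i : ℤ) + m - 1)
    (hij : (usual lam mu hle).headContent θ i ≤ (usual lam mu hle).tailContent θ j) {s t : ℕ}
    (hs : s ≤ (usual lam mu hle).rightSteps θ ((usual lam mu hle).headContent θ i)
      ((usual lam mu hle).tailContent θ j))
    (ht : t ≤ (usual lam mu hle).rightSteps θ ((usual lam mu hle).headContent θ i)
      ((usual lam mu hle).tailContent θ j)) :
    superElem
      (interval (gY m x α β) ((usual lam mu hle).inducedA θ a i j t)
        ((usual lam mu hle).inducedB θ b i j s))
      (interval (gZ m α β) ((usual lam mu hle).inducedA θ a i j t +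
          ((usual lam mu hle).hash θ i j).topContent t)
        ((usual lam mu hle).inducedB θ b i j s + ((usual lam mu hle).hash θ i j).botContent s))
      ((((usual lam mu hle).hash θ i j).lam.colLen s : ℤ) - s -
        ((usual lam mu hle).hash θ i j).mu.colLen t + t) =
    contentKernel lam mu m x α β
      (columnStart ((usual lam mu hle).GoesUp θ) ((usual lam mu hle).headContent θ i) s)
      ((usual lam mu hle).columnTop θ ((usual lam mu hle).headContent θ i)
        ((usual lam mu hle).tailContent θ j) t + 1) := by
  have hA := inducedA_hash hθ hconn hij ht ha
  have hB := inducedB_hash (m := m) (b := b) hθ hconn hij hs hb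
  have hbot : ((usual lam mu hle).hash θ i j).botContent s = _ :=
    (usual lam mu hle).strip_botContent θ hij hs
  have htop : ((usual lam mu hle).hash θ i j).topContent t = _ :=
    (usual lam mu hle).strip_topContent θ hij ht
  have hn : (((usual lam mu hle).hash θ i j).lam.colLen s : ℤ) - s -
      ((usual lam mu hle).hash θ i j).mu.colLen t + t =
      ((usual lam mu hle).hash θ i j).topContent t + 1 -
        ((usual lam mu hle).hash θ i j).botContent s := by
    simp only [topContent, botContent]
    ring
  rw [hn, ← hbot, ← htop]
  generalize ((usual lam mu hle).hash θ i j).topContent t = c at *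
  generalize ((usual lam mu hle).hash θ i j).botContent s = p at *
  generalize (usual lam mu hle).inducedA θ a i j t = A at *
  generalize (usual lam mu hle).inducedB θ b i j s = B at *
  rw [contentKernel, add_sub_cancel_right, ← hB.1, ← hA,
    show (1 : ℤ) - mu.colLen (diagRow mu c + c).toNat = A + c by omega,
    show diagRow lam p + p + m - 1 = B + p by omega]

/-- The content after the top of a column is the bottom content of the next one, or the end of the
strip for the last column. This makes the matrix of the enumerator the Hessenberg matrix of `K`. -/
theorem ribbonG_eq_stripDet {R : Type*} [CommRing R]
    (hθ : (usual lam mu hle).IsOuterDecomposition θ) (hconn : (usual lam mu hle).IsConnected)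
    (x α β : ℕ → R) (ha : ∀ i : ℕ, a i = -((i : ℤ) + 1) + 2)
    (hb : ∀ i : ℕ, b i = (lam.colLen i : ℤ) + m - 1) (i j : Fin k) :
    (usual lam mu hle).ribbonG θ a b m x α β i j =
      stripDet ((usual lam mu hle).GoesUp θ) (contentKernel lam mu m x α β)
        ((usual lam mu hle).headContent θ i)
        (IsOuterDecomposition.ribbonEnd (usual lam mu hle) θ j) := by
  unfold IsOuterDecomposition.ribbonEnd
  rw [ribbonG]
  split_ifs with hdef
  · unfold HashDefined at hdef
    rw [flaggedG, flaggedSchur]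
    rcases lt_or_ge ((usual lam mu hle).tailContent θ j) ((usual lam mu hle).headContent θ i)
      with hij | hij
    -- The only defined empty case is head content equal to tail content plus one, where the
    -- determinant is of size zero.
    · rw [show (usual lam mu hle).headContent θ i = (usual lam mu hle).tailContent θ j + 1 by omega,
        stripDet_self]
      have : IsEmpty (Fin ((usual lam mu hle).hash θ i j).numCols) := by
        rw [hash, strip_numCols_of_lt _ _ hij]
        infer_instance
      exact Matrix.det_isEmpty
    · rw [stripDet_of_lt _ _ (by omega), hessenberg, add_sub_cancel_right]
      refine det_fin_congr (strip_numCols _ _ hij) (fun s t => superElem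
        (interval (gY m x α β) ((usual lam mu hle).inducedA θ a i j t)
          ((usual lam mu hle).inducedB θ b i j s))
        (interval (gZ m α β) ((usual lam mu hle).inducedA θ a i j t +
            ((usual lam mu hle).hash θ i j).topContent t)
          ((usual lam mu hle).inducedB θ b i j s + ((usual lam mu hle).hash θ i j).botContent s))
        ((((usual lam mu hle).hash θ i j).lam.colLen s : ℤ) - s -
          ((usual lam mu hle).hash θ i j).mu.colLen t + t)) (fun s t => if t =
        rightCount ((usual lam mu hle).GoesUp θ) ((usual lam mu hle).headContent θ i)
          ((usual lam mu hle).tailContent θ j) then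
          contentKernel lam mu m x α β (columnStart ((usual lam mu hle).GoesUp θ)
            ((usual lam mu hle).headContent θ i) s) ((usual lam mu hle).tailContent θ j + 1)
        else contentKernel lam mu m x α β (columnStart ((usual lam mu hle).GoesUp θ)
            ((usual lam mu hle).headContent θ i) s) (columnStart ((usual lam mu hle).GoesUp θ)
            ((usual lam mu hle).headContent θ i) (t + 1))) fun s hs t ht => ?_
      have hs' : s ≤ (usual lam mu hle).rightSteps θ ((usual lam mu hle).headContent θ i)
        ((usual lam mu hle).tailContent θ j) := by omega
      have ht' : t ≤ (usual lam mu hle).rightSteps θ ((usual lam mu hle).headContent θ i)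
        ((usual lam mu hle).tailContent θ j) := by omega
      have htop : (usual lam mu hle).columnTop θ ((usual lam mu hle).headContent θ i)
          ((usual lam mu hle).tailContent θ j) t + 1 = if t =
          rightCount ((usual lam mu hle).GoesUp θ) ((usual lam mu hle).headContent θ i)
          ((usual lam mu hle).tailContent θ j) then (usual lam mu hle).tailContent θ j + 1 else
          columnStart ((usual lam mu hle).GoesUp θ) ((usual lam mu hle).headContent θ i) (t + 1) := by
        rw [columnTop, rightSteps_eq]
        split_ifs
        · rfl
        · ring
      rw [superElem_hash_eq hθ hconn x α β ha hb hij hs' ht', htop]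
      split_ifs <;> rfl
  · unfold HashDefined at hdef
    rw [stripDet, if_pos (by omega)]

end Flags

end RShape

end HamelGoulden

theorem mainTheorem3 {R : Type*} [CommRing R] (lam mu : YoungDiagram) (hle : mu ≤ lam)
    (hconn : (RShape.usual lam mu hle).IsConnected)
    {k : ℕ} (θ : Fin k → Finset (ℕ × ℕ))
    (hθ : (RShape.usual lam mu hle).IsOuterDecomposition θ)
    (m : ℕ) (x α β : ℕ → R) (a b : ℕ → ℤ)
    (ha : ∀ i : ℕ, a i = -((i : ℤ) + 1) + 2)
    (hb : ∀ i : ℕ, b i = (lam.colLen i : ℤ) + m - 1) :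
    -- `a`, `b` and the induced ribbon flags are column flags
    (RShape.usual lam mu hle).IsColumnFlags a b ∧
    (∀ i j : Fin k, ((RShape.usual lam mu hle).hash θ i j).IsColumnFlags
      ((RShape.usual lam mu hle).inducedA θ a i j) ((RShape.usual lam mu hle).inducedB θ b i j)) ∧
    -- the explicit form of the induced ribbon flags
    (∀ i j : Fin k, ∀ r < ((RShape.usual lam mu hle).hash θ i j).numCols,
      (RShape.usual lam mu hle).inducedA θ a i j r =
        -(RShape.usual lam mu hle).content ((RShape.usual lam mu hle).cellm θ i j r)
          - mu.colLen ((RShape.usual lam mu hle).cellm θ i j r).2 + 1 ∧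
      (RShape.usual lam mu hle).inducedB θ b i j r =
        (((RShape.usual lam mu hle).cellM θ i j r).1 + 1 : ℤ) + m - 1) ∧
    -- the determinantal formula
    (∀ n : ℕ, lam.rowLen 0 ≤ n →
      dualGrothendieck n lam mu m x α β =
        Matrix.det (Matrix.of fun i j : Fin k =>
          (RShape.usual lam mu hle).ribbonG θ a b m x α β i j)) := by
  refine ⟨RShape.isColumnFlags_usual ha hb, RShape.isColumnFlags_hash hθ hconn ha hb,
    fun i j r _ => ⟨RShape.inducedA_eq ha i j r, RShape.inducedB_eq hb i j r⟩, fun n hn => ?_⟩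
  have h1 := contentKernel_self lam mu m x α β
  have h0 : ∀ p q : ℤ, q < p → contentKernel lam mu m x α β p q = 0 :=
    fun p q => contentKernel_of_lt lam mu m x α β
  rw [dualGrothendieck_eq_det, ← det_columns hle hn _ h1 h0,
    hθ.det_ribbons hn _ h1 h0 fun i j c hc hc' => ?_]
  · congr 1
    ext i j
    exact (RShape.ribbonG_eq_stripDet hθ hconn x α β ha hb i j).symm
  -- Connectedness gives cells of content `c - 1`, so membership in `rightContents` is decided by
  -- their direction and not by the convention for empty diagonals.
  · have h := hθ.diagRow_lt hconn (i := i) (j := j) (c := c - 1) (by omega)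
      (by unfold RShape.IsOuterDecomposition.ribbonEnd at hc'; omega)
    exact RShape.IsOuterDecomposition.mem_rightContents hn le_rfl h
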